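/- Let $1\le m\le n$, let $(M,\omega)$ be a Kähler manifold of complex dimension $n$, and let $\Omega\subset M$ be open and relatively compact with smooth, non-empty boundary. A real $(1,1)$-form $\alpha$ is called $m$-positive if $\alpha^k\wedge\omega^{n-k}\ge 0$ for $1\le k\le m$. An upper semicontinuous, locally integrable function $\varphi:\Omega\to[-\infty,\infty)$ is called $m$-subharmonic, $\varphi\in m\mathrm{SH}(\Omega)$, if $i\partial\bar\partial\varphi\wedge\alpha_2\wedge\dots\wedge\alpha_m\wedge\omega^{n-m}\ge 0$ in the sense of currents for all smooth $m$-positive $(1,1)$-forms $\alpha_2,\dots,\alpha_m$. For continuous real $(1,1)$-forms, $\alpha\ge_m\beta$ means that $\alpha-\beta$ is $m$-positive. A set is $m$-polar if it is locally contained in the $-\infty$-set of an $m$-subharmonic function. Assume that $\Omega$ is strongly $m$-pseudoconvex, with a defining function $\rho$ that is smooth up to the boundary ($\rho<0$ on $\Omega$, $\rho=0$ and $d\rho\neq0$ on $\partial\Omega$) and satisfies $i\partial\bar\partial\rho\ge_m\varepsilon_0\omega$ on $\Omega$ for some $\varepsilon_0>0$. For $p\in\mathbb R$ and $s\ge0$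 set $K_0(s)=\log s$ and $K_p(s)=\frac1p s^p$ if $p\ne0$ (so $K_p(0)=-\infty$ for $p\le0$ and $K_p(0)=0$ for $p>0$), and use the convention $0\cdot\infty=0$. Let $\varepsilon,\delta>0$ and let $h\in m\mathrm{SH}(\Omega)$ be such that $0\le h\le1$, the set $\{h=0\}$ is non-empty and $m$-polar, $h$ is of class $C^2$ on $\{h>0\}$ (in a neighbourhood of each of its points), and $i\partial\bar\partial h\ge_m\varepsilon h^{1-\delta}\omega$ on $\{h>0\}$. Let $p\le0$, and suppose that $$i\partial\bar\partial K_p(h)\ \ge_m\ -c\,h^{p-1+\tilde\gamma}\,\omega\qquad\text{on }\{h>0\}$$ for some $c>0$ and $\tilde\gamma>1-\delta$. Fix $0<\gamma<\min\{\tilde\gamma+\delta-1,\ \delta/2\}$, let $\ell$ be the smallest integer with $p+\ell\gamma>0$, and put $q_j=p+j\gamma$ for $1\le j\le\ell$. Let $\theta=\theta_0,\theta_1,\dots,\theta_\ell\in C^\infty(\overline\Omega)$ satisfy $0\le\theta_j\le1$, $\theta_\ell=1$ and $\operatorname{Supp}(\theta_{j-1})\subset\{\theta_j=1\}^\circ$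 in $\Omega$ for $1\le j\le\ell$, and let $a_1,\dots,a_\ell>0$. Then there is $C_0$ such that for all $C\ge C_0$ $$\theta K_p(h)+\sum_{j=1}^{\ell}a_j\theta_jK_{q_j}(h)+C\rho\ \in\ m\mathrm{SH}(\Omega).$$ -/

import Mathlib

open Set Filter Topology MeasureTheory
open scoped Manifold ContDiff

noncomputable section

/-- The model space `ℂⁿ`. -/
abbrev Cn (n : ℕ) : Type := Fin n → ℂ

/-! ### Wirtinger derivatives and `(1,1)`-forms on open subsets of `ℂⁿ`

A real `(1,1)`-form `α = i ∑ A j k dz_j ∧ dz̄_k` is represented by its Hermitian coefficient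
matrix `A`. -/

/-- The Wirtinger derivative `∂F/∂z_j = (∂F/∂x_j - i ∂F/∂y_j) / 2`. -/
def wirtinger {n : ℕ} (j : Fin n) (F : Cn n → ℂ) (z : Cn n) : ℂ :=
  (fderiv ℝ F z (Pi.single j 1) - Complex.I * fderiv ℝ F z (Pi.single j Complex.I)) / 2

/-- The Wirtinger derivative `∂F/∂z̄_j = (∂F/∂x_j + i ∂F/∂y_j) / 2`. -/
def wirtingerBar {n : ℕ} (j : Fin n) (F : Cn n → ℂ) (z : Cn n) : ℂ :=
  (fderiv ℝ F z (Pi.single j 1) + Complex.I * fderiv ℝ F z (Pi.single j Complex.I)) / 2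

/-- The coefficient matrix `(∂²f/∂z_j∂z̄_k)` of `i∂∂̄f` for a real function `f`. -/
def leviMatrix {n : ℕ} (f : Cn n → ℝ) (z : Cn n) : Matrix (Fin n) (Fin n) ℂ :=
  Matrix.of fun j k => wirtinger j (wirtingerBar k fun w => (f w : ℂ)) z

/-- The coefficient of `α₁ ∧ … ∧ αₙ` with respect to the positive volume form
`(i dz₁∧dz̄₁) ∧ … ∧ (i dzₙ∧dz̄ₙ)`, where `αᵢ = i ∑ (A i) j k dz_j ∧ dz̄_k`. -/
def wedgeCoeff {n : ℕ} (A : Fin n → Matrix (Fin n) (Fin n) ℂ) : ℂ :=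
  ∑ σ : Equiv.Perm (Fin n), ∑ τ : Equiv.Perm (Fin n),
    ((Equiv.Perm.sign σ : ℤ) : ℂ) * ((Equiv.Perm.sign τ : ℤ) : ℂ) * ∏ i, A i (σ i) (τ i)

/-- The real `(1,1)`-form with matrix `A` is `m`-positive with respect to the Hermitian form `ω`
with matrix `G`: `α^k ∧ ω^(n-k) ≥ 0` for `1 ≤ k ≤ m`. (The coefficient of `α^k ∧ ω^(n-k)` is real
when `A` and `G` are Hermitian.) -/
def IsMPositive {n : ℕ} (m : ℕ) (G A : Matrix (Fin n) (Fin n) ℂ) : Prop :=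
  A.IsHermitian ∧ ∀ k : ℕ, 1 ≤ k → k ≤ m →
    0 ≤ (wedgeCoeff fun i : Fin n => if (i : ℕ) < k then A else G).re

/-! ### Kähler metrics -/

/-- The coefficient matrix, at the point `z` of the target of the chart `e`, of a family `H` of
sesquilinear forms on the holomorphic tangent spaces: the entry `(j, k)` is `H(∂_j, ∂_k)`. The
forms are conjugate-linear in their first slot, hence the order of the arguments. -/
def chartCoeff {n : ℕ} {M : Type*} [TopologicalSpace M] [ChartedSpace (Cn n) M]
    (H : ∀ x : M, TangentSpace 𝓘(ℂ, Cn n) x →ₗ⋆[ℂ] TangentSpace 𝓘(ℂ, Cn n) x →ₗ[ℂ] ℂ)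
    (e : OpenPartialHomeomorph M (Cn n)) (z : Cn n) : Matrix (Fin n) (Fin n) ℂ :=
  Matrix.of fun j k => H (e.symm z)
    (mfderiv 𝓘(ℂ, Cn n) 𝓘(ℂ, Cn n) e.symm z (Pi.single k (1 : ℂ) : Cn n))
    (mfderiv 𝓘(ℂ, Cn n) 𝓘(ℂ, Cn n) e.symm z (Pi.single j (1 : ℂ) : Cn n))

/-- A (smooth) Kähler metric on a complex manifold, given by its Hermitian inner products; in a
holomorphic chart its Kähler form is `ω = i ∑ g_{jk} dz_j ∧ dz̄_k`, and `dω = 0` says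
`∂g_{jk}/∂z_l = ∂g_{lk}/∂z_j`. -/
structure KahlerMetric (n : ℕ) (M : Type*) [TopologicalSpace M] [ChartedSpace (Cn n) M] where
  form : ∀ x : M, TangentSpace 𝓘(ℂ, Cn n) x →ₗ⋆[ℂ] TangentSpace 𝓘(ℂ, Cn n) x →ₗ[ℂ] ℂ
  hermitian : ∀ (x : M) (v w : TangentSpace 𝓘(ℂ, Cn n) x),
    form x v w = starRingEnd ℂ (form x w v)
  pos : ∀ (x : M) (v : TangentSpace 𝓘(ℂ, Cn n) x), v ≠ 0 → 0 < (form x v v).re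
  smooth : ∀ e ∈ atlas (Cn n) M, ∀ j k : Fin n,
    ContDiffOn ℝ ∞ (fun z => chartCoeff form e z j k) e.target
  closed : ∀ e ∈ atlas (Cn n) M, ∀ z ∈ e.target, ∀ j k l : Fin n,
    wirtinger l (fun w => chartCoeff form e w j k) z =
      wirtinger j (fun w => chartCoeff form e w l k) z

section Manifold

variable {n : ℕ} {M : Type*} [TopologicalSpace M] [ChartedSpace (Cn n) M]

/-- The coefficient matrix of the Kähler form in the chart `e`. -/
def KahlerMetric.coeff (g : KahlerMetric n M) (e : OpenPartialHomeomorph M (Cn n)) (z : Cn n) :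
    Matrix (Fin n) (Fin n) ℂ :=
  chartCoeff g.form e z

/-- `i∂∂̄f ≥_m s ω` at the point `x`, for a function `f` of class `C²` near `x` and a real
number `s`, that is, the form `i∂∂̄f - s ω` is `m`-positive at `x`. -/
def LeviGEAt (g : KahlerMetric n M) (m : ℕ) (f : M → ℝ) (s : ℝ) (x : M) : Prop :=
  ∀ e ∈ atlas (Cn n) M, x ∈ e.source →
    IsMPositive m (g.coeff e (e x))
      (leviMatrix (fun z => f (e.symm z)) (e x) - (s : ℂ) • g.coeff e (e x))

/-! ### `m`-subharmonic functions -/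

/-- The form `α₂ ∧ … ∧ α_m ∧ ω^(n-m)` on the target of a chart, paired with the elementary form
`i dz_j ∧ dz̄_k`: the coefficient of `(i dz_j ∧ dz̄_k) ∧ α₂ ∧ … ∧ α_m ∧ ω^(n-m)`.
The form `α_{i+1}` has the coefficient matrix `A i`, for `1 ≤ i < m`. -/
def cofactorCoeff (g : KahlerMetric n M) (m : ℕ) (e : OpenPartialHomeomorph M (Cn n))
    (A : ℕ → Cn n → Matrix (Fin n) (Fin n) ℂ) (j k : Fin n) (z : Cn n) : ℂ :=
  wedgeCoeff fun i : Fin n =>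
    if (i : ℕ) = 0 then Matrix.single j k 1 else if (i : ℕ) < m then A i z else g.coeff e z

/-- `φ` is `m`-subharmonic on the open set `U`: it takes values in `[-∞, ∞)`, is upper
semicontinuous, locally integrable (so that the current `i∂∂̄φ` is defined), and `i∂∂̄φ` is
`m`-positive as a current. The last condition is local; in a chart it says that
`i∂∂̄φ ∧ α₂ ∧ … ∧ α_m ∧ ω^(n-m) ≥ 0` for all smooth `m`-positive `(1,1)`-forms `α₂, …, α_m`,
that is, `∫ φ i∂∂̄(χ α₂ ∧ … ∧ α_m ∧ ω^(n-m)) ≥ 0` for all test functions `χ ≥ 0`. -/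
structure IsMSubharmonicOn (g : KahlerMetric n M) (m : ℕ) (U : Set M) (φ : M → EReal) :
    Prop where
  ne_top : ∀ x ∈ U, φ x ≠ ⊤
  usc : UpperSemicontinuousOn φ U
  ae_ne_bot : ∀ e ∈ atlas (Cn n) M,
    ∀ᵐ z ∂(volume.restrict (e.target ∩ e.symm ⁻¹' U)), φ (e.symm z) ≠ ⊥
  locallyIntegrable : ∀ e ∈ atlas (Cn n) M,
    LocallyIntegrableOn (fun z => (φ (e.symm z)).toReal) (e.target ∩ e.symm ⁻¹' U) volume
  current_nonneg : ∀ e ∈ atlas (Cn n) M, ∀ A : ℕ → Cn n → Matrix (Fin n) (Fin n) ℂ,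
    (∀ i, 1 ≤ i → i < m →
      (∀ j k, ContDiffOn ℝ ∞ (fun z => A i z j k) (e.target ∩ e.symm ⁻¹' U)) ∧
      ∀ z ∈ e.target ∩ e.symm ⁻¹' U, IsMPositive m (g.coeff e z) (A i z)) →
    ∀ χ : Cn n → ℝ, ContDiff ℝ ∞ χ → HasCompactSupport χ →
      tsupport χ ⊆ e.target ∩ e.symm ⁻¹' U → (∀ z, 0 ≤ χ z) →
      0 ≤ ∫ z, (φ (e.symm z)).toReal *
        (∑ j, ∑ k, wirtinger j
          (wirtingerBar k fun w => (χ w : ℂ) * cofactorCoeff g m e A j k w) z).re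

/-- A set `E` is `m`-polar in the open set `U`: locally it is contained in the `-∞`-set of an
`m`-subharmonic function. -/
def IsMPolarIn (g : KahlerMetric n M) (m : ℕ) (U E : Set M) : Prop :=
  ∀ x ∈ E, ∃ V : Set M, IsOpen V ∧ x ∈ V ∧ V ⊆ U ∧
    ∃ v : M → EReal, IsMSubharmonicOn g m V v ∧ ∀ y ∈ E ∩ V, v y = ⊥

/-! ### The setting -/

/-- `Ω` is a relatively compact domain with smooth non-empty boundary in the Kähler manifold `M`,
and `ρ` is a defining function of it, smooth up to the boundary and strictly `m`-subharmonic. -/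
structure IsStronglyMPseudoconvex (g : KahlerMetric n M) (m : ℕ) (Ω : Set M) (ρ : M → ℝ) :
    Prop where
  isOpen : IsOpen Ω
  isCompact_closure : IsCompact (closure Ω)
  frontier_nonempty : (frontier Ω).Nonempty
  smooth : ∃ W : Set M, IsOpen W ∧ closure Ω ⊆ W ∧
    ContMDiffOn 𝓘(ℝ, Cn n) 𝓘(ℝ, ℝ) ∞ ρ W
  neg : ∀ x ∈ Ω, ρ x < 0
  eq_zero : ∀ x ∈ frontier Ω, ρ x = 0
  mfderiv_ne_zero : ∀ x ∈ frontier Ω, mfderiv 𝓘(ℝ, Cn n) 𝓘(ℝ, ℝ) ρ x ≠ 0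
  strict : ∃ ε₀ : ℝ, 0 < ε₀ ∧ ∀ x ∈ Ω, LeviGEAt g m ρ ε₀ x

/-- The standing assumptions on `h`: it is `m`-subharmonic on `Ω` with `0 ≤ h ≤ 1`, its zero set
is non-empty and `m`-polar, it is `C²` on `{h > 0}`, and `i∂∂̄h ≥_m ε h^(1-δ) ω` there. -/
structure IsRegularWeight (g : KahlerMetric n M) (m : ℕ) (Ω : Set M) (ε δ : ℝ) (h : M → ℝ) :
    Prop where
  msh : IsMSubharmonicOn g m Ω (fun x => (h x : EReal))
  nonneg : ∀ x ∈ Ω, 0 ≤ h x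
  le_one : ∀ x ∈ Ω, h x ≤ 1
  zero_nonempty : {x ∈ Ω | h x = 0}.Nonempty
  zero_polar : IsMPolarIn g m Ω {x ∈ Ω | h x = 0}
  contMDiffAt : ∀ x ∈ Ω, 0 < h x → ContMDiffAt 𝓘(ℝ, Cn n) 𝓘(ℝ, ℝ) 2 h x
  levi_ge : ∀ x ∈ Ω, 0 < h x → LeviGEAt g m h (ε * h x ^ (1 - δ)) x

end Manifold

/-- The Riesz kernel `K_p` on `(0, ∞)`: `log s` if `p = 0`, and `s^p / p` otherwise. -/
def rieszReal (p s : ℝ) : ℝ :=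
  if p = 0 then Real.log s else s ^ p / p

/-- The Riesz kernel `K_p : [0, ∞) → [-∞, ∞)`; the value at `0` is `-∞` if `p ≤ 0`, and `0` if
`p > 0`. -/
def riesz (p s : ℝ) : EReal :=
  if p ≤ 0 ∧ s = 0 then ⊥ else (rieszReal p s : EReal)

end

/-! Off the zero set of h the claim is a pointwise estimate. Since i∂∂̄K_q(h) = h^(q-1) i∂∂̄h +
(q-1) h^(q-2) i∂h∧∂̄h, multiplying the growth hypothesis on K_p(h) by h^(q-p) leaves, for q > p, the
surplus (q-p) h^(q-2) i∂h∧∂̄h. Giving up part of it in favour of i∂∂̄h ≥ ε h^(1-δ) ω yields positive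
multiples of both h^(q-2) i∂h∧∂̄h and h^(q-δ) ω, modulo -c h^(q-1+γ̃) ω (`riesz_levi_lower`). With q
= p + jγ, the cut-off θ_j produces the errors K_q(h) i∂∂̄θ_j and h^(q-1) (i∂θ_j∧∂̄h + i∂h∧∂̄θ_j),
which Cauchy–Schwarz controls by h^(q+γ-2) i∂h∧∂̄h and h^(q-γ) ω. Where they occur θ_{j+1} = 1, and
the next kernel K_{q+γ}(h) supplies h^(q+γ-2) i∂h∧∂̄h and h^(q+γ-δ) ω. As h → 0 the latter beats
h^(q-γ) ω because γ < δ/2, and c h^(q-1+γ̃) ω because γ < γ̃+δ-1 (`exists_riesz_pair_bound`). The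
chain stops at θ_ℓ = 1, so the Levi form of the sum is at least -Bω on {h > 0}
(`exists_isLeviBddBelow_weight`), and Cρ compensates this.

The second issue is to cross {h = 0}, where the sum is not C² and, where cut-offs vanish, need not
tend to -∞. The function ψ = K_p(h) + K_{p+γ}(h) does tend to -∞ there, and its Levi form is also
bounded below. For C large, the potential plus ηψ is a subsolution off {h = 0} for every 0 < η ≤ 2.
Its smooth convex truncations from below are constant near {h = 0}, hence are C² subsolutions
everywhere. The set {h = 0} is Lebesgue null because it is m-polar; letting the truncation level
tend to -∞ and then η → 0 gives the inequality of currents. The first limit needs local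
integrability, which comes from testing the truncations against a Hopf-type barrier
(`exists_barrier`, `IsSubsolutionWithPoles.locallyIntegrableOn`).

Finally, positivity of the current is tested with mixed products of m-positive forms, which requires
Gårding's inequality (`wedgeCoeff_nonneg_of_isMPositive`). The polynomial X ↦ X^m ∧ ω^(n-m) is
real-rooted in the direction ω, by Gauss–Lucas starting from the determinant. A homotopy of roots
shows that it does not vanish on the tube over the cone spanned by the given forms, and Gauss–Lucas
again allows polarization. Thus α₂ ∧ … ∧ α_m ∧ ω^(n-m) is a functional that is nonnegative on
m-positive forms, and all Levi estimates are stated for such functionals. -/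

/-! ### Mixed discriminants -/

/-- `wedgeCoeff` as a multilinear map in the coefficient matrices. -/
noncomputable def wedgeMultilinear (n : ℕ) :
    MultilinearMap ℂ (fun _ : Fin n => Matrix (Fin n) (Fin n) ℂ) ℂ where
  toFun := wedgeCoeff
  map_update_add' := by
    intro inst A i X Y
    have : inst = instDecidableEqFin n := Subsingleton.elim _ _
    subst this
    simp only [wedgeCoeff, ← Finset.sum_add_distrib, ← mul_add]
    refine Finset.sum_congr rfl fun σ _ => Finset.sum_congr rfl fun τ _ => ?_
    congr 1
    simp only [← Finset.mul_prod_erase Finset.univ _ (Finset.mem_univ i),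
      Function.update_self, Matrix.add_apply, add_mul]
    congr 1 <;> congr 1 <;>
    · refine Finset.prod_congr rfl fun k hk => ?_
      simp [Function.update_of_ne (Finset.ne_of_mem_erase hk)]
  map_update_smul' := by
    intro inst A i c X
    have : inst = instDecidableEqFin n := Subsingleton.elim _ _
    subst this
    simp only [wedgeCoeff, smul_eq_mul, Finset.mul_sum]
    refine Finset.sum_congr rfl fun σ _ => Finset.sum_congr rfl fun τ _ => ?_
    rw [mul_left_comm]
    congr 1
    simp only [← Finset.mul_prod_erase Finset.univ _ (Finset.mem_univ i),
      Function.update_self, Matrix.smul_apply, smul_eq_mul, mul_assoc]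
    congr 2
    refine Finset.prod_congr rfl fun k hk => ?_
    simp [Function.update_of_ne (Finset.ne_of_mem_erase hk)]

theorem wedgeMultilinear_apply {n : ℕ} (A : Fin n → Matrix (Fin n) (Fin n) ℂ) :
    wedgeMultilinear n A = wedgeCoeff A := rfl

/-- Reindexing both permutation sums by π introduces the sign of π twice. The symmetry later makes
all terms of the Leibniz rule equal. -/
theorem wedgeCoeff_comp_perm {n : ℕ} (A : Fin n → Matrix (Fin n) (Fin n) ℂ)
    (π : Equiv.Perm (Fin n)) : wedgeCoeff (fun i => A (π i)) = wedgeCoeff A := by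
  unfold wedgeCoeff
  rw [← Equiv.sum_comp (Equiv.mulRight π)]
  refine Finset.sum_congr rfl fun σ _ => ?_
  rw [← Equiv.sum_comp (Equiv.mulRight π)]
  refine Finset.sum_congr rfl fun τ _ => ?_
  have h1 : ∏ i, A (π i) ((Equiv.mulRight π σ) i) ((Equiv.mulRight π τ) i)
      = ∏ i, A i (σ i) (τ i) := by
    rw [← Equiv.prod_comp π (fun i => A i (σ i) (τ i))]
    rfl
  rw [h1]
  congr 1
  have h2 : ((Equiv.Perm.sign π : ℤ) : ℂ) * ((Equiv.Perm.sign π : ℤ) : ℂ) = 1 := by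
    rcases Int.units_eq_one_or (Equiv.Perm.sign π) with h | h <;> simp [h]
  simp only [Equiv.coe_mulRight, Equiv.Perm.sign_mul, Units.val_mul, Int.cast_mul]
  linear_combination (((Equiv.Perm.sign σ : ℤ) : ℂ) * ((Equiv.Perm.sign τ : ℤ) : ℂ)) * h2

theorem wedgeCoeff_const {n : ℕ} (A : Matrix (Fin n) (Fin n) ℂ) :
    wedgeCoeff (fun _ => A) = (n.factorial : ℂ) * A.det := by
  unfold wedgeCoeff
  rw [Finset.sum_comm]
  have key : ∀ τ : Equiv.Perm (Fin n), ∑ σ : Equiv.Perm (Fin n),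
      ((Equiv.Perm.sign σ : ℤ) : ℂ) * ((Equiv.Perm.sign τ : ℤ) : ℂ) * ∏ i, A (σ i) (τ i)
      = A.det := by
    intro τ
    rw [Matrix.det_apply', ← Equiv.sum_comp (Equiv.mulRight τ)]
    refine Finset.sum_congr rfl fun σ _ => ?_
    have h1 : ∏ i, A ((Equiv.mulRight τ σ) i) (τ i) = ∏ i, A (σ i) i := by
      rw [← Equiv.prod_comp τ (fun i => A (σ i) i)]
      rfl
    have h2 : ((Equiv.Perm.sign τ : ℤ) : ℂ) * ((Equiv.Perm.sign τ : ℤ) : ℂ) = 1 := by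
      rcases Int.units_eq_one_or (Equiv.Perm.sign τ) with h | h <;> simp [h]
    rw [h1]
    simp only [Equiv.coe_mulRight, Equiv.Perm.sign_mul, Units.val_mul, Int.cast_mul]
    linear_combination (((Equiv.Perm.sign σ : ℤ) : ℂ) * ∏ i, A (σ i) i) * h2
  simp [key, Fintype.card_perm]

/-- Conjugating Hermitian entries transposes them, which exchanges the roles of σ and τ. -/
theorem conj_wedgeCoeff {n : ℕ} {A : Fin n → Matrix (Fin n) (Fin n) ℂ}
    (hA : ∀ i, (A i).IsHermitian) : starRingEnd ℂ (wedgeCoeff A) = wedgeCoeff A := by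
  unfold wedgeCoeff
  conv_rhs => rw [Finset.sum_comm]
  simp only [map_sum, map_mul, map_prod]
  refine Finset.sum_congr rfl fun σ _ => Finset.sum_congr rfl fun τ _ => ?_
  have : ∀ i j k, starRingEnd ℂ (A i j k) = A i k j := fun i j k => (hA i).apply k j
  simp only [this, map_intCast]
  ring

theorem wedgeCoeff_im {n : ℕ} {A : Fin n → Matrix (Fin n) (Fin n) ℂ}
    (hA : ∀ i, (A i).IsHermitian) : (wedgeCoeff A).im = 0 :=
  Complex.conj_eq_iff_im.1 (conj_wedgeCoeff hA)

theorem continuous_wedgeCoeff {n : ℕ} :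
    Continuous (wedgeCoeff : (Fin n → Matrix (Fin n) (Fin n) ℂ) → ℂ) := by
  unfold wedgeCoeff
  fun_prop

/-! ### Restriction of multilinear maps to lines -/

open Polynomial in
/-- The restriction of a multilinear map to a line, in the variables of a finite set `S`, is a
polynomial; its derivative is computed by the Leibniz rule. -/
theorem exists_linePolynomial {ι E : Type*} [Fintype ι] [DecidableEq ι] [AddCommGroup E]
    [Module ℂ E] (D : MultilinearMap ℂ (fun _ : ι => E) ℂ) (X Y : E) (S : Finset ι) (B : ι → E) :
    ∃ P : ℂ[X], P.natDegree ≤ S.card ∧ P.coeff S.card = D (S.piecewise (fun _ => Y) B) ∧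
      (∀ t : ℂ, P.eval t = D (S.piecewise (fun _ => X + t • Y) B)) ∧
      (∀ t : ℂ, P.derivative.eval t =
        ∑ i ∈ S, D (Function.update (S.piecewise (fun _ => X + t • Y) B) i Y)) := by
  induction S using Finset.induction_on generalizing B with
  | empty => exact ⟨C (D B), by simp⟩
  | insert i S hi ih =>
    -- Expanding slot `i` of `X + t • Y` gives `P + t * Q`, where `P` and `Q` have slot `i` frozen
    -- to `X` and to `Y`. This is why `B` is generalized in the induction.
    obtain ⟨P, hP1, hP2, hP3, hP4⟩ := ih (Function.update B i X)
    obtain ⟨Q, hQ1, hQ2, hQ3, hQ4⟩ := ih (Function.update B i Y)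
    have hpw : ∀ Z : E, (insert i S).piecewise (fun _ => Z) B
        = Function.update (S.piecewise (fun _ => Z) B) i Z := by
      intro Z
      rw [Finset.piecewise_insert]
    have hpu : ∀ (Z W : E), S.piecewise (fun _ => Z) (Function.update B i W)
        = Function.update (S.piecewise (fun _ => Z) B) i W := by
      intro Z W
      rw [Finset.update_piecewise_of_notMem _ _ _ hi]
    refine ⟨P + Polynomial.X * Q, ?_, ?_, ?_, ?_⟩
    · rw [Finset.card_insert_of_notMem hi]
      refine (natDegree_add_le _ _).trans (max_le (by omega) ?_)
      refine natDegree_mul_le.trans ?_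
      have := natDegree_X_le (R := ℂ)
      omega
    · rw [Finset.card_insert_of_notMem hi, coeff_add, coeff_X_mul, hQ2,
        coeff_eq_zero_of_natDegree_lt (by omega), zero_add, hpw, hpu]
    · intro t
      rw [eval_add, eval_mul, eval_X, hP3, hQ3, hpw, hpu, hpu, D.map_update_add,
        D.map_update_smul, smul_eq_mul]
    · intro t
      rw [derivative_add, derivative_mul, derivative_X, one_mul, eval_add, eval_add, eval_mul,
        eval_X, hP4, hQ4, hQ3, Finset.sum_insert hi, hpw, Function.update_idem, hpu]
      rw [Finset.mul_sum, add_left_comm, ← Finset.sum_add_distrib]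
      refine congrArg₂ _ (by rw [hpu]) (Finset.sum_congr rfl fun k hk => ?_)
      have hne : k ≠ i := fun h => hi (h ▸ hk)
      rw [hpu, Function.update_comm hne.symm, Function.update_comm hne.symm,
        Function.update_comm hne.symm, D.map_update_add,
        D.map_update_smul, smul_eq_mul]

open Polynomial in
/-- Gauss–Lucas theorem for convex sets containing the roots. -/
theorem mem_of_eval_derivative_eq_zero {P : ℂ[X]} {s : Set ℂ} (hs : Convex ℝ s)
    (hP : 0 < P.degree) (h : ∀ t, P.eval t = 0 → t ∈ s) {t : ℂ} (ht : P.derivative.eval t = 0) :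
    t ∈ s := by
  have hd : P.derivative ≠ 0 := by
    intro h0
    have := derivative_eq_zero.1 h0
    rw [← natDegree_pos_iff_degree_pos] at hP
    omega
  have h1 : t ∈ P.derivative.rootSet ℂ := by
    rw [mem_rootSet]
    exact ⟨hd, by simpa using ht⟩
  have h2 := rootSet_derivative_subset_convexHull_rootSet hP h1
  refine convexHull_min ?_ hs h2
  intro z hz
  rw [mem_rootSet] at hz
  exact h z (by simpa using hz.2)

/-! ### Gårding's inequality for mixed discriminants -/

section Garding

open scoped ComplexOrder

variable {n : ℕ}

/-- A transposition of two slots of `S` exchanges the two sides. Hence the derivative along a line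
is `S.card` times a single mixed discriminant. -/
theorem wedgeCoeff_update_eq (S : Finset (Fin n)) (B : Fin n → Matrix (Fin n) (Fin n) ℂ)
    (Z Y : Matrix (Fin n) (Fin n) ℂ) {i j : Fin n} (hi : i ∈ S) (hj : j ∈ S) :
    wedgeCoeff (Function.update (S.piecewise (fun _ => Z) B) i Y) =
      wedgeCoeff (Function.update (S.piecewise (fun _ => Z) B) j Y) := by
  rw [← wedgeCoeff_comp_perm _ (Equiv.swap i j)]
  congr 1
  funext k
  by_cases hki : k = i
  · subst hki
    by_cases hkj : k = j
    · subst hkj; rw [Equiv.swap_self]; rfl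
    · rw [Equiv.swap_apply_left, Function.update_of_ne hkj]
      rw [Function.update_of_ne (Ne.symm hkj)]
      simp [hi, hj]
  · by_cases hkj : k = j
    · subst hkj
      rw [Equiv.swap_apply_right]; simp
    · rw [Equiv.swap_apply_of_ne_of_ne hki hkj, Function.update_of_ne hki,
        Function.update_of_ne hkj]

open Polynomial in
theorem exists_wedgePolynomial (S : Finset (Fin n)) (B : Fin n → Matrix (Fin n) (Fin n) ℂ)
    (X Y : Matrix (Fin n) (Fin n) ℂ) {i : Fin n} (hi : i ∈ S) :
    ∃ P : ℂ[X], P.natDegree ≤ S.card ∧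
      P.coeff S.card = wedgeCoeff (S.piecewise (fun _ => Y) B) ∧
      (∀ t : ℂ, P.eval t = wedgeCoeff (S.piecewise (fun _ => X + t • Y) B)) ∧
      (∀ t : ℂ, P.derivative.eval t =
        S.card * wedgeCoeff (Function.update (S.piecewise (fun _ => X + t • Y) B) i Y)) := by
  obtain ⟨P, h1, h2, h3, h4⟩ := exists_linePolynomial (wedgeMultilinear n) X Y S B
  refine ⟨P, h1, h2, h3, fun t => ?_⟩
  rw [h4, ← nsmul_eq_mul, ← Finset.sum_const]
  exact Finset.sum_congr rfl fun k hk => wedgeCoeff_update_eq S B _ Y hk hi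

/-- Polarizing one slot in the direction `Y` is differentiation along `Y`, so Gauss–Lucas keeps the
roots in any convex set containing the old ones. The condition `hlead` makes the polynomial
nonconstant. -/
theorem mem_of_wedgeCoeff_update_eq_zero {S : Finset (Fin n)}
    {B : Fin n → Matrix (Fin n) (Fin n) ℂ}
    {X Y : Matrix (Fin n) (Fin n) ℂ} {i : Fin n} (hi : i ∈ S) {s : Set ℂ} (hs : Convex ℝ s)
    (hlead : wedgeCoeff (S.piecewise (fun _ => Y) B) ≠ 0)
    (hroots : ∀ t : ℂ, wedgeCoeff (S.piecewise (fun _ => X + t • Y) B) = 0 → t ∈ s) {t : ℂ}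
    (ht : wedgeCoeff (Function.update (S.piecewise (fun _ => X + t • Y) B) i Y) = 0) : t ∈ s := by
  obtain ⟨P, h1, h2, h3, h4⟩ := exists_wedgePolynomial S B X Y hi
  refine mem_of_eval_derivative_eq_zero (P := P) hs ?_ (fun t h => hroots t (by rwa [← h3])) ?_
  · rw [← Polynomial.natDegree_pos_iff_degree_pos]
    have hc : 0 < S.card := Finset.card_pos.2 ⟨i, hi⟩
    refine hc.trans_le (Polynomial.le_natDegree_of_ne_zero ?_)
    rwa [h2]
  · rw [h4, ht, mul_zero]

/-- The coefficient of `α^k ∧ ω^(n-k)`. -/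
noncomputable def powCoeff (G : Matrix (Fin n) (Fin n) ℂ) (k : ℕ) (Z : Matrix (Fin n) (Fin n) ℂ) :
    ℂ :=
  wedgeCoeff fun i : Fin n => if (i : ℕ) < k then Z else G

theorem powCoeff_eq_piecewise (G : Matrix (Fin n) (Fin n) ℂ) (k : ℕ)
    (Z : Matrix (Fin n) (Fin n) ℂ) : powCoeff G k Z =
      wedgeCoeff ((Finset.univ.filter fun i : Fin n => (i : ℕ) < k).piecewise
        (fun _ => Z) (fun _ => G)) := by
  unfold powCoeff
  congr 1
  funext i
  simp [Finset.piecewise]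

/-- Up to a factor, α^k ∧ ω^(n-k) is the derivative of α^(k+1) ∧ ω^(n-k-1) in the direction ω; this
form is ready for the Gauss–Lucas step. -/
theorem powCoeff_eq_update (G : Matrix (Fin n) (Fin n) ℂ) {k : ℕ} (hk : k < n)
    (Z : Matrix (Fin n) (Fin n) ℂ) : powCoeff G k Z =
      wedgeCoeff (Function.update
        ((Finset.univ.filter fun i : Fin n => (i : ℕ) < k + 1).piecewise
        (fun _ => Z) (fun _ => G)) ⟨k, hk⟩ G) := by
  unfold powCoeff
  congr 1
  funext i
  by_cases hi : i = ⟨k, hk⟩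
  · subst hi; simp
  · have : (i : ℕ) ≠ k := fun h => hi (Fin.ext h)
    rw [Function.update_of_ne hi]
    simp only [Finset.piecewise, Finset.mem_filter, Finset.mem_univ, true_and]
    congr 1
    simp only [eq_iff_iff]
    omega

theorem powCoeff_self (G : Matrix (Fin n) (Fin n) ℂ) (k : ℕ) :
    powCoeff G k G = (n.factorial : ℂ) * G.det := by
  unfold powCoeff
  simp only [ite_self]
  exact wedgeCoeff_const G

theorem powCoeff_top (G Z : Matrix (Fin n) (Fin n) ℂ) :
    powCoeff G n Z = (n.factorial : ℂ) * Z.det := by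
  unfold powCoeff
  simp only [Fin.is_lt, if_true]
  exact wedgeCoeff_const Z

theorem powCoeff_smul (G : Matrix (Fin n) (Fin n) ℂ) {k : ℕ} (hk : k ≤ n) (c : ℂ)
    (Z : Matrix (Fin n) (Fin n) ℂ) : powCoeff G k (c • Z) = c ^ k * powCoeff G k Z := by
  rw [powCoeff_eq_piecewise, powCoeff_eq_piecewise]
  have h := (wedgeMultilinear n).map_piecewise_smul (fun _ => c)
    (((Finset.univ.filter fun i : Fin n => (i : ℕ) < k).piecewise
        (fun _ => Z) (fun _ => G))) (Finset.univ.filter fun i : Fin n => (i : ℕ) < k)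
  simp only [wedgeMultilinear_apply, Finset.prod_const, smul_eq_mul] at h
  have hc : (Finset.univ.filter fun i : Fin n => (i : ℕ) < k).card = k := by
    simp [Fin.card_filter_val_lt, hk]
  rw [hc] at h
  rw [← h]
  congr 1
  funext i
  by_cases hi : (i : ℕ) < k <;> simp [Finset.piecewise, hi]

theorem det_ne_zero_of_posDef {G : Matrix (Fin n) (Fin n) ℂ} (hG : G.PosDef) :
    (n.factorial : ℂ) * G.det ≠ 0 :=
  mul_ne_zero (by exact_mod_cast n.factorial_ne_zero) hG.det_pos.ne'

/-- Descend from `k = n`, where the polynomial is the determinant, applying Gauss–Lucas in the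
direction `G` at each step. It is used with the real axis and with the half-line of nonpositive
reals. -/
theorem powCoeff_roots {G X : Matrix (Fin n) (Fin n) ℂ} (hG : G.PosDef) {s : Set ℂ}
    (hs : Convex ℝ s) (hX : ∀ t : ℂ, (X + t • G).det = 0 → t ∈ s) {k : ℕ} (hk1 : k ≤ n)
    {t : ℂ} (ht : powCoeff G k (X + t • G) = 0) : t ∈ s := by
  induction hk1 using Nat.decreasingInduction generalizing t with
  | of_succ k hk ih =>
    rw [powCoeff_eq_update G hk] at ht
    refine mem_of_wedgeCoeff_update_eq_zero (by simp) hs ?_ (fun t' ht' => ih ?_) ht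
    · rw [← powCoeff_eq_piecewise, powCoeff_self]
      exact det_ne_zero_of_posDef hG
    · rwa [powCoeff_eq_piecewise]
  | self =>
    rw [powCoeff_top] at ht
    refine hX t ((mul_eq_zero.1 ht).resolve_left ?_)
    exact_mod_cast n.factorial_ne_zero

/-- Pair a null vector of `X + t • G` with itself; the number `r` is its squared length in `G`. The
position of `t` can then be read off from the quadratic form of `X`. -/
theorem exists_form_eq_of_det_eq_zero {G X : Matrix (Fin n) (Fin n) ℂ} (hG : G.PosDef) {t : ℂ}
    (ht : (X + t • G).det = 0) : ∃ (w : Fin n → ℂ) (r : ℝ), 0 < r ∧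
      star w ⬝ᵥ X.mulVec w = -(t * r) := by
  obtain ⟨w, hw, h⟩ := Matrix.exists_mulVec_eq_zero_iff.2 ht
  have hp := hG.dotProduct_mulVec_pos hw
  obtain ⟨hr, hi⟩ := Complex.pos_iff.1 hp
  refine ⟨w, _, hr, ?_⟩
  have h1 : star w ⬝ᵥ (X + t • G).mulVec w = 0 := by rw [h]; simp
  rw [Matrix.add_mulVec, Matrix.smul_mulVec, dotProduct_add, dotProduct_smul] at h1
  have h2 : star w ⬝ᵥ G.mulVec w = ((star w ⬝ᵥ G.mulVec w).re : ℂ) :=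
    Complex.ext (by simp) (by simp [← hi])
  rw [h2, smul_eq_mul] at h1
  linear_combination h1

theorem form_im_eq_zero {X : Matrix (Fin n) (Fin n) ℂ} (hX : X.IsHermitian) (w : Fin n → ℂ) :
    (star w ⬝ᵥ X.mulVec w).im = 0 := by
  have := hX.im_star_dotProduct_mulVec_self w
  simpa using this

theorem convex_im_eq_zero : Convex ℝ {t : ℂ | t.im = 0} := by
  intro a ha b hb p q _ _ _
  simp only [Set.mem_ofPred_eq] at *
  simp [ha, hb]

theorem powCoeff_root_real {G X : Matrix (Fin n) (Fin n) ℂ} (hG : G.PosDef)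
    (hX : X.IsHermitian) {k : ℕ} (hk1 : k ≤ n)
    {t : ℂ} (ht : powCoeff G k (X + t • G) = 0) : t.im = 0 := by
  refine powCoeff_roots (s := {t : ℂ | t.im = 0}) hG convex_im_eq_zero (fun t ht => ?_) hk1 ht
  obtain ⟨w, r, hr, h⟩ := exists_form_eq_of_det_eq_zero hG ht
  have h1 := form_im_eq_zero hX w
  rw [h] at h1
  simp only [Complex.neg_im, Complex.mul_im, Complex.ofReal_im, Complex.ofReal_re, mul_zero,
    zero_add, neg_eq_zero, mul_eq_zero] at h1
  exact h1.resolve_right (ne_of_gt hr)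

/-- `d/dt` of `(A + tω)^(k+1) ∧ ω^(n-k-1)`, along the real line. -/
theorem hasDerivAt_powCoeff (G X : Matrix (Fin n) (Fin n) ℂ) {k : ℕ} (hk : k < n) (t : ℝ) :
    HasDerivAt (fun t : ℝ => (powCoeff G (k + 1) (X + (t : ℂ) • G)).re)
      ((k + 1) * (powCoeff G k (X + (t : ℂ) • G)).re) t := by
  obtain ⟨P, h1, h2, h3, h4⟩ := exists_wedgePolynomial
    (Finset.univ.filter fun i : Fin n => (i : ℕ) < k + 1) (fun _ => G) X G (i := ⟨k, hk⟩) (by simp)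
  have h := (P.hasDerivAt (t : ℂ)).real_of_complex
  rw [h4, ← powCoeff_eq_update G hk] at h
  have hc : (Finset.univ.filter fun i : Fin n => (i : ℕ) < k + 1).card = k + 1 := by
    rw [Fin.card_filter_val_lt]; omega
  rw [hc] at h
  convert h using 1
  · funext t
    rw [h3, powCoeff_eq_piecewise]
  · have : (((k + 1 : ℕ) : ℂ)) = (((k + 1 : ℝ)) : ℂ) := by push_cast; rfl
    rw [this, Complex.re_ofReal_mul]

theorem factorial_mul_det_re_pos {G : Matrix (Fin n) (Fin n) ℂ} (hG : G.PosDef) :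
    0 < ((n.factorial : ℂ) * G.det).re := by
  have h := Complex.pos_iff.1 hG.det_pos
  have : ((n.factorial : ℂ) * G.det).re = n.factorial * G.det.re := by
    simp [Complex.mul_re]
  rw [this]
  exact mul_pos (by exact_mod_cast n.factorial_pos) h.1

/-- Induction on `k`: the derivative in `t` of the polynomial of degree `k + 1` is a positive
multiple of the one of degree `k`, so the former increases strictly from a nonnegative value at `t =
0`. -/
theorem powCoeff_add_smul_pos {G X : Matrix (Fin n) (Fin n) ℂ} (hG : G.PosDef) {m : ℕ}
    (hX : ∀ k, 1 ≤ k → k ≤ m → 0 ≤ (powCoeff G k X).re) (hmn : m ≤ n) {k : ℕ} (hk : k ≤ m)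
    {t : ℝ} (ht : 0 < t) : 0 < (powCoeff G k (X + (t : ℂ) • G)).re := by
  induction k generalizing t with
  | zero =>
    have : powCoeff G 0 (X + (t : ℂ) • G) = (n.factorial : ℂ) * G.det := by
      unfold powCoeff
      simp only [Nat.not_lt_zero, if_false]
      exact wedgeCoeff_const G
    rw [this]
    exact factorial_mul_det_re_pos hG
  | succ k ih =>
    have hd := hasDerivAt_powCoeff G X (k := k) (by omega)
    have hmono : StrictMonoOn (fun t : ℝ => (powCoeff G (k + 1) (X + (t : ℂ) • G)).re)
        (Ici 0) := by
      refine strictMonoOn_of_deriv_pos (convex_Ici 0)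
        (fun t _ => (hd t).continuousAt.continuousWithinAt) ?_
      intro t ht
      rw [interior_Ici] at ht
      rw [(hd t).deriv]
      exact mul_pos (by positivity) (ih (by omega) ht)
    have h0 := hmono (mem_Ici.2 le_rfl) (mem_Ici.2 ht.le) ht
    simp only [Complex.ofReal_zero, zero_smul, add_zero] at h0
    exact (hX (k + 1) (by omega) hk).trans_lt h0

end Garding

/-! ### Stability of the m-th power on tubes over cones of positive directions -/

section Garding

open scoped ComplexOrder

theorem pow_im_le_norm_prod_sub (s : Multiset ℂ) (hs : ∀ ρ ∈ s, ρ.im < 0) {z : ℂ}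
    (hz : 0 ≤ z.im) : z.im ^ Multiset.card s ≤ ‖(s.map (z - ·)).prod‖ := by
  induction s using Multiset.induction_on with
  | empty => simp
  | cons ρ s ih =>
    rw [Multiset.card_cons, Multiset.map_cons, Multiset.prod_cons, norm_mul, pow_succ']
    refine mul_le_mul ?_ (ih fun ρ' h => hs ρ' (Multiset.mem_cons_of_mem h)) (by positivity)
      (norm_nonneg _)
    have h1 := Complex.abs_im_le_norm (z - ρ)
    have h2 := hs ρ (Multiset.mem_cons_self ρ s)
    rw [Complex.sub_im] at h1
    have := le_abs_self (z.im - ρ.im)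
    linarith

-- This turns "all roots lie in the lower half-plane" into an inequality that survives limits, and
-- so takes the place of continuity of the roots in the homotopy argument.
open Polynomial in
theorem le_norm_eval_of_roots {P : ℂ[X]} {m : ℕ} {c : ℂ} (hd : P.natDegree ≤ m)
    (hc : P.coeff m = c) (hc0 : c ≠ 0) (hr : ∀ t, P.eval t = 0 → t.im < 0) {z : ℂ}
    (hz : 0 ≤ z.im) : ‖c‖ * z.im ^ m ≤ ‖P.eval z‖ := by
  have hdeg : P.natDegree = m := le_antisymm hd (le_natDegree_of_ne_zero (by rwa [hc]))
  have hP : P ≠ 0 := by rintro rfl; simp at hc; exact hc0 hc.symm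
  have hs := IsAlgClosed.splits P
  rw [hs.eval_eq_prod_roots, norm_mul]
  have h1 : P.leadingCoeff = c := by rw [leadingCoeff, hdeg, hc]
  have h2 : Multiset.card P.roots = m := by rw [← hs.natDegree_eq_card_roots, hdeg]
  have h3 := pow_im_le_norm_prod_sub P.roots (fun ρ hρ => hr ρ (by simpa [hP] using hρ)) hz
  rw [h2] at h3
  rw [h1]
  gcongr

open Polynomial in
/-- Roots of a continuous family of polynomials with constant leading coefficient that avoid the
real axis stay in the lower half-plane. -/
theorem im_neg_of_homotopy {q : ℝ → ℂ → ℂ} (hq : Continuous (Function.uncurry q)) {m : ℕ} {c : ℂ}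
    (hc : c ≠ 0)
    (hpoly : ∀ r, ∃ P : ℂ[X], P.natDegree ≤ m ∧ P.coeff m = c ∧ ∀ t, P.eval t = q r t)
    {R : ℝ} (hR : ∀ r ∈ Icc (0 : ℝ) 1, ∀ t, q r t = 0 → ‖t‖ ≤ R)
    (hreal : ∀ r ∈ Icc (0 : ℝ) 1, ∀ t, q r t = 0 → t.im ≠ 0)
    (h0 : ∀ t, q 0 t = 0 → t.im < 0) {t : ℂ} (ht : q 1 t = 0) : t.im < 0 := by
  by_contra hneg
  rw [not_lt] at hneg
  -- `A` contains the parameters with all roots in the lower half-plane, and the projection of `K`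
  -- those with a root in the closed upper half-plane. Both sets are closed and they cover the
  -- interval, so connectedness forces a common parameter.
  let A : Set ℝ := {r | ∀ z : ℂ, 0 ≤ z.im → ‖c‖ * z.im ^ m ≤ ‖q r z‖}
  let K : Set (ℝ × ℂ) := (Icc (0 : ℝ) 1 ×ˢ Metric.closedBall (0 : ℂ) R) ∩
    {p | 0 ≤ p.2.im ∧ q p.1 p.2 = 0}
  have hA : IsClosed A := by
    have : A = ⋂ z : ℂ, ⋂ _ : 0 ≤ z.im, {r | ‖c‖ * z.im ^ m ≤ ‖q r z‖} := by
      ext r; simp [A]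
    rw [this]
    refine isClosed_iInter fun z => isClosed_iInter fun _ => isClosed_le continuous_const ?_
    exact (hq.comp (continuous_id.prodMk continuous_const)).norm
  have hK : IsCompact K := by
    refine (isCompact_Icc.prod (isCompact_closedBall 0 R)).inter_right ?_
    have h1 : IsClosed {p : ℝ × ℂ | 0 ≤ p.2.im} :=
      isClosed_le continuous_const (Complex.continuous_im.comp continuous_snd)
    have h2 : IsClosed {p : ℝ × ℂ | q p.1 p.2 = 0} := isClosed_eq hq continuous_const
    exact h1.inter h2
  have hB : IsClosed (Prod.fst '' K) := (hK.image continuous_fst).isClosed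
  have hcover : Icc (0 : ℝ) 1 ⊆ A ∪ Prod.fst '' K := by
    intro r hr
    by_cases h : ∀ t, q r t = 0 → t.im < 0
    · left
      intro z hz
      obtain ⟨P, h1, h2, h3⟩ := hpoly r
      rw [← h3]
      exact le_norm_eval_of_roots h1 h2 hc (fun t ht => h t (by rwa [← h3])) hz
    · right
      push Not at h
      obtain ⟨s, hs1, hs2⟩ := h
      exact ⟨(r, s), ⟨⟨hr, by simpa using hR r hr s hs1⟩, hs2, hs1⟩, rfl⟩
  have h01 : (0 : ℝ) ∈ A := by
    intro z hz
    obtain ⟨P, h1, h2, h3⟩ := hpoly 0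
    rw [← h3]
    exact le_norm_eval_of_roots h1 h2 hc (fun t ht => h0 t (by rwa [← h3])) hz
  have h1m : (1 : ℝ) ∈ Icc (0 : ℝ) 1 := by simp
  obtain ⟨r, hr, hrA, ⟨⟨r', s⟩, ⟨⟨-, -⟩, hs1, hs2⟩, rfl⟩⟩ :=
    isPreconnected_closed_iff.1 isPreconnected_Icc A _ hA hB hcover
      ⟨0, by simp, h01⟩
      ⟨1, h1m, (1, t), ⟨⟨h1m, by simpa using hR 1 h1m t ht⟩, hneg, ht⟩, rfl⟩
  have h2 := hrA s hs1
  -- At a common parameter the root `s` is not real, so the lower bound defining `A` is positive at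
  -- `s`, although `q` vanishes there.
  have h3 : 0 < s.im := lt_of_le_of_ne hs1 (hreal _ hr s hs2).symm
  have h4 : 0 < ‖c‖ * s.im ^ m := mul_pos (norm_pos_iff.2 hc) (pow_pos h3 m)
  simp only at h2 hs2
  rw [hs2, norm_zero] at h2
  linarith

variable {n : ℕ}

theorem continuous_powCoeff (G : Matrix (Fin n) (Fin n) ℂ) (k : ℕ) : Continuous (powCoeff G k) := by
  unfold powCoeff
  refine continuous_wedgeCoeff.comp (continuous_pi fun i => ?_)
  split_ifs <;> fun_prop

/-- A positive direction can be added to a cone of directions in which `powCoeff` is stable. -/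
theorem powCoeff_stable_extend {G a : Matrix (Fin n) (Fin n) ℂ} (hG : G.PosDef) {m : ℕ}
    (hmn : m ≤ n) {K : Set (Matrix (Fin n) (Fin n) ℂ)}
    (hKG : ∀ y ∈ K, ∀ r ∈ Icc (0 : ℝ) 1, ((1 - r : ℝ) : ℂ) • G + (r : ℂ) • y ∈ K)
    (hK : ∀ x : Matrix (Fin n) (Fin n) ℂ, x.IsHermitian → ∀ y ∈ K,
      powCoeff G m (x + Complex.I • y) ≠ 0)
    (ha : a.IsHermitian) (haG : ∀ t : ℝ, 0 ≤ t → powCoeff G m (a + (t : ℂ) • G) ≠ 0)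
    {x y : Matrix (Fin n) (Fin n) ℂ} (hx : x.IsHermitian) (hy : y ∈ K) {s : ℝ} (hs : 0 ≤ s) :
    powCoeff G m (x + Complex.I • (y + (s : ℂ) • a)) ≠ 0 := by
  intro hzero
  -- A path from `I • G` to `x + I • y` whose imaginary part stays in the cone for `r` in the unit
  -- interval.
  let w : ℝ → Matrix (Fin n) (Fin n) ℂ := fun r =>
    (r : ℂ) • x + Complex.I • (((1 - r : ℝ) : ℂ) • G + (r : ℂ) • y)
  have hw : Continuous w := by
    simp only [w]
    fun_prop
  let q : ℝ → ℂ → ℂ := fun r t => powCoeff G m (w r + t • a)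
  have hq : Continuous (Function.uncurry q) := by
    refine (continuous_powCoeff G m).comp ?_
    exact (hw.comp continuous_fst).add (continuous_snd.smul continuous_const)
  have hpa : powCoeff G m a ≠ 0 := by simpa using haG 0 le_rfl
  have hherm : ∀ (r : ℝ) (b : Matrix (Fin n) (Fin n) ℂ), b.IsHermitian →
      ((r : ℂ) • b).IsHermitian := fun r b hb => by
    rw [Matrix.IsHermitian, Matrix.conjTranspose_smul, hb.eq]; simp
  -- Large roots `t` correspond to small `u = t⁻¹` with `a + u • w r` a zero. This is excluded near
  -- `u = 0`, uniformly in `r`, because the polynomial does not vanish at `a`.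
  obtain ⟨R, hR⟩ : ∃ R : ℝ, ∀ r ∈ Icc (0 : ℝ) 1, ∀ t, q r t = 0 → ‖t‖ ≤ R := by
    have hev : ∀ᶠ u in 𝓝 (0 : ℂ), ∀ r ∈ Icc (0 : ℝ) 1, powCoeff G m (a + u • w r) ≠ 0 := by
      refine isCompact_Icc.eventually_forall_of_forall_eventually fun r _ => ?_
      have hc : Continuous fun p : ℂ × ℝ => powCoeff G m (a + p.1 • w p.2) := by
        refine (continuous_powCoeff G m).comp ?_
        exact continuous_const.add (continuous_fst.smul (hw.comp continuous_snd))
      refine hc.continuousAt.eventually_ne ?_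
      simpa using hpa
    obtain ⟨ε, hε, hball⟩ := Metric.eventually_nhds_iff.1 hev
    refine ⟨ε⁻¹, fun r hr t ht => ?_⟩
    by_contra hlt
    rw [not_le] at hlt
    have ht0 : t ≠ 0 := by
      rintro rfl
      simp only [norm_zero] at hlt
      exact absurd (inv_pos.2 hε) hlt.not_gt
    refine hball (y := t⁻¹) ?_ r hr ?_
    · rw [dist_zero_right, norm_inv]
      exact inv_lt_of_inv_lt₀ hε hlt
    · have : w r + t • a = t • (a + t⁻¹ • w r) := by
        rw [smul_add, smul_smul, mul_inv_cancel₀ ht0, one_smul, add_comm]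
      simp only [q] at ht
      rw [this, powCoeff_smul G hmn] at ht
      exact (mul_eq_zero.1 ht).resolve_left (pow_ne_zero _ ht0)
  have hreal : ∀ r ∈ Icc (0 : ℝ) 1, ∀ t, q r t = 0 → t.im ≠ 0 := by
    intro r hr t ht him
    have ht' : t = (t.re : ℂ) := Complex.ext (by simp) (by simp [him])
    refine hK ((r : ℂ) • x + (t.re : ℂ) • a) ((hherm _ _ hx).add (hherm _ _ ha)) _
      (hKG y hy r hr) ?_
    rw [← ht, ← ht']
    simp only [q, w]
    congr 1
    exact add_right_comm _ _ _
  -- For a root of `I • G + t • a` the number `μ = I / t` is real by hyperbolicity, and negative by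
  -- `haG`. Hence `t = I / μ` lies on the negative imaginary axis.
  have h0 : ∀ t, q 0 t = 0 → t.im < 0 := by
    intro t ht
    simp only [q, w, Complex.ofReal_zero, zero_smul, sub_zero, Complex.ofReal_one, one_smul,
      add_zero, zero_add] at ht
    have ht0 : t ≠ 0 := by
      rintro rfl
      rw [zero_smul, add_zero, powCoeff_smul G hmn, powCoeff_self] at ht
      exact mul_ne_zero (pow_ne_zero _ Complex.I_ne_zero) (det_ne_zero_of_posDef hG) ht
    have h1 : Complex.I • G + t • a = t • (a + (t⁻¹ * Complex.I) • G) := by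
      rw [smul_add, smul_smul, ← mul_assoc, mul_inv_cancel₀ ht0, one_mul, add_comm]
    rw [h1, powCoeff_smul G hmn] at ht
    have h2 := (mul_eq_zero.1 ht).resolve_left (pow_ne_zero _ ht0)
    have h3 := powCoeff_root_real hG ha hmn h2
    set μ : ℝ := (t⁻¹ * Complex.I).re with hμ
    have h4 : t⁻¹ * Complex.I = (μ : ℂ) := Complex.ext (by simp [hμ]) (by simp [h3])
    have h5 : μ < 0 := by
      by_contra hμ0
      rw [not_lt] at hμ0
      exact haG μ hμ0 (by rw [← h4]; exact h2)
    have h6 : t = Complex.I * ((μ⁻¹ : ℝ) : ℂ) := by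
      have hμc : (μ : ℂ) ≠ 0 := by exact_mod_cast h5.ne
      push_cast
      rw [← h4]
      field_simp
    rw [h6]
    simp [h5]
  -- The assumed zero is a root with imaginary part `s ≥ 0` at the end of the path, which the
  -- homotopy forbids.
  have h1 : q 1 (Complex.I * s) = 0 := by
    rw [← hzero]
    simp only [q, w, Complex.ofReal_one, one_smul, sub_self, Complex.ofReal_zero, zero_smul,
      zero_add]
    congr 1
    rw [smul_add, smul_smul, add_assoc]
  have hpoly : ∀ r, ∃ P : Polynomial ℂ, P.natDegree ≤ m ∧ P.coeff m = powCoeff G m a ∧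
      ∀ t, P.eval t = q r t := by
    intro r
    obtain ⟨P, hP1, hP2, hP3, -⟩ := exists_linePolynomial (wedgeMultilinear n) (w r) a
      (Finset.univ.filter fun i : Fin n => (i : ℕ) < m) (fun _ => G)
    have hc : (Finset.univ.filter fun i : Fin n => (i : ℕ) < m).card = m := by
      rw [Fin.card_filter_val_lt]; omega
    rw [hc] at hP1 hP2
    refine ⟨P, hP1, ?_, fun t => ?_⟩
    · rw [hP2, powCoeff_eq_piecewise]; rfl
    · rw [hP3]
      simp only [q]
      rw [powCoeff_eq_piecewise]; rfl
  have := im_neg_of_homotopy hq hpa hpoly hR hreal h0 h1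
  simp at this
  linarith

/-- The cone spanned by `G` and the family `b`, with a positive multiple of `G`. -/
def spanCone (G : Matrix (Fin n) (Fin n) ℂ) (b : Fin n → Matrix (Fin n) (Fin n) ℂ)
    (S : Finset (Fin n)) : Set (Matrix (Fin n) (Fin n) ℂ) :=
  {y | ∃ (s : ℝ) (c : Fin n → ℝ), 0 < s ∧ (∀ i, 0 ≤ c i) ∧
    y = (s : ℂ) • G + ∑ i ∈ S, (c i : ℂ) • b i}

/-- The generators are added one at a time with `powCoeff_stable_extend`. The starting cone is the
ray of `G`, where non-vanishing is real-rootedness. -/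
theorem powCoeff_stable_spanCone {G : Matrix (Fin n) (Fin n) ℂ} (hG : G.PosDef) {m : ℕ}
    (hmn : m ≤ n) {b : Fin n → Matrix (Fin n) (Fin n) ℂ} (hb : ∀ i, (b i).IsHermitian)
    (hbG : ∀ i, ∀ t : ℝ, 0 ≤ t → powCoeff G m (b i + (t : ℂ) • G) ≠ 0) (S : Finset (Fin n)) :
    ∀ x : Matrix (Fin n) (Fin n) ℂ, x.IsHermitian → ∀ y ∈ spanCone G b S,
      powCoeff G m (x + Complex.I • y) ≠ 0 := by
  induction S using Finset.induction_on with
  | empty =>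
    rintro x hx _ ⟨s, c, hs, -, rfl⟩ h
    rw [Finset.sum_empty, add_zero, smul_smul] at h
    have := powCoeff_root_real hG hx hmn h
    simp at this
    exact hs.ne' this
  | insert i S hi ih =>
    rintro x hx _ ⟨s, c, hs, hc, rfl⟩
    have h := powCoeff_stable_extend hG hmn (K := spanCone G b S) ?_ ih (hb i) (hbG i) hx
      (y := (s : ℂ) • G + ∑ i ∈ S, (c i : ℂ) • b i) ⟨s, c, hs, hc, rfl⟩ (hc i)
    · rw [Finset.sum_insert hi]
      rwa [add_comm ((c i : ℂ) • b i), ← add_assoc]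
    · rintro _ ⟨s, c, hs, hc, rfl⟩ r ⟨hr0, hr1⟩
      refine ⟨(1 - r) + r * s, fun i => r * c i, ?_, fun i => mul_nonneg hr0 (hc i), ?_⟩
      · rcases hr1.lt_or_eq with h | h
        · have := mul_nonneg hr0 hs.le
          linarith
        · subst h; linarith
      · simp only [Complex.ofReal_add, Complex.ofReal_mul, add_smul, smul_add, mul_smul,
          Finset.smul_sum, add_assoc]

theorem spanCone_add {G : Matrix (Fin n) (Fin n) ℂ} {b : Fin n → Matrix (Fin n) (Fin n) ℂ}
    {S : Finset (Fin n)} {y z : Matrix (Fin n) (Fin n) ℂ} (hy : y ∈ spanCone G b S)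
    (hz : z ∈ spanCone G b S) {r : ℝ} (hr : 0 ≤ r) : y + (r : ℂ) • z ∈ spanCone G b S := by
  obtain ⟨s, c, hs, hc, rfl⟩ := hy
  obtain ⟨s', c', hs', hc', rfl⟩ := hz
  refine ⟨s + r * s', fun i => c i + r * c' i, by have := mul_nonneg hr hs'.le; linarith,
    fun i => add_nonneg (hc i) (mul_nonneg hr (hc' i)), ?_⟩
  simp only [Complex.ofReal_add, Complex.ofReal_mul, add_smul, smul_add, mul_smul,
          Finset.smul_sum, Finset.sum_add_distrib]
  abel

end Garding

/-! ### Polarization and Gårding's inequality -/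

section Garding

open scoped ComplexOrder

variable {n : ℕ}

/-- `b₀ ∧ … ∧ b_{j-1} ∧ Z^(m-j) ∧ ω^(n-m)` does not vanish on the tube over the cone of the `b i`. -/
theorem wedgeCoeff_partial_ne_zero {G : Matrix (Fin n) (Fin n) ℂ} {m : ℕ} (hmn : m ≤ n)
    {K : Set (Matrix (Fin n) (Fin n) ℂ)}
    (hK : ∀ x : Matrix (Fin n) (Fin n) ℂ, x.IsHermitian → ∀ y ∈ K,
      powCoeff G m (x + Complex.I • y) ≠ 0)
    (hKadd : ∀ y ∈ K, ∀ z ∈ K, ∀ r : ℝ, 0 ≤ r → y + (r : ℂ) • z ∈ K)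
    {b : Fin n → Matrix (Fin n) (Fin n) ℂ} (hb : ∀ i, (b i).IsHermitian) (hbK : ∀ i, b i ∈ K)
    {j : ℕ} (hj : j ≤ m) {x : Matrix (Fin n) (Fin n) ℂ} (hx : x.IsHermitian)
    {y : Matrix (Fin n) (Fin n) ℂ} (hy : y ∈ K) :
    wedgeCoeff (fun i : Fin n => if (i : ℕ) < j then b i else
      if (i : ℕ) < m then x + Complex.I • y else G) ≠ 0 := by
  induction j generalizing x y with
  | zero => simpa [powCoeff] using hK x hx y hy
  | succ j ih =>
    have hjn : j < n := by omega
    let S : Finset (Fin n) := Finset.univ.filter fun i : Fin n => j ≤ (i : ℕ) ∧ (i : ℕ) < m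
    let B : Fin n → Matrix (Fin n) (Fin n) ℂ := fun i => if (i : ℕ) < j then b i else G
    have hpw : ∀ Z, S.piecewise (fun _ => Z) B = fun i : Fin n => if (i : ℕ) < j then b i else
        if (i : ℕ) < m then Z else G := by
      intro Z
      funext i
      simp only [Finset.piecewise, S, B, Finset.mem_filter, Finset.mem_univ, true_and]
      by_cases h1 : (i : ℕ) < j
      · simp [h1]
      · simp [h1, not_lt.1 h1]
    let i₀ : Fin n := ⟨j, hjn⟩
    have hi₀ : i₀ ∈ S := by simp [S, i₀]; omega
    have hup : ∀ Z, Function.update (S.piecewise (fun _ => Z) B) i₀ (b i₀) =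
        fun i : Fin n => if (i : ℕ) < j + 1 then b i else if (i : ℕ) < m then Z else G := by
      intro Z
      rw [hpw]
      funext i
      by_cases h : i = i₀
      · subst h; simp [i₀]
      · have h' : (i : ℕ) ≠ j := fun h' => h (Fin.ext h')
        rw [Function.update_of_ne h]
        congr 1
        simp only [eq_iff_iff]
        omega
    -- The induction hypothesis at `x = 0`, `y = b i₀` gives this up to a power of `I`.
    have hlead : wedgeCoeff (S.piecewise (fun _ => b i₀) B) ≠ 0 := by
      intro h0
      refine ih (by omega) Matrix.isHermitian_zero (hbK i₀) ?_
      rw [← hpw, zero_add]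
      have h := (wedgeMultilinear n).map_piecewise_smul (fun _ => Complex.I)
        (S.piecewise (fun _ => b i₀) B) S
      simp only [wedgeMultilinear_apply, h0, smul_zero] at h
      rw [← h]
      congr 1
      funext i
      by_cases hi : i ∈ S <;> simp [hi]
    intro hzero
    -- For `t.im ≥ 0` the point `x + I • y + t • b i₀` is still in the tube, with imaginary part `y
    -- + t.im • b i₀`. So all roots lie in the open lower half-plane; by Gauss–Lucas the polarized
    -- form cannot vanish at `t = 0`.
    have h := mem_of_wedgeCoeff_update_eq_zero (s := {t : ℂ | t.im < 0}) (t := 0)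
      (X := x + Complex.I • y) (Y := b i₀) (B := B) hi₀ ?_ hlead ?_ ?_
    · simp at h
    · intro p hp q hq u v hu hv huv
      simp only [Set.mem_ofPred_eq] at *
      simp only [Complex.add_im, Complex.smul_im, smul_eq_mul]
      rcases hu.eq_or_lt with rfl | hu
      · have : v = 1 := by linarith
        subst this; linarith
      · have := mul_neg_of_pos_of_neg hu hp
        have := mul_nonpos_of_nonneg_of_nonpos hv hq.le
        linarith
    · intro t ht
      by_contra him
      simp only [Set.mem_ofPred_eq, not_lt] at him
      rw [hpw] at ht
      have hre : ((t.re : ℂ) • b i₀).IsHermitian := by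
        rw [Matrix.IsHermitian, Matrix.conjTranspose_smul, (hb i₀).eq]; simp
      refine ih (by omega) (hx.add hre) (hKadd y hy (b i₀) (hbK i₀) t.im him) ?_
      convert ht using 5
      rw [smul_add, smul_smul, add_add_add_comm, ← add_smul, mul_comm Complex.I,
        Complex.re_add_im]
    · rw [zero_smul, add_zero, hup]
      exact hzero

theorem wedgeCoeff_add_smul_ne_zero {G : Matrix (Fin n) (Fin n) ℂ} (hG : G.PosDef) {m : ℕ}
    (hmn : m ≤ n) {A : Fin n → Matrix (Fin n) (Fin n) ℂ} (hA : ∀ i, IsMPositive m G (A i))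
    {η : ℝ} (hη : 0 < η) :
    wedgeCoeff (fun i : Fin n => if (i : ℕ) < m then A i + (η : ℂ) • G else G) ≠ 0 := by
  have hsm : ∀ (r : ℝ) (b : Matrix (Fin n) (Fin n) ℂ), b.IsHermitian →
      ((r : ℂ) • b).IsHermitian := fun r b hb => by
    rw [Matrix.IsHermitian, Matrix.conjTranspose_smul, hb.eq]; simp
  -- Half of `η` makes the generators strictly positive; the other half is the positive multiple of
  -- `G` that puts `b i` inside the cone.
  let b₀ : Fin n → Matrix (Fin n) (Fin n) ℂ := fun i => A i + ((η / 2 : ℝ) : ℂ) • G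
  let b : Fin n → Matrix (Fin n) (Fin n) ℂ := fun i => A i + (η : ℂ) • G
  have hstab := powCoeff_stable_spanCone hG hmn (b := b₀)
    (fun i => (hA i).1.add (hsm _ _ hG.isHermitian)) (fun i t ht h => by
      have h1 := powCoeff_add_smul_pos hG (hA i).2 hmn le_rfl (t := η / 2 + t) (by linarith)
      simp only [b₀] at h
      rw [add_assoc, ← add_smul, ← Complex.ofReal_add] at h
      rw [h] at h1
      simp at h1) Finset.univ
  have hbK : ∀ i, b i ∈ spanCone G b₀ Finset.univ := by
    intro i
    refine ⟨η / 2, fun k => if k = i then 1 else 0, by linarith,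
      fun k => by positivity, ?_⟩
    rw [Finset.sum_eq_single i]
    · simp only [b, b₀, if_true, Complex.ofReal_one, one_smul]
      rw [add_left_comm, ← add_smul, ← Complex.ofReal_add, add_halves]
    · intro k _ hk
      simp [hk]
    · simp
  have hbH : ∀ i, (b i).IsHermitian := fun i => (hA i).1.add (hsm _ _ hG.isHermitian)
  rcases Nat.eq_zero_or_pos n with hn | hn
  · subst hn
    have : m = 0 := by omega
    subst this
    simp only [Nat.not_lt_zero, if_false]
    rw [wedgeCoeff_const]
    exact det_ne_zero_of_posDef hG
  · have h := wedgeCoeff_partial_ne_zero hmn hstab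
      (fun y hy z hz r hr => spanCone_add hy hz hr) hbH hbK (le_refl m) Matrix.isHermitian_zero
      (hbK ⟨0, hn⟩)
    convert h using 3 with i
    split_ifs <;> rfl

theorem wedgeCoeff_smul_lt (G : Matrix (Fin n) (Fin n) ℂ) {m : ℕ} (hmn : m ≤ n)
    (A : Fin n → Matrix (Fin n) (Fin n) ℂ) (c : ℂ) :
    wedgeCoeff (fun i : Fin n => if (i : ℕ) < m then c • A i else G) =
      c ^ m * wedgeCoeff (fun i : Fin n => if (i : ℕ) < m then A i else G) := by
  have h := (wedgeMultilinear n).map_piecewise_smul (fun _ => c)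
    (fun i : Fin n => if (i : ℕ) < m then A i else G)
    (Finset.univ.filter fun i : Fin n => (i : ℕ) < m)
  have hc : (Finset.univ.filter fun i : Fin n => (i : ℕ) < m).card = m := by
    rw [Fin.card_filter_val_lt]; omega
  simp only [wedgeMultilinear_apply, Finset.prod_const, smul_eq_mul, hc] at h
  rw [← h]
  congr 1
  funext i
  by_cases hi : (i : ℕ) < m <;> simp [Finset.piecewise, hi]

/-- Gårding's inequality: the mixed product of `m`-positive forms is non-negative. -/
theorem wedgeCoeff_nonneg_of_isMPositive {G : Matrix (Fin n) (Fin n) ℂ} (hG : G.PosDef) {m : ℕ}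
    (hmn : m ≤ n) {A : Fin n → Matrix (Fin n) (Fin n) ℂ} (hA : ∀ i, IsMPositive m G (A i)) :
    0 ≤ (wedgeCoeff fun i : Fin n => if (i : ℕ) < m then A i else G).re := by
  have hsm : ∀ (r : ℝ) (b : Matrix (Fin n) (Fin n) ℂ), b.IsHermitian →
      ((r : ℂ) • b).IsHermitian := fun r b hb => by
    rw [Matrix.IsHermitian, Matrix.conjTranspose_smul, hb.eq]; simp
  -- Along this path, positive at `s = 0`, the mixed product never vanishes: for `s > 0` it is a
  -- rescaling of the product of the forms `A i + s⁻¹ • G`. Thus it stays positive, and `s → ∞`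
  -- gives the inequality.
  let f : ℝ → ℝ := fun s => (wedgeCoeff fun i : Fin n =>
    if (i : ℕ) < m then G + (s : ℂ) • A i else G).re
  have hf : Continuous f := by
    refine Complex.continuous_re.comp (continuous_wedgeCoeff.comp (continuous_pi fun i => ?_))
    split_ifs
    · fun_prop
    · fun_prop
  have hscale : ∀ s : ℝ, s ≠ 0 → f s = s ^ m * (wedgeCoeff fun i : Fin n =>
      if (i : ℕ) < m then A i + ((s⁻¹ : ℝ) : ℂ) • G else G).re := by
    intro s hs
    have hsc : (s : ℂ) ≠ 0 := by exact_mod_cast hs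
    have : (fun i : Fin n => if (i : ℕ) < m then G + (s : ℂ) • A i else G) =
        fun i : Fin n => if (i : ℕ) < m then (s : ℂ) • (A i + ((s⁻¹ : ℝ) : ℂ) • G) else G := by
      funext i
      congr 1
      rw [smul_add, smul_smul, Complex.ofReal_inv, mul_inv_cancel₀ hsc, one_smul, add_comm]
    simp only [f]
    rw [this, wedgeCoeff_smul_lt G hmn, ← Complex.ofReal_pow, Complex.re_ofReal_mul]
  have hne : ∀ s : ℝ, 0 < s → f s ≠ 0 := by
    intro s hs h0
    rw [hscale s hs.ne'] at h0
    have h1 := (mul_eq_zero.1 h0).resolve_left (pow_ne_zero _ hs.ne')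
    refine wedgeCoeff_add_smul_ne_zero hG hmn hA (inv_pos.2 hs) (Complex.ext h1 ?_)
    refine wedgeCoeff_im fun i => ?_
    split_ifs
    · exact (hA i).1.add (hsm _ _ hG.isHermitian)
    · exact hG.isHermitian
  have h0 : 0 < f 0 := by
    simp only [f, Complex.ofReal_zero, zero_smul, add_zero, ite_self]
    rw [wedgeCoeff_const]
    exact factorial_mul_det_re_pos hG
  have hpos : ∀ s : ℝ, 0 < s → 0 < f s := by
    intro s hs
    by_contra hneg
    rw [not_lt] at hneg
    obtain ⟨u, hu, hu0⟩ := intermediate_value_Icc' hs.le hf.continuousOn ⟨hneg, h0.le⟩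
    rcases hu.1.eq_or_lt with rfl | hu'
    · exact h0.ne' hu0
    · exact hne u hu' hu0
  let g : ℝ → ℝ := fun η => (wedgeCoeff fun i : Fin n =>
    if (i : ℕ) < m then A i + (η : ℂ) • G else G).re
  have hg : Continuous g := by
    refine Complex.continuous_re.comp (continuous_wedgeCoeff.comp (continuous_pi fun i => ?_))
    split_ifs
    · fun_prop
    · fun_prop
  have hgpos : ∀ η : ℝ, 0 < η → 0 ≤ g η := by
    intro η hη
    have h1 := hpos η⁻¹ (inv_pos.2 hη)
    rw [hscale _ (inv_pos.2 hη).ne', inv_inv] at h1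
    exact (pos_of_mul_pos_right h1 (by positivity)).le
  have hlim : Tendsto g (𝓝[>] 0) (𝓝 (g 0)) := hg.continuousAt.mono_left nhdsWithin_le_nhds
  have h := ge_of_tendsto hlim (eventually_nhdsWithin_of_forall hgpos)
  simpa [g] using h

/-- Positive semidefinite forms are `m`-positive. -/
theorem Matrix.PosSemidef.isMPositive {G X : Matrix (Fin n) (Fin n) ℂ} (hG : G.PosDef)
    (hX : X.PosSemidef) {m : ℕ} (hmn : m ≤ n) : IsMPositive m G X := by
  refine ⟨hX.isHermitian, fun k hk1 hkm => ?_⟩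
  -- For `X ≥ 0` the roots of the determinant are nonpositive, and Gauss–Lucas transmits this to
  -- every `k`. Positivity for `X + η • G` then follows by continuity from `G`, and `η → 0`
  -- concludes.
  have hroot : ∀ t : ℂ, powCoeff G k (X + t • G) = 0 → t ∈ {t : ℂ | t.im = 0 ∧ t.re ≤ 0} := by
    intro t ht
    refine powCoeff_roots (s := {t : ℂ | t.im = 0 ∧ t.re ≤ 0}) hG ?_ (fun t ht => ?_)
      (hkm.trans hmn) ht
    · intro a ha b hb p q hp hq _
      simp only [Set.mem_ofPred_eq] at *
      refine ⟨by simp [ha, hb], ?_⟩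
      simp only [Complex.add_re, Complex.smul_re, smul_eq_mul]
      have := mul_nonpos_of_nonneg_of_nonpos hp ha.2
      have := mul_nonpos_of_nonneg_of_nonpos hq hb.2
      linarith
    · obtain ⟨w, r, hr, h⟩ := exists_form_eq_of_det_eq_zero hG ht
      have h1 := Complex.nonneg_iff.1 (hX.dotProduct_mulVec_nonneg w)
      rw [h] at h1
      simp only [Complex.neg_re, Complex.neg_im, Complex.mul_re, Complex.mul_im,
        Complex.ofReal_re, Complex.ofReal_im, mul_zero, sub_zero, zero_add] at h1
      refine ⟨?_, ?_⟩
      · have h2 : t.im * r = 0 := by linarith [h1.2]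
        exact (mul_eq_zero.1 h2).resolve_right hr.ne'
      · by_contra hneg
        rw [not_le] at hneg
        have := mul_pos hneg hr
        linarith [h1.1]
  let f : ℝ → ℝ := fun s => (powCoeff G k (G + (s : ℂ) • X)).re
  have hf : Continuous f := by
    refine Complex.continuous_re.comp ((continuous_powCoeff G k).comp ?_)
    fun_prop
  have hsm : ∀ (r : ℝ) (b : Matrix (Fin n) (Fin n) ℂ), b.IsHermitian →
      ((r : ℂ) • b).IsHermitian := fun r b hb => by
    rw [Matrix.IsHermitian, Matrix.conjTranspose_smul, hb.eq]; simp
  have hscale : ∀ s : ℝ, s ≠ 0 → powCoeff G k (G + (s : ℂ) • X) =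
      (s : ℂ) ^ k * powCoeff G k (X + ((s⁻¹ : ℝ) : ℂ) • G) := by
    intro s hs
    have hsc : (s : ℂ) ≠ 0 := by exact_mod_cast hs
    rw [← powCoeff_smul G (hkm.trans hmn), smul_add, smul_smul, Complex.ofReal_inv,
      mul_inv_cancel₀ hsc, one_smul, add_comm]
  have h0 : 0 < f 0 := by
    simp only [f, Complex.ofReal_zero, zero_smul, add_zero]
    rw [powCoeff_self]
    exact factorial_mul_det_re_pos hG
  have hne : ∀ s : ℝ, 0 < s → f s ≠ 0 := by
    intro s hs hs0
    have him : (powCoeff G k (G + (s : ℂ) • X)).im = 0 := by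
      refine wedgeCoeff_im fun i => ?_
      split_ifs
      · exact hG.isHermitian.add (hsm _ _ hX.isHermitian)
      · exact hG.isHermitian
    have h1 : powCoeff G k (G + (s : ℂ) • X) = 0 := Complex.ext hs0 him
    rw [hscale s hs.ne'] at h1
    have h2 := (mul_eq_zero.1 h1).resolve_left
      (pow_ne_zero _ (by exact_mod_cast hs.ne'))
    have h3 := (hroot _ h2).2
    rw [Complex.ofReal_re] at h3
    exact absurd (inv_pos.2 hs) h3.not_gt
  let g : ℝ → ℝ := fun η => (powCoeff G k (X + (η : ℂ) • G)).re
  have hg : Continuous g := by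
    refine Complex.continuous_re.comp ((continuous_powCoeff G k).comp ?_)
    fun_prop
  have hgpos : ∀ η : ℝ, 0 < η → 0 ≤ g η := by
    intro η hη
    have h1 : 0 < f η⁻¹ := by
      by_contra hneg
      rw [not_lt] at hneg
      obtain ⟨u, hu, hu0⟩ :=
        intermediate_value_Icc' (inv_pos.2 hη).le hf.continuousOn ⟨hneg, h0.le⟩
      rcases hu.1.eq_or_lt with rfl | hu'
      · exact h0.ne' hu0
      · exact hne u hu' hu0
    simp only [f] at h1
    rw [hscale _ (inv_pos.2 hη).ne', inv_inv, ← Complex.ofReal_pow, Complex.re_ofReal_mul] at h1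
    exact (pos_of_mul_pos_right h1 (by positivity)).le
  have hlim : Tendsto g (𝓝[>] 0) (𝓝 (g 0)) := hg.continuousAt.mono_left nhdsWithin_le_nhds
  have h := ge_of_tendsto hlim (eventually_nhdsWithin_of_forall hgpos)
  simpa [g, powCoeff] using h

end Garding

/-! ### Calculus of Wirtinger derivatives -/

section Wirtinger

variable {n : ℕ} {z : Cn n}

theorem Filter.EventuallyEq.wirtinger {F G : Cn n → ℂ} (h : F =ᶠ[𝓝 z] G) (j : Fin n) :
    wirtinger j F =ᶠ[𝓝 z] wirtinger j G := by
  filter_upwards [h.fderiv (𝕜 := ℝ)] with w hw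
  simp only [_root_.wirtinger, hw]

theorem Filter.EventuallyEq.wirtingerBar {F G : Cn n → ℂ} (h : F =ᶠ[𝓝 z] G) (j : Fin n) :
    wirtingerBar j F =ᶠ[𝓝 z] wirtingerBar j G := by
  filter_upwards [h.fderiv (𝕜 := ℝ)] with w hw
  simp only [_root_.wirtingerBar, hw]

theorem Filter.EventuallyEq.leviMatrix {f g : Cn n → ℝ} (h : f =ᶠ[𝓝 z] g) :
    leviMatrix f =ᶠ[𝓝 z] leviMatrix g := by
  have h1 : ∀ j k, (_root_.wirtinger j (_root_.wirtingerBar k fun w => (f w : ℂ))) =ᶠ[𝓝 z]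
      _root_.wirtinger j (_root_.wirtingerBar k fun w => (g w : ℂ)) := fun j k =>
    (EventuallyEq.wirtingerBar (h.mono fun w hw => by simp [hw]) k).wirtinger j
  have h2 : ∀ᶠ w in 𝓝 z, ∀ j k, (_root_.wirtinger j (_root_.wirtingerBar k fun w => (f w : ℂ))) w =
      _root_.wirtinger j (_root_.wirtingerBar k fun w => (g w : ℂ)) w :=
    eventually_all.2 fun j => eventually_all.2 fun k => h1 j k
  filter_upwards [h2] with w hw
  ext j k
  exact hw j k

theorem wirtinger_add {F G : Cn n → ℂ} (hF : DifferentiableAt ℝ F z)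
    (hG : DifferentiableAt ℝ G z) (j : Fin n) :
    wirtinger j (fun w => F w + G w) z = wirtinger j F z + wirtinger j G z := by
  simp only [wirtinger, fderiv_fun_add hF hG, add_apply]
  ring

theorem wirtingerBar_add {F G : Cn n → ℂ} (hF : DifferentiableAt ℝ F z)
    (hG : DifferentiableAt ℝ G z) (j : Fin n) :
    wirtingerBar j (fun w => F w + G w) z = wirtingerBar j F z + wirtingerBar j G z := by
  simp only [wirtingerBar, fderiv_fun_add hF hG, add_apply]
  ring

theorem wirtinger_mul {F G : Cn n → ℂ} (hF : DifferentiableAt ℝ F z)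
    (hG : DifferentiableAt ℝ G z) (j : Fin n) :
    wirtinger j (fun w => F w * G w) z = F z * wirtinger j G z + wirtinger j F z * G z := by
  simp only [wirtinger, fderiv_fun_mul hF hG, add_apply,
    smul_apply, smul_eq_mul]
  ring

theorem wirtingerBar_mul {F G : Cn n → ℂ} (hF : DifferentiableAt ℝ F z)
    (hG : DifferentiableAt ℝ G z) (j : Fin n) :
    wirtingerBar j (fun w => F w * G w) z = F z * wirtingerBar j G z + wirtingerBar j F z * G z := by
  simp only [wirtingerBar, fderiv_fun_mul hF hG, add_apply,
    smul_apply, smul_eq_mul]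
  ring

theorem fderiv_ofReal_comp {f : Cn n → ℝ} (hf : DifferentiableAt ℝ f z) (v : Cn n) :
    fderiv ℝ (fun w => (f w : ℂ)) z v = (fderiv ℝ f z v : ℂ) := by
  have := (Complex.ofRealCLM.hasFDerivAt.comp z hf.hasFDerivAt).fderiv
  simp only [Function.comp_def, Complex.ofRealCLM_apply] at this
  rw [this]
  simp

/-- The vector `(∂f/∂z_j)` of a real function. -/
noncomputable def wirtingerGrad (f : Cn n → ℝ) (z : Cn n) : Fin n → ℂ :=
  fun j => wirtinger j (fun w => (f w : ℂ)) z

theorem star_wirtingerGrad {f : Cn n → ℝ} (hf : DifferentiableAt ℝ f z) (k : Fin n) :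
    star (wirtingerGrad f z) k = wirtingerBar k (fun w => (f w : ℂ)) z := by
  simp only [wirtingerGrad, Pi.star_apply, wirtinger, wirtingerBar, fderiv_ofReal_comp hf,
    Complex.star_def, map_div₀, map_sub, map_mul, Complex.conj_ofReal, Complex.conj_I, map_ofNat]
  ring

theorem fderiv_real_comp {f : Cn n → ℝ} {κ : ℝ → ℝ} {κ' : ℝ} (hf : DifferentiableAt ℝ f z)
    (hκ : HasDerivAt κ κ' (f z)) (v : Cn n) :
    fderiv ℝ (fun w => ((κ (f w) : ℝ) : ℂ)) z v = κ' * fderiv ℝ (fun w => (f w : ℂ)) z v := by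
  have h1 := hκ.comp_hasFDerivAt z hf.hasFDerivAt
  have h2 : DifferentiableAt ℝ (fun w => κ (f w)) z := h1.differentiableAt
  rw [fderiv_ofReal_comp h2, fderiv_ofReal_comp hf]
  have h3 : fderiv ℝ (fun w => κ (f w)) z = κ' • fderiv ℝ f z := h1.fderiv
  rw [h3]
  simp

theorem wirtinger_comp {f : Cn n → ℝ} {κ : ℝ → ℝ} {κ' : ℝ} (hf : DifferentiableAt ℝ f z)
    (hκ : HasDerivAt κ κ' (f z)) (j : Fin n) :
    wirtinger j (fun w => ((κ (f w) : ℝ) : ℂ)) z = κ' * wirtinger j (fun w => (f w : ℂ)) z := by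
  simp only [wirtinger, fderiv_real_comp hf hκ]
  ring

theorem wirtingerBar_comp {f : Cn n → ℝ} {κ : ℝ → ℝ} {κ' : ℝ} (hf : DifferentiableAt ℝ f z)
    (hκ : HasDerivAt κ κ' (f z)) (j : Fin n) :
    wirtingerBar j (fun w => ((κ (f w) : ℝ) : ℂ)) z =
      κ' * wirtingerBar j (fun w => (f w : ℂ)) z := by
  simp only [wirtingerBar, fderiv_real_comp hf hκ]
  ring

theorem wirtingerGrad_comp {f : Cn n → ℝ} {κ : ℝ → ℝ} {κ' : ℝ} (hf : DifferentiableAt ℝ f z)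
    (hκ : HasDerivAt κ κ' (f z)) :
    wirtingerGrad (fun w => κ (f w)) z = (κ' : ℂ) • wirtingerGrad f z := by
  funext j
  exact wirtinger_comp hf hκ j

theorem ContDiffAt.eventually_contDiffAt_two {E F : Type*} [NormedAddCommGroup E]
    [NormedSpace ℝ E] [NormedAddCommGroup F] [NormedSpace ℝ F] {f : E → F} {x : E}
    (hf : ContDiffAt ℝ 2 f x) : ∀ᶠ y in 𝓝 x, ContDiffAt ℝ 2 f y :=
  hf.eventually (by decide)

theorem ContDiffAt.differentiableAt_two {E F : Type*} [NormedAddCommGroup E]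
    [NormedSpace ℝ E] [NormedAddCommGroup F] [NormedSpace ℝ F] {f : E → F} {x : E}
    (hf : ContDiffAt ℝ 2 f x) : DifferentiableAt ℝ f x :=
  hf.differentiableAt (by norm_num)

theorem ContDiffAt.ofReal {f : Cn n → ℝ} {k : WithTop ℕ∞} (hf : ContDiffAt ℝ k f z) :
    ContDiffAt ℝ k (fun w => (f w : ℂ)) z :=
  Complex.ofRealCLM.contDiff.contDiffAt.comp z hf

theorem ContDiffAt.fderiv_apply_one {F : Cn n → ℂ} (hF : ContDiffAt ℝ 2 F z) (v : Cn n) :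
    ContDiffAt ℝ 1 (fun w => fderiv ℝ F w v) z :=
  (hF.fderiv_right (m := 1) (by norm_num)).clm_apply contDiffAt_const

theorem ContDiffAt.wirtinger_one {F : Cn n → ℂ} (hF : ContDiffAt ℝ 2 F z) (j : Fin n) :
    ContDiffAt ℝ 1 (wirtinger j F) z := by
  unfold wirtinger
  exact ((hF.fderiv_apply_one _).sub (contDiffAt_const.mul (hF.fderiv_apply_one _))).div_const 2

theorem ContDiffAt.wirtingerBar_one {F : Cn n → ℂ} (hF : ContDiffAt ℝ 2 F z) (j : Fin n) :
    ContDiffAt ℝ 1 (wirtingerBar j F) z := by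
  unfold wirtingerBar
  exact ((hF.fderiv_apply_one _).add (contDiffAt_const.mul (hF.fderiv_apply_one _))).div_const 2

theorem ContDiffAt.wirtingerBar_differentiableAt {F : Cn n → ℂ} (hF : ContDiffAt ℝ 2 F z)
    (j : Fin n) : DifferentiableAt ℝ (wirtingerBar j F) z :=
  (hF.wirtingerBar_one j).differentiableAt (by norm_num)

theorem wirtinger_wirtingerBar_mul {F G : Cn n → ℂ} (hF : ContDiffAt ℝ 2 F z)
    (hG : ContDiffAt ℝ 2 G z) (j k : Fin n) :
    wirtinger j (wirtingerBar k fun w => F w * G w) z =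
      F z * wirtinger j (wirtingerBar k G) z + wirtinger j (wirtingerBar k F) z * G z +
      wirtinger j F z * wirtingerBar k G z + wirtinger j G z * wirtingerBar k F z := by
  have h : (wirtingerBar k fun w => F w * G w) =ᶠ[𝓝 z]
      fun w => F w * wirtingerBar k G w + wirtingerBar k F w * G w := by
    filter_upwards [hF.eventually_contDiffAt_two, hG.eventually_contDiffAt_two] with w h1 h2
    exact wirtingerBar_mul h1.differentiableAt_two h2.differentiableAt_two k
  have hF1 := hF.differentiableAt_two
  have hG1 := hG.differentiableAt_two
  have hF2 := hF.wirtingerBar_differentiableAt k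
  have hG2 := hG.wirtingerBar_differentiableAt k
  rw [(h.wirtinger j).eq_of_nhds, wirtinger_add (hF1.fun_mul hG2) (hF2.fun_mul hG1),
    wirtinger_mul hF1 hG2, wirtinger_mul hF2 hG1]
  ring

theorem leviMatrix_add {f g : Cn n → ℝ} (hf : ContDiffAt ℝ 2 f z) (hg : ContDiffAt ℝ 2 g z) :
    leviMatrix (fun w => f w + g w) z = leviMatrix f z + leviMatrix g z := by
  ext j k
  have h : (wirtingerBar k fun w => ((f w + g w : ℝ) : ℂ)) =ᶠ[𝓝 z]
      fun w => wirtingerBar k (fun w => (f w : ℂ)) w + wirtingerBar k (fun w => (g w : ℂ)) w := by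
    filter_upwards [hf.eventually_contDiffAt_two, hg.eventually_contDiffAt_two] with w h1 h2
    simp only [Complex.ofReal_add]
    exact wirtingerBar_add h1.ofReal.differentiableAt_two h2.ofReal.differentiableAt_two k
  simp only [leviMatrix, Matrix.of_apply, Matrix.add_apply]
  rw [(h.wirtinger j).eq_of_nhds,
    wirtinger_add (hf.ofReal.wirtingerBar_differentiableAt k)
      (hg.ofReal.wirtingerBar_differentiableAt k)]

theorem leviMatrix_mul {f g : Cn n → ℝ} (hf : ContDiffAt ℝ 2 f z) (hg : ContDiffAt ℝ 2 g z) :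
    leviMatrix (fun w => f w * g w) z = (f z : ℂ) • leviMatrix g z + (g z : ℂ) • leviMatrix f z +
      Matrix.vecMulVec (wirtingerGrad f z) (star (wirtingerGrad g z)) +
      Matrix.vecMulVec (wirtingerGrad g z) (star (wirtingerGrad f z)) := by
  ext j k
  simp only [leviMatrix, Matrix.of_apply, Matrix.add_apply, Matrix.smul_apply, smul_eq_mul,
    Matrix.vecMulVec_apply, star_wirtingerGrad hf.differentiableAt_two,
    star_wirtingerGrad hg.differentiableAt_two, Complex.ofReal_mul]
  rw [wirtinger_wirtingerBar_mul hf.ofReal hg.ofReal]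
  simp only [wirtingerGrad]
  ring

theorem leviMatrix_comp {f : Cn n → ℝ} {κ κ' : ℝ → ℝ} {κ'' : ℝ} (hf : ContDiffAt ℝ 2 f z)
    (hκ : ∀ᶠ s in 𝓝 (f z), HasDerivAt κ (κ' s) s) (hκ' : HasDerivAt κ' κ'' (f z)) :
    leviMatrix (fun w => κ (f w)) z = (κ' (f z) : ℂ) • leviMatrix f z +
      (κ'' : ℂ) • Matrix.vecMulVec (wirtingerGrad f z) (star (wirtingerGrad f z)) := by
  ext j k
  simp only [leviMatrix, Matrix.of_apply, Matrix.add_apply, Matrix.smul_apply, smul_eq_mul,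
    Matrix.vecMulVec_apply, star_wirtingerGrad hf.differentiableAt_two]
  have h : (wirtingerBar k fun w => ((κ (f w) : ℝ) : ℂ)) =ᶠ[𝓝 z]
      fun w => ((κ' (f w) : ℝ) : ℂ) * wirtingerBar k (fun w => (f w : ℂ)) w := by
    filter_upwards [hf.eventually_contDiffAt_two, hf.continuousAt.eventually hκ] with w h1 h2
    exact wirtingerBar_comp h1.differentiableAt_two h2 k
  have h3 : DifferentiableAt ℝ (fun w => ((κ' (f w) : ℝ) : ℂ)) z :=
    Complex.ofRealCLM.differentiableAt.comp z
      (hκ'.differentiableAt.comp z hf.differentiableAt_two)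
  rw [(h.wirtinger j).eq_of_nhds, wirtinger_mul h3 (hf.ofReal.wirtingerBar_differentiableAt k),
    wirtinger_comp hf.differentiableAt_two hκ']
  simp only [wirtingerGrad]
  ring

/-! ### The Levi form -/

/-- The form `D²f(v,v) + D²f(iv,iv)`, four times the Levi form of `f` at `z`. -/
noncomputable def leviForm (f : Cn n → ℝ) (z v : Cn n) : ℝ :=
  fderiv ℝ (fderiv ℝ f) z v v +
    fderiv ℝ (fderiv ℝ f) z (Complex.I • v) (Complex.I • v)

theorem fderiv_fderiv_apply {f : Cn n → ℝ} (hf : ContDiffAt ℝ 2 f z) (u v : Cn n) :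
    fderiv ℝ (fun w => fderiv ℝ (fun w' => (f w' : ℂ)) w v) z u =
      (fderiv ℝ (fderiv ℝ f) z u v : ℂ) := by
  have h : (fun w => fderiv ℝ (fun w' => (f w' : ℂ)) w v) =ᶠ[𝓝 z]
      fun w => ((fderiv ℝ f w v : ℝ) : ℂ) := by
    filter_upwards [hf.eventually_contDiffAt_two] with w hw
    exact fderiv_ofReal_comp hw.differentiableAt_two v
  have h1 : DifferentiableAt ℝ (fderiv ℝ f) z :=
    (hf.fderiv_right (m := 1) (by norm_num)).differentiableAt (by norm_num)
  rw [h.fderiv_eq, fderiv_ofReal_comp (h1.clm_apply (differentiableAt_const v))]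
  congr 1
  rw [fderiv_clm_apply h1 (differentiableAt_const v)]
  simp

theorem wirtinger_wirtingerBar_eq {f : Cn n → ℝ} (hf : ContDiffAt ℝ 2 f z) (j k : Fin n) :
    leviMatrix f z j k =
      ((fderiv ℝ (fderiv ℝ f) z (Pi.single j 1) (Pi.single k 1) : ℂ) +
        fderiv ℝ (fderiv ℝ f) z (Pi.single j Complex.I) (Pi.single k Complex.I) +
        Complex.I * (fderiv ℝ (fderiv ℝ f) z (Pi.single j 1) (Pi.single k Complex.I) -
          fderiv ℝ (fderiv ℝ f) z (Pi.single j Complex.I) (Pi.single k 1))) / 4 := by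
  have hd : ∀ u : Cn n, fderiv ℝ (wirtingerBar k fun w => (f w : ℂ)) z u =
      ((fderiv ℝ (fderiv ℝ f) z u (Pi.single k 1) : ℂ) +
        Complex.I * fderiv ℝ (fderiv ℝ f) z u (Pi.single k Complex.I)) / 2 := by
    intro u
    have h1 : ∀ v, DifferentiableAt ℝ (fun w => fderiv ℝ (fun w => (f w : ℂ)) w v) z := fun v =>
      (hf.ofReal.fderiv_apply_one v).differentiableAt (by norm_num)
    have h2 : (wirtingerBar k fun w => (f w : ℂ)) = fun w =>
        (1 / 2 : ℂ) * (fderiv ℝ (fun w => (f w : ℂ)) w (Pi.single k 1) +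
          Complex.I * fderiv ℝ (fun w => (f w : ℂ)) w (Pi.single k Complex.I)) := by
      funext w
      simp only [wirtingerBar]
      ring
    rw [h2, fderiv_const_mul ((h1 _).fun_add ((h1 _).const_mul _)),
      fderiv_fun_add (h1 _) ((h1 _).const_mul _), fderiv_const_mul (h1 _)]
    simp only [smul_apply, add_apply, smul_eq_mul,
      fderiv_fderiv_apply hf]
    ring
  simp only [leviMatrix, Matrix.of_apply]
  rw [wirtinger, hd, hd]
  linear_combination (-(1 / 4 : ℂ) *
    fderiv ℝ (fderiv ℝ f) z (Pi.single j Complex.I) (Pi.single k Complex.I)) * Complex.I_mul_I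

end Wirtinger

/-! ### The Levi matrix as a Hermitian form; integration by parts -/

section Wirtinger

variable {n : ℕ} {z : Cn n}

/-- The sesquilinear form attached to a real bilinear form. -/
noncomputable def sesqOfBilin (H : Cn n →L[ℝ] Cn n →L[ℝ] ℝ) : Cn n →ₗ[ℂ] Cn n →ₗ⋆[ℂ] ℂ :=
  LinearMap.mk₂'ₛₗ (RingHom.id ℂ) (starRingEnd ℂ)
    (fun u v => ((H u v : ℂ) + H (Complex.I • u) (Complex.I • v) +
      Complex.I * (H u (Complex.I • v) - H (Complex.I • u) v)) / 4)
    (fun u u' v => by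
      simp only [map_add, add_apply, smul_add, Complex.ofReal_add]
      ring)
    (fun c u v => by
      have hc : c • u = c.re • u + c.im • (Complex.I • u) := by
        ext i
        simp only [Pi.smul_apply, Pi.add_apply, smul_eq_mul, Complex.real_smul]
        linear_combination (-u i) * Complex.re_add_im c
      have hI : Complex.I • c • u = c.re • (Complex.I • u) - c.im • u := by
        ext i
        simp only [Pi.smul_apply, Pi.sub_apply, smul_eq_mul, Complex.real_smul]
        linear_combination (-Complex.I * u i) * Complex.re_add_im c +
          c.im * u i * Complex.I_mul_I
      rw [hI, hc]
      simp only [map_add, map_sub, map_smul, add_apply, sub_apply, smul_apply, smul_eq_mul,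
        Complex.ofReal_add, Complex.ofReal_sub, Complex.ofReal_mul, RingHom.id_apply]
      conv_rhs => rw [← Complex.re_add_im c]
      linear_combination (-(c.im : ℂ) / 4 * (H u (Complex.I • v) - H (Complex.I • u) v)) *
        Complex.I_mul_I)
    (fun u v v' => by
      simp only [map_add, smul_add, Complex.ofReal_add]
      ring)
    (fun c u v => by
      have hc : c • v = c.re • v + c.im • (Complex.I • v) := by
        ext i
        simp only [Pi.smul_apply, Pi.add_apply, smul_eq_mul, Complex.real_smul]
        linear_combination (-v i) * Complex.re_add_im c
      have hI : Complex.I • c • v = c.re • (Complex.I • v) - c.im • v := by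
        ext i
        simp only [Pi.smul_apply, Pi.sub_apply, smul_eq_mul, Complex.real_smul]
        linear_combination (-Complex.I * v i) * Complex.re_add_im c +
          c.im * v i * Complex.I_mul_I
      rw [hI, hc]
      simp only [map_add, map_sub, map_smul, smul_eq_mul,
        Complex.ofReal_add, Complex.ofReal_sub, Complex.ofReal_mul]
      have hcc : starRingEnd ℂ c = c.re - c.im * Complex.I := by
        apply Complex.ext <;> simp
      rw [hcc]
      linear_combination ((c.im : ℂ) / 4 * (H u (Complex.I • v) - H (Complex.I • u) v)) *
        Complex.I_mul_I)

theorem sesqOfBilin_apply (H : Cn n →L[ℝ] Cn n →L[ℝ] ℝ) (u v : Cn n) :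
    sesqOfBilin H u v = ((H u v : ℂ) + H (Complex.I • u) (Complex.I • v) +
      Complex.I * (H u (Complex.I • v) - H (Complex.I • u) v)) / 4 := rfl

theorem Cn_eq_sum_single (u : Cn n) : u = ∑ j, u j • (Pi.single j 1 : Cn n) := by
  rw [pi_eq_sum_univ' u]
  refine Finset.sum_congr rfl fun j _ => ?_
  ext i
  simp [Pi.single_apply]

theorem sesq_eq_sum {S : Cn n →ₗ[ℂ] Cn n →ₗ⋆[ℂ] ℂ} (u v : Cn n) :
    S u v = ∑ j, ∑ k, u j * starRingEnd ℂ (v k) * S (Pi.single j 1) (Pi.single k 1) := by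
  conv_lhs => rw [Cn_eq_sum_single u, Cn_eq_sum_single v]
  simp only [map_sum, LinearMap.sum_apply, map_smul, LinearMap.map_smulₛₗ, LinearMap.smul_apply,
    smul_eq_mul, Finset.mul_sum]
  rw [Finset.sum_comm]
  refine Finset.sum_congr rfl fun j _ => Finset.sum_congr rfl fun k _ => ?_
  ring

theorem I_smul_single (j : Fin n) :
    Complex.I • (Pi.single j 1 : Cn n) = Pi.single j Complex.I := by
  rw [← Pi.single_smul, smul_eq_mul, mul_one]

theorem leviMatrix_eq_sesq {f : Cn n → ℝ} (hf : ContDiffAt ℝ 2 f z) (j k : Fin n) :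
    leviMatrix f z j k =
      sesqOfBilin (fderiv ℝ (fderiv ℝ f) z) (Pi.single j 1) (Pi.single k 1) := by
  rw [wirtinger_wirtingerBar_eq hf, sesqOfBilin_apply, I_smul_single, I_smul_single]

theorem fderiv_fderiv_symm {f : Cn n → ℝ} (hf : ContDiffAt ℝ 2 f z) (u v : Cn n) :
    fderiv ℝ (fderiv ℝ f) z u v = fderiv ℝ (fderiv ℝ f) z v u :=
  (hf.isSymmSndFDerivAt (by simp)).eq u v

theorem leviMatrix_isHermitian {f : Cn n → ℝ} (hf : ContDiffAt ℝ 2 f z) :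
    (leviMatrix f z).IsHermitian := by
  refine Matrix.IsHermitian.ext fun j k => ?_
  rw [wirtinger_wirtingerBar_eq hf, wirtinger_wirtingerBar_eq hf]
  simp only [Complex.star_def, map_div₀, map_add, map_sub, map_mul, Complex.conj_ofReal,
    Complex.conj_I, map_ofNat]
  rw [fderiv_fderiv_symm hf (Pi.single k 1) (Pi.single j 1),
    fderiv_fderiv_symm hf (Pi.single k 1) (Pi.single j Complex.I),
    fderiv_fderiv_symm hf (Pi.single k Complex.I) (Pi.single j 1),
    fderiv_fderiv_symm hf (Pi.single k Complex.I) (Pi.single j Complex.I)]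
  ring

/-- Rows of the matrix carry the ∂/∂z_j, which are linear in the direction, so the quadratic form at
`v` is the Levi form at the conjugate vector. Semidefiniteness can thus be checked on real second
derivatives. -/
theorem star_dotProduct_leviMatrix {f : Cn n → ℝ} (hf : ContDiffAt ℝ 2 f z) (v : Fin n → ℂ) :
    star v ⬝ᵥ (leviMatrix f z).mulVec v = ((leviForm f z (star v) / 4 : ℝ) : ℂ) := by
  have h1 : sesqOfBilin (fderiv ℝ (fderiv ℝ f) z) (star v) (star v) =
      ((leviForm f z (star v) / 4 : ℝ) : ℂ) := by
    rw [sesqOfBilin_apply, fderiv_fderiv_symm hf (star v) (Complex.I • star v), leviForm]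
    push_cast
    ring
  rw [← h1, sesq_eq_sum]
  simp only [dotProduct, Matrix.mulVec, Finset.mul_sum]
  refine Finset.sum_congr rfl fun j _ => Finset.sum_congr rfl fun k _ => ?_
  rw [leviMatrix_eq_sesq hf]
  simp only [Pi.star_apply, Complex.star_def, Complex.conj_conj]
  ring

/-- Two integrations by parts bring the derivatives out in this opposite order. -/
theorem wirtingerBar_wirtinger {f : Cn n → ℝ} (hf : ContDiffAt ℝ 2 f z) (j k : Fin n) :
    wirtingerBar k (wirtinger j fun w => (f w : ℂ)) z = leviMatrix f z j k := by
  have hd : ∀ u : Cn n, fderiv ℝ (wirtinger j fun w => (f w : ℂ)) z u =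
      ((fderiv ℝ (fderiv ℝ f) z u (Pi.single j 1) : ℂ) -
        Complex.I * fderiv ℝ (fderiv ℝ f) z u (Pi.single j Complex.I)) / 2 := by
    intro u
    have h1 : ∀ v, DifferentiableAt ℝ (fun w => fderiv ℝ (fun w => (f w : ℂ)) w v) z := fun v =>
      (hf.ofReal.fderiv_apply_one v).differentiableAt (by norm_num)
    have h2 : (wirtinger j fun w => (f w : ℂ)) = fun w =>
        (1 / 2 : ℂ) * (fderiv ℝ (fun w => (f w : ℂ)) w (Pi.single j 1) -
          Complex.I * fderiv ℝ (fun w => (f w : ℂ)) w (Pi.single j Complex.I)) := by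
      funext w
      simp only [wirtinger]
      ring
    rw [h2, fderiv_const_mul ((h1 _).fun_sub ((h1 _).const_mul _)),
      fderiv_fun_sub (h1 _) ((h1 _).const_mul _), fderiv_const_mul (h1 _)]
    simp only [smul_apply, sub_apply, smul_eq_mul, fderiv_fderiv_apply hf]
    ring
  rw [wirtinger_wirtingerBar_eq hf, wirtingerBar, hd, hd,
    fderiv_fderiv_symm hf (Pi.single k 1) (Pi.single j 1),
    fderiv_fderiv_symm hf (Pi.single k 1) (Pi.single j Complex.I),
    fderiv_fderiv_symm hf (Pi.single k Complex.I) (Pi.single j 1),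
    fderiv_fderiv_symm hf (Pi.single k Complex.I) (Pi.single j Complex.I)]
  linear_combination (-(1 / 4 : ℂ) *
    fderiv ℝ (fderiv ℝ f) z (Pi.single j Complex.I) (Pi.single k Complex.I)) * Complex.I_mul_I

/-! ### Integration by parts -/

theorem ContinuousOn.continuous_mul_of_tsupport_subset {X : Type*} [TopologicalSpace X]
    {O : Set X} (hO : IsOpen O) {f g : X → ℂ} (hf : ContinuousOn f O) (hg : Continuous g)
    (hs : tsupport g ⊆ O) : Continuous fun x => f x * g x := by
  refine continuous_iff_continuousAt.2 fun x => ?_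
  by_cases hx : x ∈ tsupport g
  · exact ((hf.continuousAt (hO.mem_nhds (hs hx)))).mul hg.continuousAt
  · have : (fun x => f x * g x) =ᶠ[𝓝 x] fun _ => 0 := by
      filter_upwards [(isClosed_tsupport g).isOpen_compl.mem_nhds hx] with y hy
      rw [image_eq_zero_of_notMem_tsupport hy, mul_zero]
    exact continuousAt_const.congr this.symm

theorem ContinuousOn.integrable_mul_of_tsupport_subset {O : Set (Cn n)} (hO : IsOpen O)
    {f g : Cn n → ℂ} (hf : ContinuousOn f O) (hg : Continuous g) (hc : HasCompactSupport g)
    (hs : tsupport g ⊆ O) : Integrable fun x => f x * g x :=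
  (hf.continuous_mul_of_tsupport_subset hO hg hs).integrable_of_hasCompactSupport
    (hc.mul_left (f := f))

theorem integral_mul_fderiv_of_contDiffOn {O : Set (Cn n)} (hO : IsOpen O) {f g : Cn n → ℂ}
    (hf : ContDiffOn ℝ 1 f O) (hg : ContDiff ℝ 1 g) (hc : HasCompactSupport g)
    (hs : tsupport g ⊆ O) (v : Cn n) :
    ∫ x, f x * fderiv ℝ g x v = -∫ x, fderiv ℝ f x v * g x := by
  have hg' : Continuous fun x => fderiv ℝ g x v :=
    (hg.continuous_fderiv (by norm_num)).clm_apply continuous_const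
  have hf' : ContinuousOn (fun x => fderiv ℝ f x v) O :=
    (hf.continuousOn_fderiv_of_isOpen hO (by norm_num)).clm_apply continuousOn_const
  refine integral_mul_fderiv_eq_neg_fderiv_mul_of_integrable ?_ ?_ ?_ ?_ ?_
  · exact hf'.integrable_mul_of_tsupport_subset hO hg.continuous hc hs
  · exact hf.continuousOn.integrable_mul_of_tsupport_subset hO hg' (hc.fderiv_apply ℝ v)
      ((tsupport_fderiv_apply_subset ℝ v).trans hs)
  · exact hf.continuousOn.integrable_mul_of_tsupport_subset hO hg.continuous hc hs
  · intro x hx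
    exact (hf.differentiableOn (by norm_num)).differentiableAt (hO.mem_nhds (hs hx))
  · exact fun x _ => (hg.differentiable (by norm_num)).differentiableAt

theorem integrable_mul_fderiv_of_contDiffOn {O : Set (Cn n)} (hO : IsOpen O) {f g : Cn n → ℂ}
    (hf : ContinuousOn f O) (hg : ContDiff ℝ 1 g) (hc : HasCompactSupport g)
    (hs : tsupport g ⊆ O) (v : Cn n) : Integrable fun x => f x * fderiv ℝ g x v :=
  hf.integrable_mul_of_tsupport_subset hO
    ((hg.continuous_fderiv (by norm_num)).clm_apply continuous_const) (hc.fderiv_apply ℝ v)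
      ((tsupport_fderiv_apply_subset ℝ v).trans hs)

theorem integrable_fderiv_mul_of_contDiffOn {O : Set (Cn n)} (hO : IsOpen O) {f g : Cn n → ℂ}
    (hf : ContDiffOn ℝ 1 f O) (hg : Continuous g) (hc : HasCompactSupport g)
    (hs : tsupport g ⊆ O) (v : Cn n) : Integrable fun x => fderiv ℝ f x v * g x :=
  ((hf.continuousOn_fderiv_of_isOpen hO (by norm_num)).clm_apply
    continuousOn_const).integrable_mul_of_tsupport_subset hO hg hc hs

theorem integral_mul_wirtinger {O : Set (Cn n)} (hO : IsOpen O) {f g : Cn n → ℂ}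
    (hf : ContDiffOn ℝ 1 f O) (hg : ContDiff ℝ 1 g) (hc : HasCompactSupport g)
    (hs : tsupport g ⊆ O) (j : Fin n) :
    ∫ x, f x * wirtinger j g x = -∫ x, wirtinger j f x * g x := by
  have e1 : ∀ x, f x * wirtinger j g x = (1 / 2 : ℂ) * (f x * fderiv ℝ g x (Pi.single j 1)) -
      (Complex.I / 2) * (f x * fderiv ℝ g x (Pi.single j Complex.I)) := by
    intro x; simp only [wirtinger]; ring
  have e2 : ∀ x, wirtinger j f x * g x = (1 / 2 : ℂ) * (fderiv ℝ f x (Pi.single j 1) * g x) -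
      (Complex.I / 2) * (fderiv ℝ f x (Pi.single j Complex.I) * g x) := by
    intro x; simp only [wirtinger]; ring
  simp only [e1, e2]
  have i1 := fun v => integrable_mul_fderiv_of_contDiffOn hO hf.continuousOn hg hc hs v
  have i2 := fun v => integrable_fderiv_mul_of_contDiffOn hO hf hg.continuous hc hs v
  rw [integral_sub ((i1 _).const_mul _) ((i1 _).const_mul _),
    integral_sub ((i2 _).const_mul _) ((i2 _).const_mul _)]
  simp only [integral_const_mul, integral_mul_fderiv_of_contDiffOn hO hf hg hc hs]
  ring

theorem integral_mul_wirtingerBar {O : Set (Cn n)} (hO : IsOpen O) {f g : Cn n → ℂ}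
    (hf : ContDiffOn ℝ 1 f O) (hg : ContDiff ℝ 1 g) (hc : HasCompactSupport g)
    (hs : tsupport g ⊆ O) (j : Fin n) :
    ∫ x, f x * wirtingerBar j g x = -∫ x, wirtingerBar j f x * g x := by
  have e1 : ∀ x, f x * wirtingerBar j g x = (1 / 2 : ℂ) * (f x * fderiv ℝ g x (Pi.single j 1)) +
      (Complex.I / 2) * (f x * fderiv ℝ g x (Pi.single j Complex.I)) := by
    intro x; simp only [wirtingerBar]; ring
  have e2 : ∀ x, wirtingerBar j f x * g x = (1 / 2 : ℂ) * (fderiv ℝ f x (Pi.single j 1) * g x) +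
      (Complex.I / 2) * (fderiv ℝ f x (Pi.single j Complex.I) * g x) := by
    intro x; simp only [wirtingerBar]; ring
  simp only [e1, e2]
  have i1 := fun v => integrable_mul_fderiv_of_contDiffOn hO hf.continuousOn hg hc hs v
  have i2 := fun v => integrable_fderiv_mul_of_contDiffOn hO hf hg.continuous hc hs v
  rw [integral_add ((i1 _).const_mul _) ((i1 _).const_mul _),
    integral_add ((i2 _).const_mul _) ((i2 _).const_mul _)]
  simp only [integral_const_mul, integral_mul_fderiv_of_contDiffOn hO hf hg hc hs]
  ring

theorem HasCompactSupport.wirtingerBar {g : Cn n → ℂ} (hc : HasCompactSupport g) (k : Fin n) :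
    HasCompactSupport (wirtingerBar k g) := by
  refine hc.mono' fun x hx => ?_
  by_contra h
  refine hx ?_
  have h0 : fderiv ℝ g x = 0 := image_eq_zero_of_notMem_tsupport
    fun h' => h (tsupport_fderiv_subset ℝ h')
  simp [_root_.wirtingerBar, h0]

theorem tsupport_wirtingerBar_subset (g : Cn n → ℂ) (k : Fin n) :
    tsupport (wirtingerBar k g) ⊆ tsupport g := by
  refine closure_minimal (fun x hx => ?_) (isClosed_tsupport g)
  by_contra h
  refine hx ?_
  have h0 : fderiv ℝ g x = 0 := image_eq_zero_of_notMem_tsupport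
    fun h' => h (tsupport_fderiv_subset ℝ h')
  simp [wirtingerBar, h0]

theorem integral_mul_wirtinger_wirtingerBar {O : Set (Cn n)} (hO : IsOpen O) {u : Cn n → ℝ}
    {F : Cn n → ℂ} (hu : ContDiffOn ℝ 2 u O) (hF : ContDiff ℝ 2 F) (hc : HasCompactSupport F)
    (hs : tsupport F ⊆ O) (j k : Fin n) :
    ∫ x, (u x : ℂ) * wirtinger j (wirtingerBar k F) x = ∫ x, leviMatrix u x j k * F x := by
  have hat : ∀ x ∈ O, ContDiffAt ℝ 2 u x := fun x hx => hu.contDiffAt (hO.mem_nhds hx)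
  have hB : ContDiff ℝ 1 (wirtingerBar k F) :=
    contDiff_iff_contDiffAt.2 fun x => hF.contDiffAt.wirtingerBar_one k
  have h1 : ContDiffOn ℝ 1 (fun w => (u w : ℂ)) O := fun x hx =>
    ((hat x hx).ofReal.of_le (by norm_num)).contDiffWithinAt
  have h2 : ContDiffOn ℝ 1 (wirtinger j fun w => (u w : ℂ)) O := fun x hx =>
    ((hat x hx).ofReal.wirtinger_one j).contDiffWithinAt
  rw [integral_mul_wirtinger hO h1 hB (hc.wirtingerBar k)
    ((tsupport_wirtingerBar_subset F k).trans hs),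
    integral_mul_wirtingerBar hO h2 (hF.of_le (by norm_num)) hc hs, neg_neg]
  refine integral_congr_ae (Eventually.of_forall fun x => ?_)
  by_cases hx : x ∈ O
  · simp only [wirtingerBar_wirtinger (hat x hx)]
  · have : F x = 0 := image_eq_zero_of_notMem_tsupport fun h => hx (hs h)
    simp [this]

end Wirtinger

/-! ### Wedge products with a fixed form as linear functionals -/

section Functional

variable {n : ℕ}

/-- The functional `α ↦ α ∧ β₁ ∧ … ∧ β_{n-1}` (the form `B 0` is not used). -/
noncomputable def cofactorForm (B : Fin n → Matrix (Fin n) (Fin n) ℂ)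
    (X : Matrix (Fin n) (Fin n) ℂ) : ℂ :=
  wedgeCoeff fun i : Fin n => if (i : ℕ) = 0 then X else B i

theorem cofactorForm_eq_toLinearMap (hn : 0 < n) (B : Fin n → Matrix (Fin n) (Fin n) ℂ)
    (X : Matrix (Fin n) (Fin n) ℂ) :
    cofactorForm B X = (wedgeMultilinear n).toLinearMap B ⟨0, hn⟩ X := by
  simp only [cofactorForm, MultilinearMap.toLinearMap_apply, wedgeMultilinear_apply]
  congr 1
  funext i
  by_cases hi : i = ⟨0, hn⟩
  · subst hi; simp
  · have : (i : ℕ) ≠ 0 := fun h => hi (Fin.ext h)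
    simp [hi, this]

/-- The real part of `cofactorForm`, as a real linear functional. -/
noncomputable def cofactorLinear (hn : 0 < n) (B : Fin n → Matrix (Fin n) (Fin n) ℂ) :
    Matrix (Fin n) (Fin n) ℂ →ₗ[ℝ] ℝ :=
  Complex.reLm ∘ₗ ((wedgeMultilinear n).toLinearMap B ⟨0, hn⟩).restrictScalars ℝ

theorem cofactorLinear_apply (hn : 0 < n) (B : Fin n → Matrix (Fin n) (Fin n) ℂ)
    (X : Matrix (Fin n) (Fin n) ℂ) : cofactorLinear hn B X = (cofactorForm B X).re := by
  rw [cofactorForm_eq_toLinearMap hn]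
  rfl

theorem cofactorForm_eq_sum (hn : 0 < n) (B : Fin n → Matrix (Fin n) (Fin n) ℂ)
    (X : Matrix (Fin n) (Fin n) ℂ) :
    cofactorForm B X = ∑ j, ∑ k, X j k * cofactorForm B (Matrix.single j k 1) := by
  simp only [cofactorForm_eq_toLinearMap hn]
  conv_lhs => rw [Matrix.matrix_eq_sum_single X]
  simp only [map_sum]
  refine Finset.sum_congr rfl fun j _ => Finset.sum_congr rfl fun k _ => ?_
  rw [← smul_eq_mul, ← map_smul, Matrix.smul_single, smul_eq_mul, mul_one]

-- Gårding's inequality with `X` in slot 0, the `A i` next, and ω in the remaining slots. It places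
-- every admissible test form in the dual cone of the m-positive forms.
open scoped ComplexOrder in
theorem cofactorForm_nonneg {G : Matrix (Fin n) (Fin n) ℂ} (hG : G.PosDef) {m : ℕ} (hm : 1 ≤ m)
    (hmn : m ≤ n) {A : ℕ → Matrix (Fin n) (Fin n) ℂ}
    (hA : ∀ i, 1 ≤ i → i < m → IsMPositive m G (A i)) {X : Matrix (Fin n) (Fin n) ℂ}
    (hX : IsMPositive m G X) :
    0 ≤ (cofactorForm (fun i : Fin n => if (i : ℕ) < m then A i else G) X).re := by
  let A' : Fin n → Matrix (Fin n) (Fin n) ℂ := fun i =>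
    if (i : ℕ) = 0 then X else if (i : ℕ) < m then A i else G
  have h := wedgeCoeff_nonneg_of_isMPositive hG hmn (A := A') (fun i => by
    simp only [A']
    split_ifs with h1 h2
    · exact hX
    · exact hA i (by omega) h2
    · exact hG.posSemidef.isMPositive hG hmn)
  convert h using 2
  unfold cofactorForm
  congr 1
  funext i
  simp only [A']
  split_ifs with h1 h2 h2
  · rfl
  · omega
  · rfl
  · rfl

open scoped ComplexOrder in
/-- The form `α ↦ α ∧ ω^(n-1)` is positive definite. -/
theorem cofactorForm_vecMulVec_pos (hn : 0 < n) {G : Matrix (Fin n) (Fin n) ℂ} (hG : G.PosDef)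
    {v : Fin n → ℂ} (hv : v ≠ 0) :
    0 < (cofactorForm (fun _ => G) (Matrix.vecMulVec v (star v))).re := by
  set X := Matrix.vecMulVec v (star v) with hX
  -- The determinant is affine in a rank-one direction. By the Leibniz rule, `n!` times its slope
  -- equals `n` times the cofactor form at `X`, which is therefore positive.
  have hdet : ∀ t : ℂ, (G + t • X).det = G.det * (1 + t * (star v ⬝ᵥ G⁻¹.mulVec v)) := by
    intro t
    have hu : IsUnit G.det := isUnit_iff_ne_zero.2 hG.det_pos.ne'
    have h := Matrix.det_add_replicateCol_mul_replicateRow (ι := Unit) hu (t • v) (star v)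
    have e1 : Matrix.replicateCol Unit (t • v) * Matrix.replicateRow Unit (star v) = t • X := by
      rw [hX, ← Matrix.smul_vecMulVec, Matrix.vecMulVec_eq Unit]
    rw [e1] at h
    rw [h]
    congr 1
    rw [Matrix.det_unique]
    simp only [Matrix.add_apply, Matrix.one_apply_eq, Matrix.replicateCol_smul, Matrix.mul_smul,
      Matrix.smul_apply, smul_eq_mul]
    congr 2
    rw [Matrix.mul_assoc]
    simp only [Matrix.mul_apply, dotProduct, Matrix.mulVec, Matrix.replicateRow_apply,
      Matrix.replicateCol_apply]
  obtain ⟨P, -, -, hP3, hP4⟩ := exists_wedgePolynomial Finset.univ (fun _ => G) G X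
    (i := ⟨0, hn⟩) (Finset.mem_univ _)
  simp only [Finset.piecewise_univ, Finset.card_univ, Fintype.card_fin] at hP3 hP4
  have h1 : ∀ t, P.eval t = (n.factorial : ℂ) * G.det +
      t * ((n.factorial : ℂ) * G.det * (star v ⬝ᵥ G⁻¹.mulVec v)) := by
    intro t
    rw [hP3, wedgeCoeff_const, hdet]
    ring
  have h2 : P = Polynomial.C ((n.factorial : ℂ) * G.det) + Polynomial.X *
      Polynomial.C ((n.factorial : ℂ) * G.det * (star v ⬝ᵥ G⁻¹.mulVec v)) := by
    refine Polynomial.funext fun t => ?_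
    rw [h1]
    simp
  have h3 := hP4 0
  rw [h2] at h3
  simp only [Polynomial.derivative_add, Polynomial.derivative_C, Polynomial.derivative_mul,
    Polynomial.derivative_X, one_mul, mul_zero, add_zero, zero_add, Polynomial.eval_C,
    zero_smul] at h3
  have h4 : cofactorForm (fun _ => G) X =
      wedgeCoeff (Function.update (fun _ => G) ⟨0, hn⟩ X) := by
    rw [cofactorForm_eq_toLinearMap hn]; rfl
  rw [← h4] at h3
  have h5 : 0 < (n.factorial : ℂ) * G.det * (star v ⬝ᵥ G⁻¹.mulVec v) := by
    refine mul_pos (mul_pos ?_ hG.det_pos) (hG.inv.dotProduct_mulVec_pos hv)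
    exact_mod_cast n.factorial_pos
  rw [h3] at h5
  have h6 := (Complex.pos_iff.1 h5).1
  have h7 : ((n : ℂ) * cofactorForm (fun _ => G) X).re =
      n * (cofactorForm (fun _ => G) X).re := by simp [Complex.mul_re]
  rw [h7] at h6
  exact pos_of_mul_pos_right h6 (Nat.cast_nonneg n)

end Functional

/-! ### The adjoint second order operator and the weak formulation -/

section Adjoint

variable {n : ℕ}

theorem ContDiffOn.contDiff_mul_of_tsupport_subset {O : Set (Cn n)} (hO : IsOpen O)
    {χ T : Cn n → ℂ} {k : WithTop ℕ∞} (hT : ContDiffOn ℝ k T O) (hχ : ContDiff ℝ k χ)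
    (hs : tsupport χ ⊆ O) : ContDiff ℝ k fun x => χ x * T x := by
  refine contDiff_iff_contDiffAt.2 fun x => ?_
  by_cases hx : x ∈ tsupport χ
  · exact hχ.contDiffAt.mul (hT.contDiffAt (hO.mem_nhds (hs hx)))
  · have : (fun x => χ x * T x) =ᶠ[𝓝 x] fun _ => 0 := by
      filter_upwards [(isClosed_tsupport χ).isOpen_compl.mem_nhds hx] with y hy
      rw [image_eq_zero_of_notMem_tsupport hy, zero_mul]
    exact contDiffAt_const.congr_of_eventuallyEq this

/-- The operator `χ ↦ Re ∑ ∂²(χ T_{jk})/∂z_j∂z̄_k`. -/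
noncomputable def adjointOp (T : Fin n → Fin n → Cn n → ℂ) (χ : Cn n → ℝ) (z : Cn n) : ℝ :=
  (∑ j, ∑ k, wirtinger j (wirtingerBar k fun w => (χ w : ℂ) * T j k w) z).re

theorem ContDiff.continuous_wirtinger_wirtingerBar {F : Cn n → ℂ} (hF : ContDiff ℝ 2 F)
    (j k : Fin n) : Continuous (wirtinger j (wirtingerBar k F)) := by
  have hB : ContDiff ℝ 1 (wirtingerBar k F) :=
    contDiff_iff_contDiffAt.2 fun x => hF.contDiffAt.wirtingerBar_one k
  have h := hB.continuous_fderiv (by norm_num)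
  unfold wirtinger
  fun_prop

theorem tsupport_wirtinger_subset (g : Cn n → ℂ) (k : Fin n) :
    tsupport (wirtinger k g) ⊆ tsupport g := by
  refine closure_minimal (fun x hx => ?_) (isClosed_tsupport g)
  by_contra h
  refine hx ?_
  have h0 : fderiv ℝ g x = 0 := image_eq_zero_of_notMem_tsupport
    fun h' => h (tsupport_fderiv_subset ℝ h')
  simp [wirtinger, h0]

theorem tsupport_ofReal_comp (χ : Cn n → ℝ) : tsupport (fun w => (χ w : ℂ)) = tsupport χ := by
  simp only [tsupport]
  congr 1
  ext x
  simp

theorem tsupport_ofReal_mul_subset (χ : Cn n → ℝ) (T : Cn n → ℂ) :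
    tsupport (fun w => (χ w : ℂ) * T w) ⊆ tsupport χ :=
  (tsupport_mul_subset_left (f := fun w => (χ w : ℂ))).trans (tsupport_ofReal_comp χ).subset

theorem tsupport_wirtinger_wirtingerBar_subset (χ : Cn n → ℝ) (T : Cn n → ℂ) (j k : Fin n) :
    tsupport (wirtinger j (wirtingerBar k fun w => (χ w : ℂ) * T w)) ⊆ tsupport χ :=
  ((tsupport_wirtinger_subset _ j).trans (tsupport_wirtingerBar_subset _ k)).trans
    (tsupport_ofReal_mul_subset χ T)

theorem continuous_adjointOp {O : Set (Cn n)} (hO : IsOpen O) {T : Fin n → Fin n → Cn n → ℂ}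
    (hT : ∀ j k, ContDiffOn ℝ 2 (T j k) O) {χ : Cn n → ℝ} (hχ : ContDiff ℝ 2 χ)
    (hs : tsupport χ ⊆ O) : Continuous (adjointOp T χ) := by
  refine Complex.continuous_re.comp (continuous_finsetSum _ fun j _ =>
    continuous_finsetSum _ fun k _ => ?_)
  refine ContDiff.continuous_wirtinger_wirtingerBar ?_ j k
  exact (hT j k).contDiff_mul_of_tsupport_subset hO (Complex.ofRealCLM.contDiff.comp hχ)
    ((tsupport_ofReal_comp χ).subset.trans hs)

theorem adjointOp_eq_zero {T : Fin n → Fin n → Cn n → ℂ} {χ : Cn n → ℝ} {z : Cn n}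
    (hz : z ∉ tsupport χ) : adjointOp T χ z = 0 := by
  have : ∀ j k, wirtinger j (wirtingerBar k fun w => (χ w : ℂ) * T j k w) z = 0 := fun j k =>
    image_eq_zero_of_notMem_tsupport fun h =>
      hz (tsupport_wirtinger_wirtingerBar_subset χ (T j k) j k h)
  simp [adjointOp, this]

theorem integral_mul_adjointOp {O : Set (Cn n)} (hO : IsOpen O) {T : Fin n → Fin n → Cn n → ℂ}
    (hT : ∀ j k, ContDiffOn ℝ 2 (T j k) O) {u χ : Cn n → ℝ} (hu : ContDiffOn ℝ 2 u O)
    (hχ : ContDiff ℝ 2 χ) (hc : HasCompactSupport χ) (hs : tsupport χ ⊆ O) :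
    ∫ z, u z * adjointOp T χ z =
      ∫ z, χ z * (∑ j, ∑ k, leviMatrix u z j k * T j k z).re := by
  let F : Fin n → Fin n → Cn n → ℂ := fun j k w => (χ w : ℂ) * T j k w
  have hχ' : ContDiff ℝ 2 fun w => (χ w : ℂ) := Complex.ofRealCLM.contDiff.comp hχ
  have hF : ∀ j k, ContDiff ℝ 2 (F j k) := fun j k =>
    (hT j k).contDiff_mul_of_tsupport_subset hO hχ' ((tsupport_ofReal_comp χ).subset.trans hs)
  have hFs : ∀ j k, tsupport (F j k) ⊆ tsupport χ := fun j k => tsupport_ofReal_mul_subset χ _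
  have hFc : ∀ j k, HasCompactSupport (F j k) := fun j k =>
    IsCompact.of_isClosed_subset hc (isClosed_tsupport _) (hFs j k)
  have hat : ∀ x ∈ O, ContDiffAt ℝ 2 u x := fun x hx => hu.contDiffAt (hO.mem_nhds hx)
  have huc : ContinuousOn (fun w => (u w : ℂ)) O := fun x hx =>
    (hat x hx).ofReal.continuousAt.continuousWithinAt
  have hlc : ∀ j k, ContinuousOn (fun w => leviMatrix u w j k) O := by
    intro j k
    have h2 : ContDiffOn ℝ 1 (wirtingerBar k fun w => (u w : ℂ)) O := fun x hx =>
      ((hat x hx).ofReal.wirtingerBar_one k).contDiffWithinAt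
    have h3 := h2.continuousOn_fderiv_of_isOpen hO (by norm_num)
    have h4 := fun v : Cn n => h3.clm_apply (g := fun _ => v) continuousOn_const
    exact ((h4 _).sub (continuousOn_const.mul (h4 _))).div_const 2
  have i1 : ∀ j k, Integrable fun z => (u z : ℂ) * wirtinger j (wirtingerBar k (F j k)) z :=
    fun j k => huc.integrable_mul_of_tsupport_subset hO
      ((hF j k).continuous_wirtinger_wirtingerBar j k)
      (IsCompact.of_isClosed_subset hc (isClosed_tsupport _)
        (tsupport_wirtinger_wirtingerBar_subset χ (T j k) j k))
      ((tsupport_wirtinger_wirtingerBar_subset χ (T j k) j k).trans hs)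
  have i2 : ∀ j k, Integrable fun z => leviMatrix u z j k * F j k z := fun j k =>
    (hlc j k).integrable_mul_of_tsupport_subset hO (hF j k).continuous (hFc j k)
      ((hFs j k).trans hs)
  have e1 : ∀ z, u z * adjointOp T χ z =
      (∑ j, ∑ k, (u z : ℂ) * wirtinger j (wirtingerBar k (F j k)) z).re := by
    intro z
    rw [adjointOp, ← Complex.re_ofReal_mul]
    simp only [Finset.mul_sum, F]
  have e2 : ∀ z, χ z * (∑ j, ∑ k, leviMatrix u z j k * T j k z).re =
      (∑ j, ∑ k, leviMatrix u z j k * F j k z).re := by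
    intro z
    rw [← Complex.re_ofReal_mul]
    simp only [Finset.mul_sum, F]
    congr 1
    refine Finset.sum_congr rfl fun j _ => Finset.sum_congr rfl fun k _ => ?_
    ring
  simp only [e1, e2]
  have r1 := integral_re (𝕜 := ℂ) (integrable_finsetSum Finset.univ fun j _ =>
    integrable_finsetSum Finset.univ fun k _ => i1 j k)
  have r2 := integral_re (𝕜 := ℂ) (integrable_finsetSum Finset.univ fun j _ =>
    integrable_finsetSum Finset.univ fun k _ => i2 j k)
  simp only [RCLike.re_to_complex] at r1 r2
  rw [r1, r2]
  congr 1
  rw [integral_finsetSum _ fun j _ => integrable_finsetSum Finset.univ fun k _ => i1 j k,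
    integral_finsetSum _ fun j _ => integrable_finsetSum Finset.univ fun k _ => i2 j k]
  refine Finset.sum_congr rfl fun j _ => ?_
  rw [integral_finsetSum _ fun k _ => i1 j k, integral_finsetSum _ fun k _ => i2 j k]
  refine Finset.sum_congr rfl fun k _ => ?_
  exact integral_mul_wirtinger_wirtingerBar hO hu (hF j k) (hFc j k) ((hFs j k).trans hs) j k

end Adjoint

/-! ### Scalar estimates -/

section Scalar

/-- Near 0 the smaller exponent dominates, with any constant; on the rest `[s₀, 1]` of the interval
the power `s ^ β'` is bounded. The signs of the exponents play no role. -/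
theorem exists_mul_rpow_le {β β' μ : ℝ} (hβ : β < β') (hμ : 0 < μ) {c : ℝ} (hc : 0 ≤ c) :
    ∃ B : ℝ, 0 ≤ B ∧ ∀ s : ℝ, 0 < s → s ≤ 1 → c * s ^ β' ≤ μ * s ^ β + B := by
  have hlim : Tendsto (fun s : ℝ => c * s ^ (β' - β)) (𝓝[>] 0) (𝓝 0) := by
    have h1 : Tendsto (fun s : ℝ => s ^ (β' - β)) (𝓝[>] 0) (𝓝 ((0 : ℝ) ^ (β' - β))) :=
      ((Real.continuousAt_rpow_const 0 (β' - β) (Or.inr (by linarith))).tendsto).mono_left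
        nhdsWithin_le_nhds
    rw [Real.zero_rpow (by linarith)] at h1
    simpa using h1.const_mul c
  have hev := hlim.eventually (gt_mem_nhds hμ)
  obtain ⟨s₀, hs₀, hsub⟩ := mem_nhdsGT_iff_exists_Ioo_subset.1 hev
  have hs₀' : (0 : ℝ) < s₀ := hs₀
  refine ⟨c * max 1 (s₀ ^ β'), by positivity, fun s hs hs1 => ?_⟩
  by_cases h : s < s₀
  · have h1 : c * s ^ (β' - β) < μ := hsub ⟨hs, h⟩
    have h2 : s ^ β' = s ^ (β' - β) * s ^ β := by rw [← Real.rpow_add hs]; ring_nf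
    have h3 : c * s ^ β' ≤ μ * s ^ β := by
      rw [h2, ← mul_assoc]
      exact mul_le_mul_of_nonneg_right h1.le (by positivity)
    have : 0 ≤ c * max 1 (s₀ ^ β') := by positivity
    linarith
  · rw [not_lt] at h
    have h1 : s ^ β' ≤ max 1 (s₀ ^ β') := by
      by_cases hb : 0 ≤ β'
      · exact (Real.rpow_le_one hs.le hs1 hb).trans (le_max_left _ _)
      · exact (Real.rpow_le_rpow_of_nonpos hs₀' h (by linarith)).trans (le_max_right _ _)
    have h2 := mul_le_mul_of_nonneg_left h1 hc
    have : 0 ≤ μ * s ^ β := by positivity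
    linarith

/-- The loss of `γ` in the exponent is what the logarithm at `q = 0` requires; it makes all
exponents uniform. -/
theorem exists_abs_rieszReal_le {q γ : ℝ} (hγ : 0 < γ) :
    ∃ k : ℝ, 0 ≤ k ∧ ∀ s : ℝ, 0 < s → s ≤ 1 → |rieszReal q s| ≤ k * s ^ (q - γ) := by
  by_cases hq : q = 0
  · subst hq
    refine ⟨1 / γ, by positivity, fun s hs hs1 => ?_⟩
    rw [rieszReal, if_pos rfl, zero_sub]
    have h := Real.log_le_rpow_div (inv_pos.2 hs).le hγ
    rw [Real.log_inv, Real.inv_rpow hs.le, ← Real.rpow_neg hs.le] at h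
    rw [abs_of_nonpos (Real.log_nonpos hs.le hs1)]
    calc -Real.log s ≤ s ^ (-γ) / γ := h
      _ = 1 / γ * s ^ (-γ) := by ring
  · refine ⟨|q|⁻¹, by positivity, fun s hs hs1 => ?_⟩
    rw [rieszReal, if_neg hq, abs_div, abs_of_pos (Real.rpow_pos_of_pos hs q), div_eq_inv_mul]
    refine mul_le_mul_of_nonneg_left ?_ (by positivity)
    exact Real.rpow_le_rpow_of_exponent_ge hs hs1 (by linarith)

/-- Here `W`, `P`, `H` stand for the values of a positive functional on ω, i∂h∧∂̄h and i∂∂̄h, and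
`s` for h. Combine the growth condition times `s ^ (q - p)`, with weight `1 - τ`, and the bound on
`H`, with weight `τ`. The coefficient left for `P` is `(q - p) - τ * (1 - p)`. -/
theorem riesz_levi_lower {p q ε δ c γt s W P H : ℝ} (hp : p ≤ 0) (hq : p < q) (hc : 0 < c)
    (hs : 0 < s) (hW : 0 ≤ W) (hP : 0 ≤ P)
    (hH : ε * s ^ (1 - δ) * W ≤ H)
    (hgrowth : -(c * s ^ (p - 1 + γt)) * W ≤ s ^ (p - 1) * H + (p - 1) * s ^ (p - 2) * P) :
    (q - p) / 2 * s ^ (q - 2) * P + (q - p) / (2 * (1 - p) + (q - p)) * ε * s ^ (q - δ) * W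
      - c * s ^ (q - 1 + γt) * W ≤ s ^ (q - 1) * H + (q - 1) * s ^ (q - 2) * P := by
  -- The summand `2 * (1 - p)` ensures `τ * (1 - p) ≤ (q - p) / 2`, so half of the surplus in `P`
  -- survives; the summand `q - p` ensures `τ ≤ 1`.
  set τ : ℝ := (q - p) / (2 * (1 - p) + (q - p)) with hτ
  have hden : 0 < 2 * (1 - p) + (q - p) := by linarith
  have hτ0 : 0 < τ := div_pos (by linarith) hden
  have hτ1 : τ ≤ 1 := by rw [hτ, div_le_one hden]; linarith
  have hτ2 : τ * (1 - p) ≤ (q - p) / 2 := by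
    have h1 : τ * (2 * (1 - p) + (q - p)) = q - p := by rw [hτ]; field_simp
    have h2 : 0 ≤ τ * (q - p) := mul_nonneg hτ0.le (by linarith)
    nlinarith
  have e1 : s ^ (q - 1) = s ^ (q - p) * s ^ (p - 1) := by rw [← Real.rpow_add hs]; ring_nf
  have e2 : s ^ (q - 2) = s ^ (q - p) * s ^ (p - 2) := by rw [← Real.rpow_add hs]; ring_nf
  have e3 : s ^ (q - 1 + γt) = s ^ (q - p) * s ^ (p - 1 + γt) := by
    rw [← Real.rpow_add hs]; ring_nf
  have e4 : s ^ (q - δ) = s ^ (q - 1) * s ^ (1 - δ) := by rw [← Real.rpow_add hs]; ring_nf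
  have hY : -(c * s ^ (q - 1 + γt)) * W ≤ s ^ (q - 1) * H + (p - 1) * s ^ (q - 2) * P := by
    have h1 := mul_le_mul_of_nonneg_left hgrowth (Real.rpow_pos_of_pos hs (q - p)).le
    rw [e1, e2, e3]
    calc _ = s ^ (q - p) * (-(c * s ^ (p - 1 + γt)) * W) := by ring
      _ ≤ _ := h1
      _ = _ := by ring
  have hY' : -(c * s ^ (q - 1 + γt)) * W ≤
      (1 - τ) * (s ^ (q - 1) * H + (p - 1) * s ^ (q - 2) * P) := by
    have h1 := mul_le_mul_of_nonneg_left hY (by linarith : 0 ≤ 1 - τ)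
    have h2 : 0 ≤ c * s ^ (q - 1 + γt) * W := by positivity
    have h3 : 0 ≤ τ * (c * s ^ (q - 1 + γt) * W) := mul_nonneg hτ0.le h2
    linarith
  have hH' : τ * ε * s ^ (q - δ) * W ≤ τ * (s ^ (q - 1) * H) := by
    have h1 := mul_le_mul_of_nonneg_left hH (Real.rpow_pos_of_pos hs (q - 1)).le
    have h2 := mul_le_mul_of_nonneg_left h1 hτ0.le
    rw [e4]
    linarith
  have hP' : (q - p) / 2 * s ^ (q - 2) * P ≤ ((q - p) - τ * (1 - p)) * s ^ (q - 2) * P := by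
    have h0 : 0 ≤ s ^ (q - 2) * P := by positivity
    have h1 : (q - p) / 2 ≤ (q - p) - τ * (1 - p) := by linarith
    have := mul_le_mul_of_nonneg_right h1 h0
    linarith
  linarith

/-- The errors produced by a cut-off function at the exponent `q` are absorbed by the positive
terms at the exponent `q + γ`. -/
theorem exists_riesz_pair_bound {p q ε δ c γt γ a a' b : ℝ} (hp : p ≤ 0) (hpq : p ≤ q)
    (hε : 0 < ε) (hc : 0 < c) (hγ : 0 < γ)
    (hγ1 : γ < γt + δ - 1) (hγ2 : γ < δ / 2) (ha : 0 < a) (ha' : 0 < a') (hb : 0 ≤ b) :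
    ∃ B : ℝ, 0 ≤ B ∧ ∀ s W P H L N R : ℝ, 0 < s → s ≤ 1 → 0 ≤ W → 0 ≤ P →
      ε * s ^ (1 - δ) * W ≤ H →
      -(c * s ^ (p - 1 + γt)) * W ≤ s ^ (p - 1) * H + (p - 1) * s ^ (p - 2) * P →
      |L| ≤ b * W → N ≤ b * W → (∀ t : ℝ, 0 < t → -(t * P + t⁻¹ * N) ≤ R) →
      -B * W ≤ a' * (s ^ (q + γ - 1) * H + (q + γ - 1) * s ^ (q + γ - 2) * P) +
        a * (rieszReal q s * L + s ^ (q - 1) * R) - c * s ^ (q - 1 + γt) * W := by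
  have hq' : p < q + γ := by linarith
  obtain ⟨k, hk0, hk⟩ := exists_abs_rieszReal_le (q := q) hγ
  set μ : ℝ := a' * ((q + γ - p) / (2 * (1 - p) + (q + γ - p)) * ε) with hμdef
  have hμ : 0 < μ :=
    mul_pos ha' (mul_pos (div_pos (by linarith) (by linarith)) hε)
  -- Chosen so that the gradient error `a * κ` equals exactly the gradient term supplied by the
  -- exponent `q + γ`.
  set κ : ℝ := a' * (q + γ - p) / (2 * a) with hκdef
  have hκ : 0 < κ := div_pos (mul_pos ha' (by linarith)) (by linarith)
  -- The gain `μ * s ^ (q + γ - δ)` is split into three parts: one for the negative term at `q + γ`,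
  -- one for the cut-off errors, one for the reserved term at `q`. In each case the exponent is
  -- larger than `q + γ - δ`.
  obtain ⟨B₁, hB₁, h₁⟩ := exists_mul_rpow_le (β := q + γ - δ) (β' := q + γ - 1 + γt) (μ := μ / 3)
    (by linarith) (by linarith) (mul_pos ha' hc).le
  obtain ⟨B₂, hB₂, h₂⟩ := exists_mul_rpow_le (β := q + γ - δ) (β' := q - γ) (μ := μ / 3)
    (by linarith) (by linarith) (c := a * k * b + a * κ⁻¹ * b) (by positivity)
  obtain ⟨B₃, hB₃, h₃⟩ := exists_mul_rpow_le (β := q + γ - δ) (β' := q - 1 + γt) (μ := μ / 3)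
    (by linarith) (by linarith) hc.le
  refine ⟨B₁ + B₂ + B₃, by linarith, ?_⟩
  intro s W P H L N R hs hs1 hW hP hH hg hL hN hR
  have hX := riesz_levi_lower hp hq' hc hs hW hP hH hg
  have hX' := mul_le_mul_of_nonneg_left hX ha'.le
  have hKL : -(k * b * s ^ (q - γ) * W) ≤ rieszReal q s * L := by
    have h1 : |rieszReal q s * L| ≤ (k * s ^ (q - γ)) * (b * W) := by
      rw [abs_mul]
      exact mul_le_mul (hk s hs hs1) hL (abs_nonneg _) (by positivity)
    have := neg_abs_le (rieszReal q s * L)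
    linarith
  have hRs : -(κ * s ^ (q + γ - 2) * P + κ⁻¹ * b * s ^ (q - γ) * W) ≤ s ^ (q - 1) * R := by
    -- With this parameter in Cauchy–Schwarz, the factor `s ^ (q - 1)` turns the two terms into the
    -- powers `q + γ - 2` and `q - γ`.
    have ht : 0 < κ * s ^ (γ - 1) := by positivity
    have h1 := hR _ ht
    have h2 : (κ * s ^ (γ - 1))⁻¹ = κ⁻¹ * s ^ (1 - γ) := by
      rw [mul_inv, ← Real.rpow_neg hs.le, neg_sub]
    rw [h2] at h1
    have h3 : κ⁻¹ * s ^ (1 - γ) * N ≤ κ⁻¹ * s ^ (1 - γ) * (b * W) :=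
      mul_le_mul_of_nonneg_left hN (by positivity)
    have h4 : -(κ * s ^ (γ - 1) * P + κ⁻¹ * s ^ (1 - γ) * (b * W)) ≤ R := by linarith
    have h5 := mul_le_mul_of_nonneg_left h4 (Real.rpow_pos_of_pos hs (q - 1)).le
    have e1 : s ^ (q + γ - 2) = s ^ (q - 1) * s ^ (γ - 1) := by
      rw [← Real.rpow_add hs]; ring_nf
    have e2 : s ^ (q - γ) = s ^ (q - 1) * s ^ (1 - γ) := by
      rw [← Real.rpow_add hs]; ring_nf
    rw [e1, e2]
    linarith
  have hsum : a * (-(k * b * s ^ (q - γ) * W) -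
      (κ * s ^ (q + γ - 2) * P + κ⁻¹ * b * s ^ (q - γ) * W)) ≤
      a * (rieszReal q s * L + s ^ (q - 1) * R) :=
    mul_le_mul_of_nonneg_left (by linarith) ha.le
  have hκa : a * κ = a' * ((q + γ - p) / 2) := by rw [hκdef]; field_simp
  have hcancel : a * (κ * s ^ (q + γ - 2) * P) = a' * ((q + γ - p) / 2 * s ^ (q + γ - 2) * P) := by
    linear_combination (s ^ (q + γ - 2) * P) * hκa
  have hw1 := mul_le_mul_of_nonneg_right (h₁ s hs hs1) hW
  have hw2 := mul_le_mul_of_nonneg_right (h₂ s hs hs1) hW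
  have hw3 := mul_le_mul_of_nonneg_right (h₃ s hs hs1) hW
  have hμe : a' * ((q + γ - p) / (2 * (1 - p) + (q + γ - p)) * ε * s ^ (q + γ - δ) * W) =
      μ * s ^ (q + γ - δ) * W := by rw [hμdef]; ring
  linarith

theorem hasDerivAt_rieszReal (q : ℝ) {s : ℝ} (hs : 0 < s) :
    HasDerivAt (rieszReal q) (s ^ (q - 1)) s := by
  by_cases hq : q = 0
  · subst hq
    have : rieszReal 0 = Real.log := by funext t; simp [rieszReal]
    rw [this, zero_sub, Real.rpow_neg_one]
    exact Real.hasDerivAt_log hs.ne'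
  · have : rieszReal q = fun t => t ^ q / q := by funext t; simp [rieszReal, hq]
    rw [this]
    have h := (Real.hasDerivAt_rpow_const (x := s) (p := q) (Or.inl hs.ne')).div_const q
    rwa [mul_div_cancel_left₀ _ hq] at h

theorem contDiffAt_rieszReal (q : ℝ) {s : ℝ} (hs : 0 < s) {k : WithTop ℕ∞} :
    ContDiffAt ℝ k (rieszReal q) s := by
  by_cases hq : q = 0
  · subst hq
    have : rieszReal 0 = Real.log := by funext t; simp [rieszReal]
    rw [this]
    exact Real.contDiffAt_log.2 hs.ne'
  · have : rieszReal q = fun t => t ^ q / q := by funext t; simp [rieszReal, hq]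
    rw [this]
    exact (Real.contDiffAt_rpow_const_of_ne hs.ne').div_const q

end Scalar

/-! ### The Levi matrix of the weight -/

section Pointwise

open scoped ComplexOrder

variable {n : ℕ} {z : Cn n}

theorem leviMatrix_riesz {f : Cn n → ℝ} (hf : ContDiffAt ℝ 2 f z) (hfz : 0 < f z) (q : ℝ) :
    leviMatrix (fun w => rieszReal q (f w)) z = ((f z ^ (q - 1) : ℝ) : ℂ) • leviMatrix f z +
      (((q - 1) * f z ^ (q - 2) : ℝ) : ℂ) •
        Matrix.vecMulVec (wirtingerGrad f z) (star (wirtingerGrad f z)) := by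
  refine leviMatrix_comp hf (κ' := fun s => s ^ (q - 1)) ?_ ?_
  · filter_upwards [lt_mem_nhds hfz] with s hs
    exact hasDerivAt_rieszReal q hs
  · have h := Real.hasDerivAt_rpow_const (x := f z) (p := q - 1) (Or.inl hfz.ne')
    rwa [show q - 1 - 1 = q - 2 by ring] at h

theorem map_ofReal_smul (l : Matrix (Fin n) (Fin n) ℂ →ₗ[ℝ] ℝ) (r : ℝ)
    (X : Matrix (Fin n) (Fin n) ℂ) : l ((r : ℂ) • X) = r * l X := by
  have : (r : ℂ) • X = r • X := by ext i j; simp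
  rw [this, map_smul, smul_eq_mul]

/-- The hermitian matrix of `i∂f ∧ ∂̄g + i∂g ∧ ∂̄f`. -/
noncomputable def crossMatrix (f g : Cn n → ℝ) (z : Cn n) : Matrix (Fin n) (Fin n) ℂ :=
  Matrix.vecMulVec (wirtingerGrad f z) (star (wirtingerGrad g z)) +
    Matrix.vecMulVec (wirtingerGrad g z) (star (wirtingerGrad f z))

/-- Cauchy–Schwarz with a free parameter: apply `l` to the rank-one square of `√t • v + (√t)⁻¹ • u`,
with `u`, `v` the gradients of `f`, `g`. -/
theorem crossMatrix_lower {l : Matrix (Fin n) (Fin n) ℂ →ₗ[ℝ] ℝ}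
    (hl : ∀ X : Matrix (Fin n) (Fin n) ℂ, X.PosSemidef → 0 ≤ l X) (f g : Cn n → ℝ) {t : ℝ}
    (ht : 0 < t) :
    -(t * l (Matrix.vecMulVec (wirtingerGrad g z) (star (wirtingerGrad g z))) +
      t⁻¹ * l (Matrix.vecMulVec (wirtingerGrad f z) (star (wirtingerGrad f z)))) ≤
      l (crossMatrix f g z) := by
  set u := wirtingerGrad f z
  set v := wirtingerGrad g z
  set r : ℝ := √t
  have hr : r * r = t := Real.mul_self_sqrt ht.le
  have hr0 : r ≠ 0 := (Real.sqrt_pos.2 ht).ne'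
  have hpsd := Matrix.posSemidef_vecMulVec_self_star ((r : ℂ) • v + ((r⁻¹ : ℝ) : ℂ) • u)
  have hexp : Matrix.vecMulVec ((r : ℂ) • v + ((r⁻¹ : ℝ) : ℂ) • u)
      (star ((r : ℂ) • v + ((r⁻¹ : ℝ) : ℂ) • u)) =
      (t : ℂ) • Matrix.vecMulVec v (star v) + ((t⁻¹ : ℝ) : ℂ) • Matrix.vecMulVec u (star u) +
        crossMatrix f g z := by
    have h1 : (t : ℂ) = r * r := by exact_mod_cast hr.symm
    have h2 : ((t⁻¹ : ℝ) : ℂ) = ((r⁻¹ : ℝ) : ℂ) * ((r⁻¹ : ℝ) : ℂ) := by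
      rw [← Complex.ofReal_mul, ← mul_inv, hr]
    have h3 : (r : ℂ) * ((r⁻¹ : ℝ) : ℂ) = 1 := by
      rw [← Complex.ofReal_mul, mul_inv_cancel₀ hr0, Complex.ofReal_one]
    ext j k
    simp only [Matrix.vecMulVec_apply, crossMatrix, Matrix.add_apply, Matrix.smul_apply,
      Pi.add_apply, Pi.smul_apply, Pi.star_apply, star_add, star_smul, smul_eq_mul,
      Complex.star_def, Complex.conj_ofReal]
    rw [h1, h2]
    linear_combination (v j * (starRingEnd ℂ) (u k) + u j * (starRingEnd ℂ) (v k)) * h3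
  have h := hl _ hpsd
  rw [hexp, map_add, map_add, map_ofReal_smul, map_ofReal_smul] at h
  linarith

end Pointwise

/-! ### Telescoping the cut-off errors along the chain of exponents -/

section Pointwise

open scoped ComplexOrder

variable {n : ℕ} {z : Cn n}

theorem ContDiffAt.rieszReal_comp {f : Cn n → ℝ} (hf : ContDiffAt ℝ 2 f z) (hfz : 0 < f z)
    (q : ℝ) : ContDiffAt ℝ 2 (fun w => rieszReal q (f w)) z :=
  (contDiffAt_rieszReal q hfz).comp z hf

theorem leviMatrix_const_mul {f : Cn n → ℝ} (hf : ContDiffAt ℝ 2 f z) (c : ℝ) :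
    leviMatrix (fun w => c * f w) z = (c : ℂ) • leviMatrix f z := by
  have h := leviMatrix_comp (κ := fun s => c * s) (κ' := fun _ => c) (κ'' := 0) hf
    (Eventually.of_forall fun s => by simpa using (hasDerivAt_id s).const_mul c)
    (hasDerivAt_const _ _)
  simpa using h

theorem leviMatrix_const (c : ℝ) (z : Cn n) : leviMatrix (fun _ => c) z = 0 := by
  ext j k
  have h : (wirtingerBar k fun _ : Cn n => (c : ℂ)) = fun _ => 0 := by
    funext w; simp [wirtingerBar]
  simp [leviMatrix, h, wirtinger]

theorem leviMatrix_sum {ι : Type*} (S : Finset ι) {f : ι → Cn n → ℝ}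
    (hf : ∀ i ∈ S, ContDiffAt ℝ 2 (f i) z) :
    leviMatrix (fun w => ∑ i ∈ S, f i w) z = ∑ i ∈ S, leviMatrix (f i) z := by
  classical
  induction S using Finset.induction_on with
  | empty => simpa using leviMatrix_const 0 z
  | insert i S hi ih =>
    have h1 := hf i (Finset.mem_insert_self i S)
    have h2 : ∀ i ∈ S, ContDiffAt ℝ 2 (f i) z := fun k hk => hf k (Finset.mem_insert_of_mem hk)
    simp only [Finset.sum_insert hi]
    rw [leviMatrix_add h1 (ContDiffAt.sum h2), ih h2]

theorem wirtingerGrad_congr {f g : Cn n → ℝ} (h : f =ᶠ[𝓝 z] g) :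
    wirtingerGrad f z = wirtingerGrad g z := by
  funext j
  exact (EventuallyEq.wirtinger (h.mono fun w hw => by simp [hw]) j).eq_of_nhds

theorem wirtingerGrad_const (c : ℝ) : wirtingerGrad (fun _ => c) z = 0 := by
  funext j
  simp [wirtingerGrad, wirtinger]

theorem leviMatrix_mul_riesz {θ f : Cn n → ℝ} (hθ : ContDiffAt ℝ 2 θ z)
    (hf : ContDiffAt ℝ 2 f z) (hfz : 0 < f z) (q : ℝ) :
    leviMatrix (fun w => θ w * rieszReal q (f w)) z =
      (θ z : ℂ) • leviMatrix (fun w => rieszReal q (f w)) z +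
      (rieszReal q (f z) : ℂ) • leviMatrix θ z +
      ((f z ^ (q - 1) : ℝ) : ℂ) • crossMatrix θ f z := by
  rw [leviMatrix_mul hθ (hf.rieszReal_comp hfz q),
    wirtingerGrad_comp hf.differentiableAt_two (hasDerivAt_rieszReal q hfz), add_assoc]
  congr 1
  ext j k
  simp only [Matrix.vecMulVec_apply, crossMatrix, Matrix.add_apply, Matrix.smul_apply,
    Pi.smul_apply, Pi.star_apply, star_smul, smul_eq_mul,
    Complex.star_def, Complex.conj_ofReal]
  ring

/-- The error of the `j`-th cut-off is paired with the main term at `j + 1`: either `θ j` vanishes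
near the point and there is no error, or `θ (j + 1) = 1` and the main term is there in full. The
bound `B` is chosen before the point, the chart metric and the functional, so it is uniform on the
manifold. -/
theorem exists_levi_weight_bound {p ε δ c γt γ b : ℝ} (hp : p ≤ 0) (hε : 0 < ε) (hc : 0 < c)
    (hγ : 0 < γ) (hγ1 : γ < γt + δ - 1) (hγ2 : γ < δ / 2) (hb : 0 ≤ b) {N : ℕ} (hN : 1 ≤ N)
    {a : ℕ → ℝ} (ha : ∀ j ≤ N, 0 < a j) (ha0 : a 0 = 1) :
    ∃ B : ℝ, 0 ≤ B ∧ ∀ (n : ℕ) (z : Cn n) (G : Matrix (Fin n) (Fin n) ℂ)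
      (l : Matrix (Fin n) (Fin n) ℂ →ₗ[ℝ] ℝ) (f : Cn n → ℝ) (θ : ℕ → Cn n → ℝ),
      (∀ X : Matrix (Fin n) (Fin n) ℂ, X.PosSemidef → 0 ≤ l X) → 0 ≤ l G →
      ContDiffAt ℝ 2 f z → 0 < f z → f z ≤ 1 →
      ε * f z ^ (1 - δ) * l G ≤ l (leviMatrix f z) →
      -(c * f z ^ (p - 1 + γt)) * l G ≤ l (leviMatrix (fun w => rieszReal p (f w)) z) →
      (∀ j ≤ N, ContDiffAt ℝ 2 (θ j) z) → (∀ j ≤ N, 0 ≤ θ j z ∧ θ j z ≤ 1) →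
      (∀ j ≤ N, |l (leviMatrix (θ j) z)| ≤ b * l G) →
      (∀ j ≤ N, l (Matrix.vecMulVec (wirtingerGrad (θ j) z) (star (wirtingerGrad (θ j) z))) ≤
        b * l G) →
      (∀ j < N, θ j =ᶠ[𝓝 z] (fun _ => 0) ∨ θ (j + 1) z = 1) →
      θ N =ᶠ[𝓝 z] (fun _ => 1) →
      -B * l G ≤ l (leviMatrix (fun w => ∑ j ∈ Finset.range (N + 1),
        a j * (θ j w * rieszReal (p + j * γ) (f w))) z) := by
  have hpair : ∀ j : ℕ, ∃ B : ℝ, 0 ≤ B ∧ (j < N →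
      ∀ s W P H L N R : ℝ, 0 < s → s ≤ 1 → 0 ≤ W → 0 ≤ P →
      ε * s ^ (1 - δ) * W ≤ H →
      -(c * s ^ (p - 1 + γt)) * W ≤ s ^ (p - 1) * H + (p - 1) * s ^ (p - 2) * P →
      |L| ≤ b * W → N ≤ b * W → (∀ t : ℝ, 0 < t → -(t * P + t⁻¹ * N) ≤ R) →
      -B * W ≤ a (j + 1) * (s ^ ((p + j * γ) + γ - 1) * H +
          ((p + j * γ) + γ - 1) * s ^ ((p + j * γ) + γ - 2) * P) +
        a j * (rieszReal (p + j * γ) s * L + s ^ ((p + j * γ) - 1) * R) -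
          c * s ^ ((p + j * γ) - 1 + γt) * W) := by
    intro j
    by_cases hj : j < N
    · obtain ⟨B, hB, h⟩ := exists_riesz_pair_bound (q := p + j * γ) hp
        (by have : 0 ≤ (j : ℝ) * γ := by positivity
            linarith) hε hc hγ hγ1 hγ2 (ha j hj.le) (ha (j + 1) hj) hb
      exact ⟨B, hB, fun _ => h⟩
    · exact ⟨0, le_rfl, fun h => absurd h hj⟩
  choose B hB hpair using hpair
  refine ⟨∑ j ∈ Finset.range N, B j, Finset.sum_nonneg fun j _ => hB j, ?_⟩
  intro n z G l f θ hl hG hf hf0 hf1 hH hg hθ hθ01 hθl hθg hsupp hθN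
  set s := f z with hs
  set W := l G with hW
  set P := l (Matrix.vecMulVec (wirtingerGrad f z) (star (wirtingerGrad f z))) with hP
  set H := l (leviMatrix f z) with hHdef
  have hP0 : 0 ≤ P := hl _ (Matrix.posSemidef_vecMulVec_self_star _)
  let X : ℝ → ℝ := fun q => s ^ (q - 1) * H + (q - 1) * s ^ (q - 2) * P
  have hX : ∀ q, l (leviMatrix (fun w => rieszReal q (f w)) z) = X q := by
    intro q
    rw [leviMatrix_riesz hf hf0, map_add, map_ofReal_smul, map_ofReal_smul]
  rw [hX] at hg
  let err : ℕ → ℝ := fun j => a j * (rieszReal (p + j * γ) s * l (leviMatrix (θ j) z) +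
    s ^ ((p + j * γ) - 1) * l (crossMatrix (θ j) f z))
  have hterm : ∀ j ∈ Finset.range (N + 1),
      l (leviMatrix (fun w => a j * (θ j w * rieszReal (p + j * γ) (f w))) z) =
        a j * (θ j z * X (p + j * γ)) + err j := by
    intro j hj
    have hj' : j ≤ N := Nat.lt_succ_iff.1 (Finset.mem_range.1 hj)
    rw [leviMatrix_const_mul ((hθ j hj').mul (hf.rieszReal_comp hf0 _)),
      leviMatrix_mul_riesz (hθ j hj') hf hf0, map_ofReal_smul, map_add, map_add, map_ofReal_smul,
      map_ofReal_smul, map_ofReal_smul, hX]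
    simp only [err]
    ring
  rw [leviMatrix_sum _ fun j hj => contDiffAt_const.mul
    ((hθ j (Nat.lt_succ_iff.1 (Finset.mem_range.1 hj))).mul (hf.rieszReal_comp hf0 _)), map_sum,
    Finset.sum_congr rfl hterm, Finset.sum_add_distrib]
  have herrN : err N = 0 := by
    have h1 : leviMatrix (θ N) z = 0 := by rw [hθN.leviMatrix.eq_of_nhds, leviMatrix_const]
    have h2 : crossMatrix (θ N) f z = 0 := by
      rw [crossMatrix, wirtingerGrad_congr hθN, wirtingerGrad_const]; simp
    simp only [err, h1, h2, map_zero, mul_zero, add_zero]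
  -- Shift the main terms by one against the errors. The last error is zero since `θ N` is locally
  -- 1, and the leftover main term at exponent `p` is booked under `j = 0`.
  rw [Finset.sum_range_succ', Finset.sum_range_succ err, herrN, add_zero, add_right_comm,
    ← Finset.sum_add_distrib]
  have hsplit : a 0 * (θ 0 z * X (p + (0 : ℕ) * γ)) =
      ∑ j ∈ Finset.range N, if j = 0 then θ 0 z * X p else 0 := by
    rw [Finset.sum_ite_eq' , if_pos (Finset.mem_range.2 (by omega)), ha0]
    simp
  rw [hsplit, ← Finset.sum_add_distrib, ← Finset.sum_neg_distrib, Finset.sum_mul]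
  refine Finset.sum_le_sum fun j hj => ?_
  have hjN : j < N := Finset.mem_range.1 hj
  have hq : p + ((j + 1 : ℕ) : ℝ) * γ = p + j * γ + γ := by push_cast; ring
  have hcW : 0 ≤ c * s ^ ((p + j * γ) - 1 + γt) * W := by positivity
  -- The amount reserved in the pair bound pays for the possibly negative term `θ 0 * X p`; for `j >
  -- 0` nothing has to be paid.
  have h0 : -(c * s ^ ((p + j * γ) - 1 + γt) * W) ≤ if j = 0 then θ 0 z * X p else 0 := by
    split_ifs with h
    · subst h
      simp only [Nat.cast_zero, zero_mul, add_zero] at hcW ⊢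
      obtain ⟨t0, t1⟩ := hθ01 0 (by omega)
      have h1 := mul_le_mul_of_nonneg_left hg t0
      have h2 := mul_le_mul_of_nonneg_right t1 hcW
      linarith
    · linarith
  rw [hq]
  rcases hsupp j hjN with hz | h1
  · have hθj0 : θ j z = 0 := hz.eq_of_nhds
    have herr0 : err j = 0 := by
      have h1 : leviMatrix (θ j) z = 0 := by rw [hz.leviMatrix.eq_of_nhds, leviMatrix_const]
      have h2 : crossMatrix (θ j) f z = 0 := by
        rw [crossMatrix, wirtingerGrad_congr hz, wirtingerGrad_const]; simp
      simp only [err, h1, h2, map_zero, mul_zero, add_zero]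
    have hif : (if j = 0 then θ 0 z * X p else 0) = 0 := by
      split_ifs with h
      · subst h; rw [hθj0, zero_mul]
      · rfl
    -- Without errors the pair bound controls the main term alone. It may then be multiplied by any
    -- value of `θ (j + 1)` between 0 and 1.
    have h := hpair j hjN s W P H 0 0 0 hf0 hf1 hG hP0 hH hg (by simpa using mul_nonneg hb hG)
      (mul_nonneg hb hG) (fun t ht => by
        have : 0 ≤ t * P := by positivity
        simp only [mul_zero, add_zero]; linarith)
    simp only [mul_zero, add_zero] at h
    rw [herr0, hif]
    obtain ⟨t0, t1⟩ := hθ01 (j + 1) hjN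
    have h2 : -(B j * W) ≤ a (j + 1) * X (p + j * γ + γ) := by
      simp only [X]; linarith
    have h3 := mul_le_mul_of_nonneg_left h2 t0
    have h4 := mul_le_mul_of_nonneg_right t1 (mul_nonneg (hB j) hG)
    simp only [Nat.cast_zero] at *
    linarith
  · have h := hpair j hjN s W P H (l (leviMatrix (θ j) z))
      (l (Matrix.vecMulVec (wirtingerGrad (θ j) z) (star (wirtingerGrad (θ j) z))))
      (l (crossMatrix (θ j) f z)) hf0 hf1 hG hP0 hH hg (hθl j hjN.le) (hθg j hjN.le)
      (fun t ht => crossMatrix_lower hl (θ j) f ht)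
    rw [h1]
    simp only [err, X] at h0 ⊢
    linarith

end Pointwise

/-! ### Holomorphic changes of coordinates -/

section Holomorphic

variable {n : ℕ} {z : Cn n}

theorem fderiv_fderiv_comp_holomorphic {u : Cn n → ℝ} {ψ : Cn n → Cn n}
    (hψ : ContDiffAt ℂ 2 ψ z) (hu : ContDiffAt ℝ 2 u (ψ z)) (a b : Cn n) :
    fderiv ℝ (fderiv ℝ fun w => u (ψ w)) z a b =
      fderiv ℝ (fderiv ℝ u) (ψ z) (fderiv ℂ ψ z a) (fderiv ℂ ψ z b) +
        fderiv ℝ u (ψ z) (fderiv ℂ (fderiv ℂ ψ) z a b) := by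
  have hψr : ContDiffAt ℝ 2 ψ z := hψ.restrict_scalars ℝ
  have hcomp : ContDiffAt ℝ 2 (fun w => u (ψ w)) z := hu.comp z hψr
  have hd : DifferentiableAt ℝ (fderiv ℝ fun w => u (ψ w)) z :=
    (hcomp.fderiv_right (m := 1) (by norm_num)).differentiableAt (by norm_num)
  have e0 : fderiv ℝ (fderiv ℝ fun w => u (ψ w)) z a b =
      fderiv ℝ (fun w => fderiv ℝ (fun w => u (ψ w)) w b) z a := by
    rw [fderiv_clm_apply hd (differentiableAt_const b)]
    simp
  have e1 : (fun w => fderiv ℝ (fun w => u (ψ w)) w b) =ᶠ[𝓝 z]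
      fun w => fderiv ℝ u (ψ w) (fderiv ℂ ψ w b) := by
    filter_upwards [hψ.eventually (by decide),
      hψ.continuousAt.eventually hu.eventually_contDiffAt_two] with w h1 h2
    have hw := (h1.differentiableAt (by norm_num)).hasFDerivAt.restrictScalars ℝ
    have := (h2.differentiableAt_two.hasFDerivAt.comp w hw).fderiv
    simp only [Function.comp_def] at this
    rw [this]
    rfl
  have hψ1 : HasFDerivAt ψ ((fderiv ℂ ψ z).restrictScalars ℝ) z :=
    (hψ.differentiableAt (by norm_num)).hasFDerivAt.restrictScalars ℝ
  have hu1 : HasFDerivAt (fderiv ℝ u) (fderiv ℝ (fderiv ℝ u) (ψ z)) (ψ z) :=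
    ((hu.fderiv_right (m := 1) (by norm_num)).differentiableAt (by norm_num)).hasFDerivAt
  have hψ2 : HasFDerivAt (fderiv ℂ ψ) (fderiv ℂ (fderiv ℂ ψ) z) z :=
    ((hψ.fderiv_right (m := 1) (by norm_num)).differentiableAt (by norm_num)).hasFDerivAt
  have hψ3 : HasFDerivAt (fun w => fderiv ℂ ψ w b)
      (((fderiv ℂ (fderiv ℂ ψ) z).flip b).restrictScalars ℝ) z := by
    have := hψ2.clm_apply (hasFDerivAt_const b z)
    rw [ContinuousLinearMap.comp_zero, zero_add] at this
    exact this.restrictScalars ℝ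
  have e2 := ((hu1.comp z hψ1).clm_apply hψ3).fderiv
  simp only [Function.comp_def] at e2
  rw [e0, e1.fderiv_eq, e2]
  simp [add_comm]

/-- The second derivative of ψ is complex bilinear, so its contributions at `v` and at `I • v`
cancel; this is the invariance of ∂∂̄ under holomorphic maps. -/
theorem leviForm_comp_holomorphic {u : Cn n → ℝ} {ψ : Cn n → Cn n}
    (hψ : ContDiffAt ℂ 2 ψ z) (hu : ContDiffAt ℝ 2 u (ψ z)) (v : Cn n) :
    leviForm (fun w => u (ψ w)) z v = leviForm u (ψ z) (fderiv ℂ ψ z v) := by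
  simp only [leviForm, fderiv_fderiv_comp_holomorphic hψ hu, map_smul, smul_apply]
  rw [smul_smul, Complex.I_mul_I, neg_one_smul, map_neg]
  ring

theorem fderiv_comp_holomorphic {u : Cn n → ℝ} {ψ : Cn n → Cn n}
    (hψ : ContDiffAt ℂ 2 ψ z) (hu : ContDiffAt ℝ 2 u (ψ z)) (v : Cn n) :
    fderiv ℝ (fun w => u (ψ w)) z v = fderiv ℝ u (ψ z) (fderiv ℂ ψ z v) := by
  have hw := (hψ.differentiableAt (by norm_num)).hasFDerivAt.restrictScalars ℝ
  have := (hu.differentiableAt_two.hasFDerivAt.comp z hw).fderiv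
  simp only [Function.comp_def] at this
  rw [this]
  rfl

/-- First and second derivatives are bounded near a point of a set on which the function
is of class `C²` in the sense of Whitney. -/
theorem exists_eventually_norm_fderiv_le {E : Type*} [NormedAddCommGroup E] [NormedSpace ℝ E]
    {f : E → ℝ} {s : Set E} {x : E} (hx : x ∈ s) (hf : ContDiffWithinAt ℝ 2 f s x) :
    ∃ C : ℝ, ∀ᶠ y in 𝓝 x, y ∈ interior s →
      ‖fderiv ℝ f y‖ ≤ C ∧ ‖fderiv ℝ (fderiv ℝ f) y‖ ≤ C := by
  have hf' : ContDiffWithinAt ℝ (1 + 1) f s x := by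
    rwa [one_add_one_eq_two]
  obtain ⟨u, hu, -, -, f', hf1, hf2⟩ :=
    (contDiffWithinAt_succ_iff_hasFDerivWithinAt' (by simp)).1 hf'
  have hf2' : ContDiffWithinAt ℝ (0 + 1) f' s x := by rwa [zero_add]
  obtain ⟨u₂, hu₂, -, -, f'', hf3, hf4⟩ :=
    (contDiffWithinAt_succ_iff_hasFDerivWithinAt' (by simp)).1 hf2'
  rw [insert_eq_of_mem hx] at hu hu₂
  have c1 := hf2.continuousWithinAt
  have c2 := hf4.continuousWithinAt
  have n1 : ∀ᶠ y in 𝓝[s] x, ‖f' y‖ < ‖f' x‖ + 1 :=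
    c1.norm.eventually (gt_mem_nhds (by linarith))
  have n2 : ∀ᶠ y in 𝓝[s] x, ‖f'' y‖ < ‖f'' x‖ + 1 :=
    c2.norm.eventually (gt_mem_nhds (by linarith))
  have hall : ∀ᶠ y in 𝓝[s] x, y ∈ u ∧ y ∈ u₂ ∧ ‖f' y‖ < ‖f' x‖ + 1 ∧ ‖f'' y‖ < ‖f'' x‖ + 1 :=
    (eventually_mem_set.2 hu).and ((eventually_mem_set.2 hu₂).and (n1.and n2))
  obtain ⟨w, hw, hxw, hws⟩ := mem_nhdsWithin.1 hall
  refine ⟨max (‖f' x‖ + 1) (‖f'' x‖ + 1), ?_⟩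
  filter_upwards [hw.mem_nhds hxw] with y hyw hys
  have hinteg : ∀ y, y ∈ w → y ∈ interior s → HasFDerivAt f (f' y) y := fun y h1 h2 =>
    (hf1 y (hws ⟨h1, interior_subset h2⟩).1).hasFDerivAt (mem_interior_iff_mem_nhds.1 h2)
  obtain ⟨-, h2, h3, h4⟩ := hws ⟨hyw, interior_subset hys⟩
  have heq : fderiv ℝ f =ᶠ[𝓝 y] f' := by
    filter_upwards [hw.mem_nhds hyw, isOpen_interior.mem_nhds hys] with y' h1 h2
    exact (hinteg y' h1 h2).fderiv
  have hd2 : HasFDerivAt f' (f'' y) y :=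
    (hf3 y h2).hasFDerivAt (mem_interior_iff_mem_nhds.1 hys)
  rw [heq.fderiv_eq, hd2.fderiv, heq.eq_of_nhds]
  exact ⟨h3.le.trans (le_max_left _ _), h4.le.trans (le_max_right _ _)⟩

theorem abs_leviForm_le {f : Cn n → ℝ} {C : ℝ} (hC : ‖fderiv ℝ (fderiv ℝ f) z‖ ≤ C)
    (v : Cn n) : |leviForm f z v| ≤ 2 * C * ‖v‖ ^ 2 := by
  have h : ∀ w : Cn n, ‖w‖ = ‖v‖ → |fderiv ℝ (fderiv ℝ f) z w w| ≤ C * ‖v‖ ^ 2 := by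
    intro w hw
    have h1 := (fderiv ℝ (fderiv ℝ f) z).le_opNorm₂ w w
    rw [hw, Real.norm_eq_abs] at h1
    refine h1.trans ?_
    rw [mul_assoc, ← sq]
    gcongr
  have h1 := h v rfl
  have h2 := h (Complex.I • v) (by rw [norm_smul]; simp)
  rw [leviForm]
  refine (abs_add_le _ _).trans ?_
  linarith

end Holomorphic

/-! ### The Kähler metric in charts -/

section Charts

open scoped ComplexOrder

variable {n : ℕ} {M : Type*} [TopologicalSpace M] [ChartedSpace (Cn n) M]

theorem contDiffOn_transition [IsManifold 𝓘(ℂ, Cn n) ω M] {e e' : OpenPartialHomeomorph M (Cn n)}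
    (he : e ∈ atlas (Cn n) M) (he' : e' ∈ atlas (Cn n) M) :
    ContDiffOn ℂ ω (fun w => e' (e.symm w)) (e.symm.trans e').source := by
  have h := contMDiffOn_of_mem_contDiffGroupoid
    (HasGroupoid.compatible (G := contDiffGroupoid ω 𝓘(ℂ, Cn n)) he he')
  exact contMDiffOn_iff_contDiffOn.1 h

theorem contDiffAt_transition [IsManifold 𝓘(ℂ, Cn n) ω M] {e e' : OpenPartialHomeomorph M (Cn n)}
    (he : e ∈ atlas (Cn n) M) (he' : e' ∈ atlas (Cn n) M) {x : M} (hx : x ∈ e.source)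
    (hx' : x ∈ e'.source) : ContDiffAt ℂ 2 (fun w => e' (e.symm w)) (e x) := by
  have h := (contDiffOn_transition he he').contDiffAt (x := e x)
    ((e.symm.trans e').open_source.mem_nhds (by simp [hx, hx']))
  exact h.of_le le_top

theorem isManifold_real [IsManifold 𝓘(ℂ, Cn n) ω M] : IsManifold 𝓘(ℝ, Cn n) ∞ M := by
  refine isManifold_of_contDiffOn _ _ _ fun e e' he he' => ?_
  have h := ((contDiffOn_transition he he').restrict_scalars ℝ).of_le (m := ∞) le_top
  simpa [Function.comp_def] using h

/-- The inner product of a Kähler metric on the model tangent space. -/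
def KahlerMetric.formAt (g : KahlerMetric n M) (x : M) : Cn n →ₗ⋆[ℂ] Cn n →ₗ[ℂ] ℂ := g.form x

/-- The differential of the inverse of a chart. -/
noncomputable def symmDeriv (e : OpenPartialHomeomorph M (Cn n)) (z : Cn n) : Cn n →L[ℂ] Cn n :=
  mfderiv 𝓘(ℂ, Cn n) 𝓘(ℂ, Cn n) e.symm z

/-- The squared length, in the metric, of a vector in a chart. -/
noncomputable def KahlerMetric.metricForm (g : KahlerMetric n M)
    (e : OpenPartialHomeomorph M (Cn n)) (z v : Cn n) : ℝ :=
  (g.formAt (e.symm z) (symmDeriv e z v) (symmDeriv e z v)).re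

theorem KahlerMetric.coeff_apply (g : KahlerMetric n M) (e : OpenPartialHomeomorph M (Cn n))
    (z : Cn n) (j k : Fin n) : g.coeff e z j k =
      g.formAt (e.symm z) (symmDeriv e z (Pi.single k 1)) (symmDeriv e z (Pi.single j 1)) := rfl

theorem KahlerMetric.coeff_isHermitian (g : KahlerMetric n M)
    (e : OpenPartialHomeomorph M (Cn n)) (z : Cn n) : (g.coeff e z).IsHermitian :=
  Matrix.IsHermitian.ext fun j k => by
    rw [g.coeff_apply, g.coeff_apply]
    exact (g.hermitian _ _ _).symm

theorem KahlerMetric.star_dotProduct_coeff (g : KahlerMetric n M)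
    (e : OpenPartialHomeomorph M (Cn n)) (z : Cn n) (v : Fin n → ℂ) :
    star v ⬝ᵥ (g.coeff e z).mulVec v = (g.metricForm e z (star v) : ℂ) := by
  have h1 : star v ⬝ᵥ (g.coeff e z).mulVec v =
      g.formAt (e.symm z) (symmDeriv e z (star v)) (symmDeriv e z (star v)) := by
    conv_rhs => rw [Cn_eq_sum_single (star v)]
    simp only [map_sum, LinearMap.sum_apply, map_smul, LinearMap.map_smulₛₗ, LinearMap.smul_apply,
      smul_eq_mul, Finset.mul_sum, dotProduct, Matrix.mulVec]
    refine Finset.sum_congr rfl fun j _ => Finset.sum_congr rfl fun k _ => ?_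
    rw [g.coeff_apply]
    simp only [Pi.star_apply, Complex.star_def, Complex.conj_conj]
    ring
  have h2 := form_im_eq_zero (g.coeff_isHermitian e z) v
  rw [h1] at h2 ⊢
  exact Complex.ext (by simp [metricForm]) (by simp [h2])

theorem KahlerMetric.continuousOn_coeff (g : KahlerMetric n M)
    {e : OpenPartialHomeomorph M (Cn n)} (he : e ∈ atlas (Cn n) M) :
    ContinuousOn (g.coeff e) e.target :=
  continuousOn_pi.2 fun j => continuousOn_pi.2 fun k => (g.smooth e he j k).continuousOn

variable [IsManifold 𝓘(ℂ, Cn n) ω M]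

theorem symmDeriv_injective {e : OpenPartialHomeomorph M (Cn n)} (he : e ∈ atlas (Cn n) M)
    {z : Cn n} (hz : z ∈ e.target) : Function.Injective (symmDeriv e z) := by
  have h : e.MDifferentiable 𝓘(ℂ, Cn n) 𝓘(ℂ, Cn n) := by
    have : IsManifold 𝓘(ℂ, Cn n) 1 M := IsManifold.of_le (n := ω) le_top
    exact mdifferentiable_of_mem_atlas he
  exact h.symm.mfderiv_injective hz

theorem KahlerMetric.metricForm_pos (g : KahlerMetric n M)
    {e : OpenPartialHomeomorph M (Cn n)} (he : e ∈ atlas (Cn n) M) {z : Cn n} (hz : z ∈ e.target)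
    {v : Cn n} (hv : v ≠ 0) : 0 < g.metricForm e z v := by
  refine g.pos _ _ fun h => hv ?_
  exact symmDeriv_injective he hz (h.trans (map_zero _).symm)

theorem KahlerMetric.coeff_posDef (g : KahlerMetric n M) {e : OpenPartialHomeomorph M (Cn n)}
    (he : e ∈ atlas (Cn n) M) {z : Cn n} (hz : z ∈ e.target) : (g.coeff e z).PosDef := by
  refine Matrix.PosDef.of_dotProduct_mulVec_pos (g.coeff_isHermitian e z) fun v hv => ?_
  rw [g.star_dotProduct_coeff]
  exact_mod_cast g.metricForm_pos he hz (star_ne_zero.2 hv)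

theorem KahlerMetric.metricForm_transition (g : KahlerMetric n M)
    {e e' : OpenPartialHomeomorph M (Cn n)} (he : e ∈ atlas (Cn n) M) (he' : e' ∈ atlas (Cn n) M)
    {x : M} (hx : x ∈ e.source) (hx' : x ∈ e'.source) (v : Cn n) :
    g.metricForm e (e x) v =
      g.metricForm e' (e' x) (fderiv ℂ (fun w => e' (e.symm w)) (e x) v) := by
  have : IsManifold 𝓘(ℂ, Cn n) 1 M := IsManifold.of_le (n := ω) le_top
  have hψ := contDiffAt_transition he he' hx hx'
  have hpt : e' (e.symm (e x)) = e' x := by rw [e.left_inv hx]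
  have heq : e.symm =ᶠ[𝓝 (e x)] e'.symm ∘ fun w => e' (e.symm w) := by
    have : (e.symm.trans e').source ∈ 𝓝 (e x) :=
      (e.symm.trans e').open_source.mem_nhds (by simp [hx, hx'])
    filter_upwards [this] with w hw
    have hw' : e.symm w ∈ e'.source := by
      have := hw.2
      simpa using this
    simp [e'.left_inv hw']
  have hsymm : MDifferentiableAt 𝓘(ℂ, Cn n) 𝓘(ℂ, Cn n) e'.symm (e' (e.symm (e x))) := by
    rw [hpt]
    exact mdifferentiableAt_atlas_symm he' (e'.map_source hx')
  have hψm : MDifferentiableAt 𝓘(ℂ, Cn n) 𝓘(ℂ, Cn n) (fun w => e' (e.symm w)) (e x) :=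
    (hψ.differentiableAt (by norm_num)).mdifferentiableAt
  have hd : symmDeriv e (e x) v =
      symmDeriv e' (e' x) (fderiv ℂ (fun w => e' (e.symm w)) (e x) v) := by
    have h1 := mfderiv_comp (e x) hsymm hψm
    have h2 : symmDeriv e (e x) = (mfderiv 𝓘(ℂ, Cn n) 𝓘(ℂ, Cn n)
      (e'.symm ∘ fun w => e' (e.symm w)) (e x) : Cn n →L[ℂ] Cn n) := heq.mfderiv_eq
    rw [h2]
    erw [h1]
    have h3 : (mfderiv 𝓘(ℂ, Cn n) 𝓘(ℂ, Cn n) (fun w => e' (e.symm w)) (e x) : Cn n →L[ℂ] Cn n)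
      = fderiv ℂ (fun w => e' (e.symm w)) (e x) := mfderiv_eq_fderiv
    change symmDeriv e' (e' (e.symm (e x))) ((mfderiv 𝓘(ℂ, Cn n) 𝓘(ℂ, Cn n)
      (fun w => e' (e.symm w)) (e x) : Cn n →L[ℂ] Cn n) v) = _
    rw [h3, hpt]
    rfl
  simp only [metricForm]
  rw [hd, e.left_inv hx, e'.left_inv hx']

/-- The form is positive on the compact unit sphere at `z₀`, hence uniformly so for nearby `z`, and
homogeneity covers all vectors. -/
theorem KahlerMetric.exists_metricForm_lower (g : KahlerMetric n M)
    {e : OpenPartialHomeomorph M (Cn n)} (he : e ∈ atlas (Cn n) M) {z₀ : Cn n}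
    (hz₀ : z₀ ∈ e.target) :
    ∃ c : ℝ, 0 < c ∧ ∀ᶠ z in 𝓝 z₀, ∀ v : Cn n, c * ‖v‖ ^ 2 ≤ g.metricForm e z v := by
  have hform : ∀ z v, g.metricForm e z v =
      (star (star v) ⬝ᵥ (g.coeff e z).mulVec (star v)).re := by
    intro z v
    rw [g.star_dotProduct_coeff, star_star, Complex.ofReal_re]
  have hcont : ∀ v : Cn n, ContinuousAt (fun p : Cn n × Cn n => g.metricForm e p.1 p.2)
      (z₀, v) := by
    intro v
    simp only [hform, star_star]
    have h1 : ContinuousAt (fun p : Cn n × Cn n => g.coeff e p.1) (z₀, v) :=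
      ContinuousAt.comp (f := Prod.fst) (x := (z₀, v))
        ((g.continuousOn_coeff he).continuousAt (e.open_target.mem_nhds hz₀)) continuousAt_fst
    have h2 : ∀ j k, ContinuousAt (fun p : Cn n × Cn n => g.coeff e p.1 j k) (z₀, v) := fun j k =>
      (continuous_apply_apply j k).continuousAt.comp h1
    simp only [dotProduct, Matrix.mulVec]
    refine Complex.continuous_re.continuousAt.comp ?_
    refine tendsto_finsetSum _ fun j _ => ?_
    refine ContinuousAt.mul (by fun_prop) ?_
    refine tendsto_finsetSum _ fun k _ => ?_
    exact (h2 j k).mul (by fun_prop)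
  have hK : IsCompact (Metric.sphere (0 : Cn n) 1) := isCompact_sphere 0 1
  obtain ⟨c, hc, hcs⟩ : ∃ c : ℝ, 0 < c ∧ ∀ v ∈ Metric.sphere (0 : Cn n) 1,
      c < g.metricForm e z₀ v := by
    rcases (Metric.sphere (0 : Cn n) 1).eq_empty_or_nonempty with h | h
    · exact ⟨1, one_pos, by simp [h]⟩
    · have hcv : ContinuousOn (fun v => g.metricForm e z₀ v) (Metric.sphere (0 : Cn n) 1) :=
        fun v _ => (ContinuousAt.comp (f := fun v => (z₀, v)) (x := v) (hcont v)
          (by fun_prop)).continuousWithinAt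
      obtain ⟨v₀, hv₀, hmin⟩ := hK.exists_isMinOn h hcv
      have hpos : 0 < g.metricForm e z₀ v₀ := g.metricForm_pos he hz₀ (by
        rintro rfl
        simp at hv₀)
      exact ⟨g.metricForm e z₀ v₀ / 2, by linarith, fun v hv => by
        have : g.metricForm e z₀ v₀ ≤ g.metricForm e z₀ v := hmin hv
        linarith⟩
  refine ⟨c, hc, ?_⟩
  have hev : ∀ᶠ z in 𝓝 z₀, ∀ v ∈ Metric.sphere (0 : Cn n) 1, c < g.metricForm e z v :=
    hK.eventually_forall_of_forall_eventually fun v hv =>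
      (hcont v).eventually (lt_mem_nhds (hcs v hv))
  filter_upwards [hev] with z hz v
  by_cases hv : v = 0
  · subst hv
    simp [metricForm]
  · have hn : 0 < ‖v‖ := norm_pos_iff.2 hv
    have hv' : ((‖v‖⁻¹ : ℝ) : ℂ) • v ∈ Metric.sphere (0 : Cn n) 1 := by
      simp [norm_smul, hn.ne']
    have h1 := hz _ hv'
    have h2 : g.metricForm e z (((‖v‖⁻¹ : ℝ) : ℂ) • v) =
        ‖v‖⁻¹ ^ 2 * g.metricForm e z v := by
      simp only [metricForm, map_smul, LinearMap.map_smulₛₗ, LinearMap.smul_apply, smul_eq_mul,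
        Complex.conj_ofReal]
      rw [Complex.re_ofReal_mul, Complex.re_ofReal_mul]
      ring
    rw [h2, inv_pow, ← div_eq_inv_mul, lt_div_iff₀ (by positivity)] at h1
    exact h1.le

end Charts

/-! ### Smooth functions have derivatives bounded by the metric -/

section Charts

open scoped ComplexOrder

variable {n : ℕ}

/-- The complex linear part of a real linear form. -/
noncomputable def complexPart (D : Cn n →L[ℝ] ℝ) : Cn n →ₗ[ℂ] ℂ where
  toFun u := ((D u : ℂ) - Complex.I * D (Complex.I • u)) / 2
  map_add' u v := by
    simp only [map_add, smul_add, Complex.ofReal_add]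
    ring
  map_smul' c u := by
    have hc : c • u = c.re • u + c.im • (Complex.I • u) := by
      ext i
      simp only [Pi.smul_apply, Pi.add_apply, smul_eq_mul, Complex.real_smul]
      linear_combination (-u i) * Complex.re_add_im c
    have hI : Complex.I • c • u = c.re • (Complex.I • u) - c.im • u := by
      ext i
      simp only [Pi.smul_apply, Pi.sub_apply, smul_eq_mul, Complex.real_smul]
      linear_combination (-Complex.I * u i) * Complex.re_add_im c +
        c.im * u i * Complex.I_mul_I
    rw [hI, hc]
    simp only [map_add, map_sub, map_smul, smul_eq_mul,
      Complex.ofReal_add, Complex.ofReal_sub, Complex.ofReal_mul, RingHom.id_apply]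
    conv_rhs => rw [← Complex.re_add_im c]
    linear_combination (c.im : ℂ) / 2 * D (Complex.I • u) * Complex.I_mul_I

theorem sum_mul_wirtingerGrad {f : Cn n → ℝ} {z : Cn n} (hf : DifferentiableAt ℝ f z) (u : Cn n) :
    ∑ j, u j * wirtingerGrad f z j =
      ((fderiv ℝ f z u : ℂ) - Complex.I * fderiv ℝ f z (Complex.I • u)) / 2 := by
  have h : complexPart (fderiv ℝ f z) u =
      ((fderiv ℝ f z u : ℂ) - Complex.I * fderiv ℝ f z (Complex.I • u)) / 2 := rfl
  rw [← h]
  conv_rhs => rw [Cn_eq_sum_single u]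
  simp only [map_sum, map_smul, smul_eq_mul]
  refine Finset.sum_congr rfl fun j _ => ?_
  congr 1
  simp only [wirtingerGrad, wirtinger, fderiv_ofReal_comp hf, complexPart, LinearMap.coe_mk,
    AddHom.coe_mk, I_smul_single]

theorem star_dotProduct_vecMulVec_grad {f : Cn n → ℝ} {z : Cn n} (hf : DifferentiableAt ℝ f z)
    (v : Fin n → ℂ) :
    star v ⬝ᵥ (Matrix.vecMulVec (wirtingerGrad f z) (star (wirtingerGrad f z))).mulVec v =
      ((((fderiv ℝ f z (star v)) ^ 2 + (fderiv ℝ f z (Complex.I • star v)) ^ 2) / 4 : ℝ) : ℂ) := by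
  have h1 : star v ⬝ᵥ (Matrix.vecMulVec (wirtingerGrad f z) (star (wirtingerGrad f z))).mulVec v =
      (∑ j, star v j * wirtingerGrad f z j) *
        starRingEnd ℂ (∑ j, star v j * wirtingerGrad f z j) := by
    rw [map_sum, Finset.sum_mul_sum]
    simp only [dotProduct, Matrix.mulVec, Matrix.vecMulVec_apply, Finset.mul_sum]
    refine Finset.sum_congr rfl fun j _ => Finset.sum_congr rfl fun k _ => ?_
    simp only [Pi.star_apply, Complex.star_def, map_mul, Complex.conj_conj]
    ring
  rw [h1, sum_mul_wirtingerGrad hf, map_div₀, map_sub, map_mul, Complex.conj_ofReal,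
    Complex.conj_ofReal, Complex.conj_I, map_ofNat]
  push_cast
  linear_combination (-(1 / 4 : ℂ) * (fderiv ℝ f z (Complex.I • star v) : ℂ) ^ 2) *
    Complex.I_mul_I

variable {M : Type*} [TopologicalSpace M] [ChartedSpace (Cn n) M]

theorem KahlerMetric.metricForm_I_smul (g : KahlerMetric n M)
    (e : OpenPartialHomeomorph M (Cn n)) (z v : Cn n) :
    g.metricForm e z (Complex.I • v) = g.metricForm e z v := by
  simp only [metricForm, map_smul, LinearMap.map_smulₛₗ, LinearMap.smul_apply, smul_eq_mul,
    Complex.conj_I]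
  congr 1
  linear_combination (-(g.formAt (e.symm z) (symmDeriv e z v) (symmDeriv e z v))) * Complex.I_mul_I

/-- A function has Levi form and gradient bounded by `b` with respect to the metric at a point. -/
def KahlerMetric.DerivBound (g : KahlerMetric n M) (b : ℝ) (u : M → ℝ) (x : M) : Prop :=
  ∀ e ∈ atlas (Cn n) M, x ∈ e.source → ∀ v : Cn n,
    |leviForm (fun w => u (e.symm w)) (e x) v| ≤ b * g.metricForm e (e x) v ∧
    (fderiv ℝ (fun w => u (e.symm w)) (e x) v) ^ 2 ≤ b * g.metricForm e (e x) v

/-- Both bω - i∂∂̄u and bω + i∂∂̄u are positive semidefinite, so the functional can be applied to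
them. -/
theorem KahlerMetric.DerivBound.levi_le {g : KahlerMetric n M} {b : ℝ} {u : M → ℝ} {x : M}
    (h : g.DerivBound b u x) {e : OpenPartialHomeomorph M (Cn n)}
    (he : e ∈ atlas (Cn n) M) (hx : x ∈ e.source)
    (hu : ContDiffAt ℝ 2 (fun w => u (e.symm w)) (e x))
    {l : Matrix (Fin n) (Fin n) ℂ →ₗ[ℝ] ℝ}
    (hl : ∀ X : Matrix (Fin n) (Fin n) ℂ, X.PosSemidef → 0 ≤ l X) :
    |l (leviMatrix (fun w => u (e.symm w)) (e x))| ≤ b * l (g.coeff e (e x)) := by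
  have hsm : ∀ (r : ℝ) (b : Matrix (Fin n) (Fin n) ℂ), b.IsHermitian →
      ((r : ℂ) • b).IsHermitian := fun r b hb => by
    rw [Matrix.IsHermitian, Matrix.conjTranspose_smul, hb.eq]; simp
  have hb : ∀ v : Fin n → ℂ, |leviForm (fun w => u (e.symm w)) (e x) (star v) / 4| ≤
      b * g.metricForm e (e x) (star v) := by
    intro v
    have h1 := (h e he hx (star v)).1
    rw [abs_div, abs_of_pos (by norm_num : (0 : ℝ) < 4)]
    have := abs_nonneg (leviForm (fun w => u (e.symm w)) (e x) (star v))
    linarith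
  have p1 : ((b : ℂ) • g.coeff e (e x) - leviMatrix (fun w => u (e.symm w)) (e x)).PosSemidef := by
    refine Matrix.PosSemidef.of_dotProduct_mulVec_nonneg
      ((hsm _ _ (g.coeff_isHermitian e _)).sub (leviMatrix_isHermitian hu)) fun v => ?_
    rw [Matrix.sub_mulVec, Matrix.smul_mulVec, dotProduct_sub, dotProduct_smul,
      g.star_dotProduct_coeff, star_dotProduct_leviMatrix hu, smul_eq_mul, ← Complex.ofReal_mul,
      ← Complex.ofReal_sub]
    have := (abs_le.1 (hb v)).2
    exact_mod_cast sub_nonneg.2 this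
  have p2 : ((b : ℂ) • g.coeff e (e x) + leviMatrix (fun w => u (e.symm w)) (e x)).PosSemidef := by
    refine Matrix.PosSemidef.of_dotProduct_mulVec_nonneg
      ((hsm _ _ (g.coeff_isHermitian e _)).add (leviMatrix_isHermitian hu)) fun v => ?_
    rw [Matrix.add_mulVec, Matrix.smul_mulVec, dotProduct_add, dotProduct_smul,
      g.star_dotProduct_coeff, star_dotProduct_leviMatrix hu, smul_eq_mul, ← Complex.ofReal_mul,
      ← Complex.ofReal_add]
    have := (abs_le.1 (hb v)).1
    have h2 : 0 ≤ b * g.metricForm e (e x) (star v) +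
      leviForm (fun w => u (e.symm w)) (e x) (star v) / 4 := by linarith
    exact_mod_cast h2
  have q1 := hl _ p1
  have q2 := hl _ p2
  rw [map_sub, map_ofReal_smul] at q1
  rw [map_add, map_ofReal_smul] at q2
  exact abs_le.2 ⟨by linarith, by linarith⟩

theorem KahlerMetric.DerivBound.grad_le {g : KahlerMetric n M} {b : ℝ} {u : M → ℝ} {x : M}
    (h : g.DerivBound b u x) {e : OpenPartialHomeomorph M (Cn n)}
    (he : e ∈ atlas (Cn n) M) (hx : x ∈ e.source)
    (hu : ContDiffAt ℝ 2 (fun w => u (e.symm w)) (e x))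
    {l : Matrix (Fin n) (Fin n) ℂ →ₗ[ℝ] ℝ}
    (hl : ∀ X : Matrix (Fin n) (Fin n) ℂ, X.PosSemidef → 0 ≤ l X) :
    l (Matrix.vecMulVec (wirtingerGrad (fun w => u (e.symm w)) (e x))
      (star (wirtingerGrad (fun w => u (e.symm w)) (e x)))) ≤ b * l (g.coeff e (e x)) := by
  have hsm : ∀ (r : ℝ) (b : Matrix (Fin n) (Fin n) ℂ), b.IsHermitian →
      ((r : ℂ) • b).IsHermitian := fun r b hb => by
    rw [Matrix.IsHermitian, Matrix.conjTranspose_smul, hb.eq]; simp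
  have p1 : ((b : ℂ) • g.coeff e (e x) -
      Matrix.vecMulVec (wirtingerGrad (fun w => u (e.symm w)) (e x))
      (star (wirtingerGrad (fun w => u (e.symm w)) (e x)))).PosSemidef := by
    refine Matrix.PosSemidef.of_dotProduct_mulVec_nonneg
      ((hsm _ _ (g.coeff_isHermitian e _)).sub
        (Matrix.posSemidef_vecMulVec_self_star _).isHermitian) fun v => ?_
    rw [Matrix.sub_mulVec, Matrix.smul_mulVec, dotProduct_sub, dotProduct_smul,
      g.star_dotProduct_coeff, star_dotProduct_vecMulVec_grad hu.differentiableAt_two,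
      smul_eq_mul, ← Complex.ofReal_mul, ← Complex.ofReal_sub]
    have h1 := (h e he hx (star v)).2
    have h2 := (h e he hx (Complex.I • star v)).2
    rw [g.metricForm_I_smul] at h2
    have h3 := sq_nonneg (fderiv ℝ (fun w => u (e.symm w)) (e x) (star v))
    exact_mod_cast sub_nonneg.2 (by linarith)
  have q1 := hl _ p1
  rw [map_sub, map_ofReal_smul] at q1
  linarith

variable [IsManifold 𝓘(ℂ, Cn n) ω M]

theorem ContMDiffAt.contDiffAt_chart {u : M → ℝ} {k : WithTop ℕ∞} (hk : k ≤ ∞)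
    {e : OpenPartialHomeomorph M (Cn n)} (he : e ∈ atlas (Cn n) M) {z : Cn n} (hz : z ∈ e.target)
    (hu : ContMDiffAt 𝓘(ℝ, Cn n) 𝓘(ℝ, ℝ) k u (e.symm z)) :
    ContDiffAt ℝ k (fun w => u (e.symm w)) z := by
  have hM : IsManifold 𝓘(ℝ, Cn n) ∞ M := isManifold_real
  have h1 : ContMDiffAt 𝓘(ℝ, Cn n) 𝓘(ℝ, Cn n) k e.symm z :=
    ((contMDiffOn_symm_of_mem_maximalAtlas (n := ∞)
      (IsManifold.subset_maximalAtlas he)).contMDiffAt (e.open_target.mem_nhds hz)).of_le hk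
  exact contMDiffAt_iff_contDiffAt.1 (hu.comp z h1)

theorem ContMDiffOn.contDiffWithinAt_chart {u : M → ℝ} {s : Set M}
    (hu : ContMDiffOn 𝓘(ℝ, Cn n) 𝓘(ℝ, ℝ) ∞ u s)
    {e : OpenPartialHomeomorph M (Cn n)} (he : e ∈ atlas (Cn n) M) {z : Cn n} (hz : z ∈ e.target)
    (hzs : e.symm z ∈ s) :
    ContDiffWithinAt ℝ 2 (fun w => u (e.symm w)) (e.symm ⁻¹' s) z := by
  have hM : IsManifold 𝓘(ℝ, Cn n) ∞ M := isManifold_real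
  have h1 : ContMDiffAt 𝓘(ℝ, Cn n) 𝓘(ℝ, Cn n) ∞ e.symm z :=
    (contMDiffOn_symm_of_mem_maximalAtlas (n := ∞)
      (IsManifold.subset_maximalAtlas he)).contMDiffAt (e.open_target.mem_nhds hz)
  have h2 := (hu _ hzs).comp z (h1.contMDiffWithinAt (s := e.symm ⁻¹' s)) (fun w hw => hw)
  exact (contMDiffWithinAt_iff_contDiffWithinAt.1 h2).of_le (WithTop.coe_le_coe.2 le_top)

/-- A bound on derivatives in one chart holds in all charts. -/
theorem KahlerMetric.derivBound_of_chart (g : KahlerMetric n M) {b : ℝ} {u : M → ℝ} {x : M}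
    (hu : ContMDiffAt 𝓘(ℝ, Cn n) 𝓘(ℝ, ℝ) 2 u x) {e' : OpenPartialHomeomorph M (Cn n)}
    (he' : e' ∈ atlas (Cn n) M) (hx' : x ∈ e'.source)
    (h : ∀ v : Cn n, |leviForm (fun w => u (e'.symm w)) (e' x) v| ≤ b * g.metricForm e' (e' x) v ∧
      (fderiv ℝ (fun w => u (e'.symm w)) (e' x) v) ^ 2 ≤ b * g.metricForm e' (e' x) v) :
    g.DerivBound b u x := by
  intro e he hx v
  have hψ := contDiffAt_transition he he' hx hx'
  have hpt : e' (e.symm (e x)) = e' x := by rw [e.left_inv hx]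
  have hu' : ContDiffAt ℝ 2 (fun w => u (e'.symm w)) (e' (e.symm (e x))) := by
    rw [hpt]
    refine ContMDiffAt.contDiffAt_chart (WithTop.coe_le_coe.2 le_top) he' (e'.map_source hx') ?_
    rwa [e'.left_inv hx']
  have heq : (fun w => u (e.symm w)) =ᶠ[𝓝 (e x)]
      fun w => (fun w => u (e'.symm w)) (e' (e.symm w)) := by
    have : (e.symm.trans e').source ∈ 𝓝 (e x) :=
      (e.symm.trans e').open_source.mem_nhds (by simp [hx, hx'])
    filter_upwards [this] with w hw
    have hw' : e.symm w ∈ e'.source := by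
      have := hw.2
      simpa using this
    simp [e'.left_inv hw']
  have h1 : leviForm (fun w => u (e.symm w)) (e x) v =
      leviForm (fun w => u (e'.symm w)) (e' x) (fderiv ℂ (fun w => e' (e.symm w)) (e x) v) := by
    have := leviForm_comp_holomorphic hψ hu' v
    rw [hpt] at this
    rw [← this]
    simp only [leviForm]
    rw [(heq.fderiv (𝕜 := ℝ)).fderiv_eq]
  have h2 : fderiv ℝ (fun w => u (e.symm w)) (e x) v =
      fderiv ℝ (fun w => u (e'.symm w)) (e' x) (fderiv ℂ (fun w => e' (e.symm w)) (e x) v) := by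
    have := fderiv_comp_holomorphic hψ hu' v
    rw [hpt] at this
    rw [← this, heq.fderiv_eq]
  rw [h1, h2, g.metricForm_transition he he' hx hx']
  exact h _

theorem KahlerMetric.DerivBound.mono {g : KahlerMetric n M} {b b' : ℝ} {u : M → ℝ} {x : M}
    (hbb : b ≤ b') (h : g.DerivBound b u x) : g.DerivBound b' u x := by
  intro e he hx v
  have h0 : 0 ≤ g.metricForm e (e x) v := by
    by_cases hv : v = 0
    · subst hv; simp [metricForm]
    · exact (g.metricForm_pos he (e.map_source hx) hv).le
  obtain ⟨h1, h2⟩ := h e he hx v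
  have := mul_le_mul_of_nonneg_right hbb h0
  exact ⟨h1.trans this, h2.trans this⟩

/-- Compactness of the closure reduces this to a bound near each point in one chart. At boundary
points smoothness on the closed set still bounds the derivatives at nearby interior points, and the
bound passes to other charts by holomorphic invariance. -/
theorem KahlerMetric.exists_derivBound (g : KahlerMetric n M) {Ω : Set M} (hΩ : IsOpen Ω)
    (hcpt : IsCompact (closure Ω)) {u : M → ℝ}
    (hu : ContMDiffOn 𝓘(ℝ, Cn n) 𝓘(ℝ, ℝ) ∞ u (closure Ω)) :
    ∃ b : ℝ, 0 ≤ b ∧ ∀ x ∈ Ω, g.DerivBound b u x := by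
  have hlocal : ∀ x₀ ∈ closure Ω, ∃ t ∈ 𝓝[closure Ω] x₀, ∃ b : ℝ, 0 ≤ b ∧
      ∀ x ∈ t ∩ Ω, g.DerivBound b u x := by
    intro x₀ hx₀
    set e := chartAt (Cn n) x₀
    have he : e ∈ atlas (Cn n) M := chart_mem_atlas (Cn n) x₀
    have hxe : x₀ ∈ e.source := mem_chart_source (Cn n) x₀
    have hz₀ : e x₀ ∈ e.target := e.map_source hxe
    obtain ⟨C, hC⟩ := exists_eventually_norm_fderiv_le (x := e x₀)
      (s := e.symm ⁻¹' closure Ω) (by simpa [e.left_inv hxe] using hx₀)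
      (hu.contDiffWithinAt_chart he hz₀ (by simpa [e.left_inv hxe] using hx₀))
    obtain ⟨c, hc, hcz⟩ := g.exists_metricForm_lower he hz₀
    have hev : ∀ᶠ x in 𝓝 x₀, (e x ∈ interior (e.symm ⁻¹' closure Ω) →
        ‖fderiv ℝ (fun w => u (e.symm w)) (e x)‖ ≤ C ∧
        ‖fderiv ℝ (fderiv ℝ fun w => u (e.symm w)) (e x)‖ ≤ C) ∧
        (∀ v : Cn n, c * ‖v‖ ^ 2 ≤ g.metricForm e (e x) v) ∧ x ∈ e.source := by
      have h1 := (e.continuousAt hxe).eventually hC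
      have h2 := (e.continuousAt hxe).eventually hcz
      filter_upwards [h1, h2, e.open_source.mem_nhds hxe] with x a b c using ⟨a, b, c⟩
    have hC0 : 0 ≤ |C| := abs_nonneg C
    refine ⟨_, mem_nhdsWithin_of_mem_nhds hev, (2 * |C| + C ^ 2) / c, by positivity, ?_⟩
    rintro x ⟨⟨h1, h2, hxs⟩, hxΩ⟩
    have hinteg : e x ∈ interior (e.symm ⁻¹' closure Ω) := by
      have hopen : IsOpen (e.target ∩ e.symm ⁻¹' Ω) := e.isOpen_inter_preimage_symm hΩ
      exact mem_interior.2 ⟨_, fun w hw => subset_closure hw.2, hopen, e.map_source hxs, by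
        simpa [e.left_inv hxs] using hxΩ⟩
    obtain ⟨n1, n2⟩ := h1 hinteg
    refine g.derivBound_of_chart ?_ he hxs fun v => ?_
    · have := (hu x (subset_closure hxΩ)).contMDiffAt
        (mem_of_superset (hΩ.mem_nhds hxΩ) subset_closure)
      exact this.of_le (WithTop.coe_le_coe.2 le_top)
    · have hm := h2 v
      have hm' : ‖v‖ ^ 2 ≤ g.metricForm e (e x) v / c := by
        rw [le_div_iff₀ hc]; linarith
      have hm0 : 0 ≤ g.metricForm e (e x) v / c := (sq_nonneg _).trans hm'
      have e1 : (2 * |C| + C ^ 2) / c * g.metricForm e (e x) v =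
        (2 * |C| + C ^ 2) * (g.metricForm e (e x) v / c) := by ring
      rw [e1]
      constructor
      · have h3 := abs_leviForm_le (n2.trans (le_abs_self C)) v
        calc _ ≤ 2 * |C| * ‖v‖ ^ 2 := h3
          _ ≤ 2 * |C| * (g.metricForm e (e x) v / c) := by gcongr
          _ ≤ _ := mul_le_mul_of_nonneg_right (by nlinarith [sq_nonneg C]) hm0
      · have h3 := (fderiv ℝ (fun w => u (e.symm w)) (e x)).le_opNorm v
        have h4 : ‖fderiv ℝ (fun w => u (e.symm w)) (e x) v‖ ≤ |C| * ‖v‖ :=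
          h3.trans (mul_le_mul_of_nonneg_right (n1.trans (le_abs_self C)) (norm_nonneg _))
        rw [Real.norm_eq_abs] at h4
        calc _ = |fderiv ℝ (fun w => u (e.symm w)) (e x) v| ^ 2 := (sq_abs _).symm
          _ ≤ (|C| * ‖v‖) ^ 2 := by gcongr
          _ = C ^ 2 * ‖v‖ ^ 2 := by rw [mul_pow, sq_abs]
          _ ≤ C ^ 2 * (g.metricForm e (e x) v / c) := by gcongr
          _ ≤ _ := mul_le_mul_of_nonneg_right (by linarith) hm0
  obtain ⟨b, hb, h⟩ := hcpt.induction_on (p := fun s => ∃ b : ℝ, 0 ≤ b ∧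
    ∀ x ∈ s ∩ Ω, g.DerivBound b u x) ⟨0, le_rfl, by simp⟩
    (fun s t hst ⟨b, hb, h⟩ => ⟨b, hb, fun x hx => h x ⟨hst hx.1, hx.2⟩⟩)
    (fun s t ⟨b, hb, h⟩ ⟨b', hb', h'⟩ => ⟨max b b', le_max_of_le_left hb, fun x hx => by
      rcases hx.1 with h1 | h1
      · exact (h x ⟨h1, hx.2⟩).mono (le_max_left _ _)
      · exact (h' x ⟨h1, hx.2⟩).mono (le_max_right _ _)⟩)
    hlocal
  exact ⟨b, hb, fun x hx => h x ⟨subset_closure hx, hx⟩⟩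

end Charts

/-! ### A smooth convex ramp -/

section Ramp

/-- A smooth convex function that vanishes on `(-∞, 0]` and has slope one on `[1, ∞)`. -/
noncomputable def ramp (s : ℝ) : ℝ := ∫ t in (0 : ℝ)..s, Real.smoothTransition t

theorem hasDerivAt_ramp (s : ℝ) : HasDerivAt ramp (Real.smoothTransition s) s :=
  intervalIntegral.integral_hasDerivAt_right
    (Real.smoothTransition.continuous.intervalIntegrable _ _)
    Real.smoothTransition.continuous.aestronglyMeasurable.stronglyMeasurableAtFilter
    Real.smoothTransition.continuous.continuousAt

theorem deriv_ramp : deriv ramp = Real.smoothTransition := funext fun s => (hasDerivAt_ramp s).deriv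

theorem contDiff_ramp : ContDiff ℝ 2 ramp := by
  rw [← one_add_one_eq_two, contDiff_succ_iff_deriv, deriv_ramp]
  exact ⟨fun s => (hasDerivAt_ramp s).differentiableAt, by simp,
    Real.smoothTransition.contDiff (n := 1)⟩

theorem hasDerivAt_smoothTransition (s : ℝ) :
    HasDerivAt Real.smoothTransition (deriv Real.smoothTransition s) s :=
  ((Real.smoothTransition.contDiff (n := 1)).differentiable (by norm_num) s).hasDerivAt

theorem deriv_smoothTransition_nonneg (s : ℝ) : 0 ≤ deriv Real.smoothTransition s :=
  Real.smoothTransition.monotone.deriv_nonneg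

theorem ramp_of_nonpos {s : ℝ} (hs : s ≤ 0) : ramp s = 0 := by
  rw [ramp, intervalIntegral.integral_congr (g := fun _ => 0)]
  · simp
  · intro t ht
    rw [uIcc_of_ge hs] at ht
    exact Real.smoothTransition.zero_of_nonpos ht.2

theorem monotone_ramp : Monotone ramp :=
  monotone_of_deriv_nonneg (fun s => (hasDerivAt_ramp s).differentiableAt) fun s => by
    rw [deriv_ramp]; exact Real.smoothTransition.nonneg s

theorem ramp_nonneg (s : ℝ) : 0 ≤ ramp s := by
  rcases le_total s 0 with h | h
  · rw [ramp_of_nonpos h]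
  · rw [← ramp_of_nonpos (le_refl 0)]
    exact monotone_ramp h

theorem antitone_ramp_sub_id : Antitone fun s => ramp s - s :=
  antitone_of_deriv_nonpos (fun s => ((hasDerivAt_ramp s).sub (hasDerivAt_id s)).differentiableAt)
    fun s => by
      have h : HasDerivAt (fun s => ramp s - s) (Real.smoothTransition s - 1) s :=
        (hasDerivAt_ramp s).sub (hasDerivAt_id s)
      rw [h.deriv]
      linarith [Real.smoothTransition.le_one s]

theorem ramp_le_self {s : ℝ} (hs : 0 ≤ s) : ramp s ≤ s := by
  have := antitone_ramp_sub_id hs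
  simp only [ramp_of_nonpos (le_refl 0), sub_zero] at this
  linarith

theorem ramp_sub_id_of_one_le {s : ℝ} (hs : 1 ≤ s) : ramp s - s = ramp 1 - 1 := by
  have h1 : ramp s - ramp 1 = ∫ t in (1 : ℝ)..s, Real.smoothTransition t :=
    intervalIntegral.integral_interval_sub_left
      (Real.smoothTransition.continuous.intervalIntegrable _ _)
      (Real.smoothTransition.continuous.intervalIntegrable _ _)
  have h2 : ∫ t in (1 : ℝ)..s, Real.smoothTransition t = ∫ _ in (1 : ℝ)..s, (1 : ℝ) := by
    refine intervalIntegral.integral_congr fun t ht => ?_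
    rw [uIcc_of_le hs] at ht
    exact Real.smoothTransition.one_of_one_le ht.1
  rw [h2] at h1
  simp at h1
  linarith

theorem ramp_one_sub_le (s : ℝ) : ramp 1 - 1 ≤ ramp s - s := by
  rcases le_total 1 s with h | h
  · exact (ramp_sub_id_of_one_le h).ge
  · exact antitone_ramp_sub_id h

/-- Convexity: the function is controlled by its derivative, which lets the barrier absorb zeroth
order terms. -/
theorem ramp_le_mul {s : ℝ} (hs : 0 ≤ s) : ramp s ≤ s * Real.smoothTransition s := by
  have h : ramp s ≤ ∫ _ in (0 : ℝ)..s, Real.smoothTransition s := by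
    refine intervalIntegral.integral_mono_on hs
      (Real.smoothTransition.continuous.intervalIntegrable _ _) (by simp) fun t ht => ?_
    exact Real.smoothTransition.monotone ht.2
  simpa using h

/-- Smooth convex truncations from below, converging to the identity. -/
noncomputable def truncBelow (N t : ℝ) : ℝ := ramp (t + N) - N + (1 - ramp 1)

theorem ramp_one_mem : 0 ≤ ramp 1 ∧ ramp 1 ≤ 1 := ⟨ramp_nonneg 1, ramp_le_self zero_le_one⟩

/-- The constant `1 - ramp 1` compensates what the ramp loses on `[0, 1]`, so that the truncation is
exactly the identity above `1 - N`. -/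
theorem truncBelow_eq {N t : ℝ} (h : 1 ≤ t + N) : truncBelow N t = t := by
  have := ramp_sub_id_of_one_le h
  rw [truncBelow]
  linarith

theorem truncBelow_of_le {N t : ℝ} (h : t + N ≤ 0) : truncBelow N t = -N + (1 - ramp 1) := by
  rw [truncBelow, ramp_of_nonpos h]
  ring

theorem le_truncBelow (N t : ℝ) : t ≤ truncBelow N t := by
  have := ramp_one_sub_le (t + N)
  rw [truncBelow]
  linarith

theorem truncBelow_le {N t : ℝ} (hN : 0 ≤ N) : truncBelow N t ≤ max t 0 + 1 := by
  have h0 := ramp_one_mem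
  rcases le_total (t + N) 0 with h | h
  · rw [truncBelow_of_le h]
    have := le_max_right t 0
    linarith
  · have h1 := ramp_le_self h
    have := le_max_left t 0
    rw [truncBelow]
    linarith

theorem abs_truncBelow_le {N t : ℝ} (hN : 0 ≤ N) : |truncBelow N t| ≤ |t| + 1 := by
  refine abs_le.2 ⟨?_, ?_⟩
  · have h1 := le_truncBelow N t
    have := neg_abs_le t
    linarith
  · have h1 := truncBelow_le (t := t) hN
    have : max t 0 ≤ |t| := max_le (le_abs_self t) (abs_nonneg t)
    linarith

theorem contDiff_truncBelow (N : ℝ) : ContDiff ℝ 2 (truncBelow N) := by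
  unfold truncBelow
  exact ((contDiff_ramp.comp (contDiff_id.add contDiff_const)).sub contDiff_const).add
    contDiff_const

theorem hasDerivAt_truncBelow (N t : ℝ) :
    HasDerivAt (truncBelow N) (Real.smoothTransition (t + N)) t := by
  have h := (hasDerivAt_ramp (t + N)).comp_add_const t N
  exact (h.sub_const N).add_const _

end Ramp

/-! ### A barrier for second order operators -/

section Barrier

variable {n : ℕ}

theorem ContDiffAt.continuousAt_wirtinger {F : Cn n → ℂ} {z : Cn n} (hF : ContDiffAt ℝ 1 F z)
    (j : Fin n) : ContinuousAt (wirtinger j F) z := by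
  have h : ContinuousAt (fderiv ℝ F) z :=
    (hF.fderiv_right (m := 0) (by norm_num)).continuousAt
  unfold wirtinger
  exact ((h.clm_apply continuousAt_const).sub
    (continuousAt_const.mul (h.clm_apply continuousAt_const))).div_const 2

theorem ContDiffAt.continuousAt_wirtinger_wirtingerBar {F : Cn n → ℂ} {z : Cn n}
    (hF : ContDiffAt ℝ 2 F z) (j k : Fin n) :
    ContinuousAt (wirtinger j (wirtingerBar k F)) z :=
  (hF.wirtingerBar_one k).continuousAt_wirtinger j

/-- The real pairing of a Hermitian matrix with the coefficients `T` at the point `z`. -/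
noncomputable def coeffPairing (T : Fin n → Fin n → Cn n → ℂ) (z : Cn n)
    (X : Matrix (Fin n) (Fin n) ℂ) : ℝ :=
  (∑ j, ∑ k, X j k * T j k z).re

theorem coeffPairing_add (T : Fin n → Fin n → Cn n → ℂ) (z : Cn n)
    (X Y : Matrix (Fin n) (Fin n) ℂ) :
    coeffPairing T z (X + Y) = coeffPairing T z X + coeffPairing T z Y := by
  simp only [coeffPairing, Matrix.add_apply, add_mul, Finset.sum_add_distrib, Complex.add_re]

theorem coeffPairing_smul (T : Fin n → Fin n → Cn n → ℂ) (z : Cn n) (r : ℝ)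
    (X : Matrix (Fin n) (Fin n) ℂ) :
    coeffPairing T z ((r : ℂ) • X) = r * coeffPairing T z X := by
  simp only [coeffPairing, Matrix.smul_apply, smul_eq_mul, mul_assoc, ← Finset.mul_sum,
    Complex.re_ofReal_mul]

theorem coeffPairing_leviMatrix_comp {T : Fin n → Fin n → Cn n → ℂ} {f : Cn n → ℝ} {z : Cn n}
    {κ κ' : ℝ → ℝ} {κ'' : ℝ} (hf : ContDiffAt ℝ 2 f z)
    (hκ : ∀ᶠ s in 𝓝 (f z), HasDerivAt κ (κ' s) s) (hκ' : HasDerivAt κ' κ'' (f z)) :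
    coeffPairing T z (leviMatrix (fun w => κ (f w)) z) =
      κ' (f z) * coeffPairing T z (leviMatrix f z) +
      κ'' * coeffPairing T z
        (Matrix.vecMulVec (wirtingerGrad f z) (star (wirtingerGrad f z))) := by
  rw [leviMatrix_comp hf hκ hκ', coeffPairing_add, coeffPairing_smul, coeffPairing_smul]

/-- The first order part of `adjointOp`. -/
noncomputable def adjointCross (T : Fin n → Fin n → Cn n → ℂ) (χ : Cn n → ℝ) (z : Cn n) : ℝ :=
  (∑ j, ∑ k, (wirtinger j (fun w => (χ w : ℂ)) z * wirtingerBar k (T j k) z +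
    wirtinger j (T j k) z * wirtingerBar k (fun w => (χ w : ℂ)) z)).re

/-- The zeroth order part of `adjointOp`. -/
noncomputable def adjointZero (T : Fin n → Fin n → Cn n → ℂ) (z : Cn n) : ℝ :=
  (∑ j, ∑ k, wirtinger j (wirtingerBar k (T j k)) z).re

theorem adjointOp_eq {T : Fin n → Fin n → Cn n → ℂ} {χ : Cn n → ℝ} {z : Cn n}
    (hT : ∀ j k, ContDiffAt ℝ 2 (T j k) z) (hχ : ContDiffAt ℝ 2 χ z) :
    adjointOp T χ z = coeffPairing T z (leviMatrix χ z) + adjointCross T χ z +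
      χ z * adjointZero T z := by
  rw [coeffPairing, adjointCross, adjointZero, ← Complex.re_ofReal_mul, ← Complex.add_re,
    ← Complex.add_re, adjointOp]
  congr 1
  simp only [Finset.mul_sum, ← Finset.sum_add_distrib]
  refine Finset.sum_congr rfl fun j _ => Finset.sum_congr rfl fun k _ => ?_
  rw [wirtinger_wirtingerBar_mul hχ.ofReal (hT j k)]
  simp only [leviMatrix, Matrix.of_apply]
  ring

theorem adjointCross_comp {T : Fin n → Fin n → Cn n → ℂ} {f : Cn n → ℝ} {z : Cn n} {κ : ℝ → ℝ}
    {κ' : ℝ} (hf : DifferentiableAt ℝ f z) (hκ : HasDerivAt κ κ' (f z)) :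
    adjointCross T (fun w => κ (f w)) z = κ' * adjointCross T f z := by
  rw [adjointCross, adjointCross, ← Complex.re_ofReal_mul]
  congr 1
  simp only [Finset.mul_sum]
  refine Finset.sum_congr rfl fun j _ => Finset.sum_congr rfl fun k _ => ?_
  rw [wirtinger_comp hf hκ, wirtingerBar_comp hf hκ]
  ring

theorem adjointOp_comp {T : Fin n → Fin n → Cn n → ℂ} {f : Cn n → ℝ} {z : Cn n}
    {κ κ' : ℝ → ℝ} {κ'' : ℝ} (hT : ∀ j k, ContDiffAt ℝ 2 (T j k) z) (hf : ContDiffAt ℝ 2 f z)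
    (hκ2 : ContDiffAt ℝ 2 κ (f z))
    (hκ : ∀ᶠ s in 𝓝 (f z), HasDerivAt κ (κ' s) s) (hκ' : HasDerivAt κ' κ'' (f z)) :
    adjointOp T (fun w => κ (f w)) z =
      κ' (f z) * (coeffPairing T z (leviMatrix f z) + adjointCross T f z) +
      κ'' * coeffPairing T z
        (Matrix.vecMulVec (wirtingerGrad f z) (star (wirtingerGrad f z))) +
      κ (f z) * adjointZero T z := by
  have hc : ContDiffAt ℝ 2 (fun w => κ (f w)) z := hκ2.comp z hf
  rw [adjointOp_eq hT hc, coeffPairing_leviMatrix_comp hf hκ hκ',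
    adjointCross_comp hf.differentiableAt_two hκ.self_of_nhds]
  ring

theorem continuousOn_coeffPairing {O : Set (Cn n)} {T : Fin n → Fin n → Cn n → ℂ}
    (hT : ∀ j k, ContinuousOn (T j k) O) {X : Cn n → Matrix (Fin n) (Fin n) ℂ}
    (hX : ∀ j k, ContinuousOn (fun z => X z j k) O) :
    ContinuousOn (fun z => coeffPairing T z (X z)) O :=
  Complex.continuous_re.comp_continuousOn (continuousOn_finsetSum _ fun j _ =>
    continuousOn_finsetSum _ fun k _ => (hX j k).mul (hT j k))

/-- The square of the Euclidean distance to `x`. -/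
noncomputable def sqDist (x z : Cn n) : ℝ := ∑ j, ((z j - x j).re ^ 2 + (z j - x j).im ^ 2)

theorem contDiff_sqDist (x : Cn n) {k : WithTop ℕ∞} : ContDiff ℝ k (sqDist x) := by
  unfold sqDist
  refine ContDiff.sum fun j _ => ?_
  have h : ContDiff ℝ k fun z : Cn n => z j - x j := (contDiff_apply ℝ ℂ j).sub contDiff_const
  exact ((Complex.reCLM.contDiff.comp h).pow 2).add ((Complex.imCLM.contDiff.comp h).pow 2)

theorem fderiv_sqDist (x z : Cn n) : fderiv ℝ (sqDist x) z (z - x) = 2 * sqDist x z := by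
  have h1 : HasDerivAt (fun t : ℝ => z + t • (z - x)) (z - x) 0 := by
    simpa using ((hasDerivAt_id (0 : ℝ)).smul_const (z - x)).const_add z
  have hd : HasFDerivAt (sqDist x) (fderiv ℝ (sqDist x) z) (z + (0 : ℝ) • (z - x)) := by
    rw [zero_smul, add_zero]
    exact ((contDiff_sqDist x (k := 1)).differentiable (by norm_num) z).hasFDerivAt
  have h2 := hd.comp_hasDerivAt (0 : ℝ) h1
  have h3 : (sqDist x ∘ fun t : ℝ => z + t • (z - x)) = fun t => (1 + t) ^ 2 * sqDist x z := by
    funext t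
    simp only [Function.comp, sqDist, Finset.mul_sum]
    refine Finset.sum_congr rfl fun j _ => ?_
    simp only [Pi.add_apply, Pi.smul_apply, Pi.sub_apply, Complex.sub_re, Complex.add_re,
      Complex.real_smul, Complex.re_ofReal_mul, Complex.im_ofReal_mul, Complex.sub_im,
      Complex.add_im]
    ring
  rw [h3] at h2
  have h4 : HasDerivAt (fun t : ℝ => (1 + t) ^ 2 * sqDist x z) (2 * sqDist x z) 0 := by
    have := (((hasDerivAt_id (0 : ℝ)).const_add 1).pow 2).mul_const (sqDist x z)
    simpa using this
  exact h2.unique h4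

theorem wirtingerGrad_sqDist_ne_zero {x z : Cn n} (h : sqDist x z ≠ 0) :
    wirtingerGrad (sqDist x) z ≠ 0 := by
  intro h0
  have h1 := sum_mul_wirtingerGrad
    ((contDiff_sqDist x (k := 1)).differentiable (by norm_num) z) (z - x)
  simp only [h0, Pi.zero_apply, mul_zero, Finset.sum_const_zero, fderiv_sqDist] at h1
  have h2 := congrArg Complex.re h1
  simp at h2
  exact h h2.symm

theorem norm_sub_sq_le_sqDist (x z : Cn n) : ‖z - x‖ ^ 2 ≤ sqDist x z := by
  have h0 : 0 ≤ sqDist x z := Finset.sum_nonneg fun j _ => by positivity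
  rw [← Real.sq_sqrt h0]
  refine pow_le_pow_left₀ (norm_nonneg _) ?_ 2
  refine (pi_norm_le_iff_of_nonneg (Real.sqrt_nonneg _)).2 fun j => ?_
  refine Real.le_sqrt_of_sq_le ?_
  rw [← Complex.normSq_eq_norm_sq, Complex.normSq_apply, ← sq, ← sq]
  exact Finset.single_le_sum (f := fun j => (z j - x j).re ^ 2 + (z j - x j).im ^ 2)
    (fun i _ => by positivity) (Finset.mem_univ j)

theorem sqDist_le (x z : Cn n) : sqDist x z ≤ n * ‖z - x‖ ^ 2 := by
  have : ∀ j, (z j - x j).re ^ 2 + (z j - x j).im ^ 2 ≤ ‖z - x‖ ^ 2 := fun j => by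
    have h := norm_le_pi_norm (z - x) j
    have h2 := pow_le_pow_left₀ (norm_nonneg _) h 2
    rwa [← Complex.normSq_eq_norm_sq, Complex.normSq_apply, ← sq, ← sq] at h2
  calc sqDist x z ≤ ∑ _j : Fin n, ‖z - x‖ ^ 2 := Finset.sum_le_sum fun j _ => this j
    _ = n * ‖z - x‖ ^ 2 := by simp

theorem isCompact_sqDist_le (x : Cn n) (s : ℝ) : IsCompact {z | sqDist x z ≤ s} := by
  refine (isCompact_closedBall x (Real.sqrt s)).of_isClosed_subset
    (isClosed_le (contDiff_sqDist x (k := 0)).continuous continuous_const) fun z hz => ?_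
  rw [mem_closedBall_iff_norm]
  exact Real.le_sqrt_of_sq_le ((norm_sub_sq_le_sqDist x z).trans hz)

/-- Hopf's barrier exp(-A|z-x|²) - exp(-A s₃), composed with the ramp to be C² with compact support.
For large `A` the second order term, of size `A ^ 2`, dominates the first and zeroth order terms
wherever the gradient of the squared distance is nonzero, that is, away from the centre. -/
theorem exists_barrier {O : Set (Cn n)} (hO : IsOpen O) {T : Fin n → Fin n → Cn n → ℂ}
    (hT : ∀ j k, ContDiffOn ℝ 2 (T j k) O)
    (hell : ∀ z ∈ O, ∀ v : Fin n → ℂ, v ≠ 0 →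
      0 < coeffPairing T z (Matrix.vecMulVec v (star v)))
    {x : Cn n} {s₁ s₂ s₃ : ℝ} (h₁ : 0 < s₁) (h₂₃ : s₂ < s₃) (hs : {z | sqDist x z ≤ s₃} ⊆ O) :
    ∃ χ : Cn n → ℝ, ContDiff ℝ 2 χ ∧ HasCompactSupport χ ∧ tsupport χ ⊆ {z | sqDist x z ≤ s₃} ∧
      (∀ z, 0 ≤ χ z) ∧ (∀ z, s₁ ≤ sqDist x z → 0 ≤ adjointOp T χ z) ∧
      ∃ c > 0, ∀ z, s₁ ≤ sqDist x z → sqDist x z ≤ s₂ → c ≤ adjointOp T χ z := by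
  have hqc : Continuous (sqDist x) := (contDiff_sqDist x (k := 0)).continuous
  have hq : ∀ z, ContDiffAt ℝ 2 (sqDist x) z := fun z => (contDiff_sqDist x).contDiffAt
  have hTa : ∀ z ∈ O, ∀ j k, ContDiffAt ℝ 2 (T j k) z := fun z hz j k =>
    (hT j k).contDiffAt (hO.mem_nhds hz)
  set K : Set (Cn n) := {z | sqDist x z ≤ s₃} ∩ {z | s₁ ≤ sqDist x z} with hK
  have hKc : IsCompact K := (isCompact_sqDist_le x s₃).inter_right
    (isClosed_le continuous_const hqc)
  have hKO : K ⊆ O := inter_subset_left.trans hs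
  have hTc : ∀ j k, ContinuousOn (T j k) O := fun j k => (hT j k).continuousOn
  have hgc : ∀ j, Continuous fun z => wirtingerGrad (sqDist x) z j := fun j =>
    continuous_iff_continuousAt.2 fun z => ((hq z).ofReal.wirtinger_one j).continuousAt
  have hac : ContinuousOn (fun z => coeffPairing T z (Matrix.vecMulVec
      (wirtingerGrad (sqDist x) z) (star (wirtingerGrad (sqDist x) z)))) O :=
    continuousOn_coeffPairing hTc fun j k =>
      ((hgc j).mul (continuous_star.comp (hgc k))).continuousOn
  have hbc : ContinuousOn (fun z => coeffPairing T z (leviMatrix (sqDist x) z) +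
      adjointCross T (sqDist x) z) O := by
    refine (continuousOn_coeffPairing hTc fun j k z _ =>
      ((hq z).ofReal.continuousAt_wirtinger_wirtingerBar j k).continuousWithinAt).add ?_
    refine Complex.continuous_re.comp_continuousOn (continuousOn_finsetSum _ fun j _ =>
      continuousOn_finsetSum _ fun k _ => fun z hz => ?_)
    exact ((((hq z).ofReal.wirtinger_one j).continuousAt.mul
      ((hTa z hz j k).wirtingerBar_one k).continuousAt).add
      (((hTa z hz j k).wirtinger_one j).continuousAt.mul
      ((hq z).ofReal.wirtingerBar_one k).continuousAt)).continuousWithinAt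
  have hdc : ContinuousOn (adjointZero T) O :=
    Complex.continuous_re.comp_continuousOn (continuousOn_finsetSum _ fun j _ =>
      continuousOn_finsetSum _ fun k _ => fun z hz =>
        ((hTa z hz j k).continuousAt_wirtinger_wirtingerBar j k).continuousWithinAt)
  obtain ⟨a₀, ha₀, ha⟩ := hKc.exists_forall_le' (hac.mono hKO) (a := 0) fun z hz =>
    hell z (hKO hz) _ (wirtingerGrad_sqDist_ne_zero (h₁.trans_le hz.2).ne')
  obtain ⟨b₀, hb⟩ := hKc.exists_bound_of_continuousOn (hbc.mono hKO)
  obtain ⟨d₀, hd⟩ := hKc.exists_bound_of_continuousOn (hdc.mono hKO)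
  set B := max b₀ 0
  set D := max d₀ 0
  have hB0 : 0 ≤ B := le_max_right _ _
  have hD0 : 0 ≤ D := le_max_right _ _
  -- Then `A * a₀ = a₀ + B + D + 1`, and `A ≥ 1` gives `hAa`: ellipticity beats the lower order
  -- bounds `B` and `D` with a margin of 1.
  set A : ℝ := 1 + (B + D + 1) / a₀ with hA
  have hA1 : 1 ≤ A := by
    have : 0 ≤ (B + D + 1) / a₀ := by positivity
    linarith
  have hAa : A * B + D + 1 ≤ A ^ 2 * a₀ := by
    have e : A ^ 2 * a₀ = A * (a₀ + B + D + 1) := by rw [hA]; field_simp; ring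
    rw [e]
    nlinarith
  let w : ℝ → ℝ := fun t => Real.exp (-A * t) - Real.exp (-A * s₃)
  let κ : ℝ → ℝ := fun t => ramp (w t)
  let κ' : ℝ → ℝ := fun t => Real.smoothTransition (w t) * (Real.exp (-A * t) * -A)
  let κ'' : ℝ → ℝ := fun t =>
    deriv Real.smoothTransition (w t) * (Real.exp (-A * t) * -A) * (Real.exp (-A * t) * -A) +
      Real.smoothTransition (w t) * (Real.exp (-A * t) * -A * -A)
  have hE : ∀ t, HasDerivAt (fun t => Real.exp (-A * t)) (Real.exp (-A * t) * -A) t := fun t => by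
    simpa using ((hasDerivAt_id t).const_mul (-A)).exp
  have hw : ∀ t, HasDerivAt w (Real.exp (-A * t) * -A) t := fun t => (hE t).sub_const _
  have hκ : ∀ t, HasDerivAt κ (κ' t) t := fun t => (hasDerivAt_ramp (w t)).comp t (hw t)
  have hκ' : ∀ t, HasDerivAt κ' (κ'' t) t := fun t =>
    ((hasDerivAt_smoothTransition (w t)).comp t (hw t)).mul ((hE t).mul_const (-A))
  have hw2 : ContDiff ℝ 2 w :=
    ((contDiff_const.mul contDiff_id).exp).sub contDiff_const
  have hκ2 : ContDiff ℝ 2 κ := contDiff_ramp.comp hw2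
  let χ : Cn n → ℝ := fun z => κ (sqDist x z)
  have hwneg : ∀ t, s₃ ≤ t → w t ≤ 0 := fun t ht => by
    have : Real.exp (-A * t) ≤ Real.exp (-A * s₃) := Real.exp_le_exp.2 (by nlinarith)
    simp only [w]; linarith
  have hsupp : tsupport χ ⊆ {z | sqDist x z ≤ s₃} := by
    refine closure_minimal (fun z hz => ?_) (isClosed_le hqc continuous_const)
    by_contra hlt
    exact hz (ramp_of_nonpos (hwneg _ (not_le.1 hlt).le))
  have hmain : ∀ z ∈ K, Real.smoothTransition (w (sqDist x z)) * Real.exp (-A * sqDist x z) ≤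
      adjointOp T χ z := by
    intro z hz
    have hzO := hKO hz
    rw [adjointOp_comp (κ' := κ') (hTa z hzO) (hq z) hκ2.contDiffAt (Eventually.of_forall hκ)
      (hκ' _)]
    have h1 := ha z hz
    have h2 := (hb z hz).trans (le_max_left b₀ 0)
    have h3 := (hd z hz).trans (le_max_left d₀ 0)
    rw [Real.norm_eq_abs] at h2 h3
    set t := sqDist x z
    set α := coeffPairing T z (Matrix.vecMulVec
      (wirtingerGrad (sqDist x) z) (star (wirtingerGrad (sqDist x) z)))
    set β := coeffPairing T z (leviMatrix (sqDist x) z) + adjointCross T (sqDist x) z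
    set d := adjointZero T z
    have hw0 : 0 ≤ w t := by
      have : Real.exp (-A * s₃) ≤ Real.exp (-A * t) :=
        Real.exp_le_exp.2 (by have : t ≤ s₃ := hz.1; nlinarith)
      simp only [w]; linarith
    set S := Real.smoothTransition (w t)
    set E := Real.exp (-A * t)
    have hE0 : 0 < E := Real.exp_pos _
    have hS0 : 0 ≤ S := Real.smoothTransition.nonneg _
    have hwE : w t ≤ E := by
      have := Real.exp_pos (-A * s₃)
      simp only [w]; linarith
    -- The zeroth order term carries the same factor `S * E` as the good term, so it is absorbed
    -- even near the outer sphere where the barrier vanishes.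
    have hκS : κ t ≤ S * E := by
      refine (ramp_le_mul hw0).trans ?_
      rw [mul_comm]
      exact mul_le_mul_of_nonneg_left hwE hS0
    have hκ0 : 0 ≤ κ t := ramp_nonneg _
    have hS1 : 0 ≤ deriv Real.smoothTransition (w t) := deriv_smoothTransition_nonneg _
    have hSE : 0 ≤ S * E := by positivity
    have t1 : -(S * E * (A * B)) ≤ κ' t * β := by
      have : κ' t * β = -(S * E * (A * β)) := by simp only [κ', S, E]; ring
      rw [this, neg_le_neg_iff]
      gcongr
      exact (le_abs_self β).trans h2
    have t2 : S * E * (A ^ 2 * a₀) ≤ κ'' t * α := by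
      have : κ'' t * α = deriv Real.smoothTransition (w t) * (E * A) ^ 2 * α +
          S * E * (A ^ 2 * α) := by
        simp only [κ'', S, E]; ring
      rw [this]
      have p1 : 0 ≤ deriv Real.smoothTransition (w t) * (E * A) ^ 2 * α :=
        mul_nonneg (by positivity) (ha₀.le.trans h1)
      have p2 : S * E * (A ^ 2 * a₀) ≤ S * E * (A ^ 2 * α) := by gcongr
      linarith
    have t3 : -(S * E * D) ≤ κ t * d := by
      have p1 : -D ≤ d := (neg_le_neg h3).trans (neg_abs_le d)
      nlinarith [mul_le_mul_of_nonneg_left p1 hκ0, mul_le_mul_of_nonneg_right hκS hD0]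
    have t4 := mul_le_mul_of_nonneg_left hAa hSE
    nlinarith
  refine ⟨χ, hκ2.comp (contDiff_sqDist x), (isCompact_sqDist_le x s₃).of_isClosed_subset
    (isClosed_tsupport _) hsupp, hsupp, fun z => ramp_nonneg _, fun z hz => ?_,
    Real.smoothTransition (w s₂) * Real.exp (-A * s₃), ?_, fun z hz hz2 => ?_⟩
  · by_cases hzs : sqDist x z ≤ s₃
    · exact (mul_nonneg (Real.smoothTransition.nonneg _) (Real.exp_pos _).le).trans
        (hmain z ⟨hzs, hz⟩)
    · rw [adjointOp_eq_zero fun h => hzs (hsupp h)]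
  · refine mul_pos (Real.smoothTransition.pos_of_pos ?_) (Real.exp_pos _)
    have : Real.exp (-A * s₃) < Real.exp (-A * s₂) := Real.exp_lt_exp.2 (by nlinarith)
    simp only [w]; linarith
  · refine le_trans ?_ (hmain z ⟨hz2.trans h₂₃.le, hz⟩)
    refine mul_le_mul (Real.smoothTransition.monotone ?_) (Real.exp_le_exp.2 ?_)
      (Real.exp_pos _).le (Real.smoothTransition.nonneg _)
    · have : Real.exp (-A * s₂) ≤ Real.exp (-A * sqDist x z) := Real.exp_le_exp.2 (by nlinarith)
      simp only [w]; linarith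
    · nlinarith

end Barrier

/-! ### Subsolutions with poles -/

section Poles

variable {n : ℕ}

/-- `u` is a subsolution of class `C²` off a null set `Z`, and tends to `-∞` at the points
of `Z`. -/
structure IsSubsolutionWithPoles (T : Fin n → Fin n → Cn n → ℂ) (O Z : Set (Cn n))
    (u : Cn n → ℝ) : Prop where
  isOpen_diff : IsOpen (O \ Z)
  null : volume Z = 0
  contDiffOn : ContDiffOn ℝ 2 u (O \ Z)
  tendsto_atBot : ∀ z ∈ O ∩ Z, Tendsto u (𝓝[O \ Z] z) atBot
  levi_nonneg : ∀ z ∈ O \ Z, 0 ≤ coeffPairing T z (leviMatrix u z)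

open Classical in
/-- The smooth truncation of a function with poles along `Z`. -/
noncomputable def truncExt (Z : Set (Cn n)) (u : Cn n → ℝ) (N : ℝ) (z : Cn n) : ℝ :=
  if z ∈ Z then -N + (1 - ramp 1) else truncBelow N (u z)

theorem truncExt_of_mem {Z : Set (Cn n)} {z : Cn n} (hz : z ∈ Z) (u : Cn n → ℝ) (N : ℝ) :
    truncExt Z u N z = -N + (1 - ramp 1) := if_pos hz

theorem truncExt_of_notMem {Z : Set (Cn n)} {z : Cn n} (hz : z ∉ Z) (u : Cn n → ℝ) (N : ℝ) :
    truncExt Z u N z = truncBelow N (u z) := if_neg hz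

theorem tendsto_truncExt {Z : Set (Cn n)} {z : Cn n} (hz : z ∉ Z) (u : Cn n → ℝ) :
    Tendsto (fun N : ℕ => truncExt Z u N z) atTop (𝓝 (u z)) := by
  refine tendsto_const_nhds.congr' ?_
  obtain ⟨k, hk⟩ := exists_nat_ge (1 - u z)
  filter_upwards [eventually_ge_atTop k] with N hN
  rw [truncExt_of_notMem hz, truncBelow_eq]
  have : (k : ℝ) ≤ N := by exact_mod_cast hN
  linarith

variable {T : Fin n → Fin n → Cn n → ℂ} {O Z : Set (Cn n)} {u : Cn n → ℝ}

/-- Near a pole `u ≤ -N`, where the truncation is constant and agrees with the value assigned on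
`Z`. Hence it is C² across `Z` whatever the shape of `Z`. -/
theorem IsSubsolutionWithPoles.truncExt_eventuallyEq_of_mem (hu : IsSubsolutionWithPoles T O Z u)
    (hO : IsOpen O) {z : Cn n} (hz : z ∈ O ∩ Z) (N : ℝ) :
    truncExt Z u N =ᶠ[𝓝 z] fun _ => -N + (1 - ramp 1) := by
  have h := (hu.tendsto_atBot z hz).eventually (eventually_le_atBot (-N))
  rw [eventually_nhdsWithin_iff] at h
  filter_upwards [h, hO.mem_nhds hz.1] with w hw hwO
  by_cases hwZ : w ∈ Z
  · exact truncExt_of_mem hwZ u N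
  · rw [truncExt_of_notMem hwZ, truncBelow_of_le]
    have := hw ⟨hwO, hwZ⟩
    linarith

theorem IsSubsolutionWithPoles.truncExt_eventuallyEq_of_notMem
    (hu : IsSubsolutionWithPoles T O Z u) {z : Cn n} (hz : z ∈ O \ Z) (N : ℝ) :
    truncExt Z u N =ᶠ[𝓝 z] fun w => truncBelow N (u w) := by
  filter_upwards [hu.isOpen_diff.mem_nhds hz] with w hw
  exact truncExt_of_notMem hw.2 u N

theorem IsSubsolutionWithPoles.contDiffAt (hu : IsSubsolutionWithPoles T O Z u) {z : Cn n}
    (hz : z ∈ O \ Z) : ContDiffAt ℝ 2 u z :=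
  hu.contDiffOn.contDiffAt (hu.isOpen_diff.mem_nhds hz)

theorem IsSubsolutionWithPoles.contDiffOn_truncExt (hu : IsSubsolutionWithPoles T O Z u)
    (hO : IsOpen O) (N : ℝ) : ContDiffOn ℝ 2 (truncExt Z u N) O := by
  intro z hz
  refine ContDiffAt.contDiffWithinAt ?_
  by_cases hzZ : z ∈ Z
  · exact contDiffAt_const.congr_of_eventuallyEq
      (hu.truncExt_eventuallyEq_of_mem hO ⟨hz, hzZ⟩ N)
  · exact ((contDiff_truncBelow N).contDiffAt.comp z
      (hu.contDiffAt ⟨hz, hzZ⟩)).congr_of_eventuallyEq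
      (hu.truncExt_eventuallyEq_of_notMem ⟨hz, hzZ⟩ N)

theorem IsSubsolutionWithPoles.levi_truncExt_nonneg (hu : IsSubsolutionWithPoles T O Z u)
    (hO : IsOpen O)
    (hT : ∀ z ∈ O, ∀ v : Fin n → ℂ, 0 ≤ coeffPairing T z (Matrix.vecMulVec v (star v)))
    {z : Cn n} (hz : z ∈ O) (N : ℝ) :
    0 ≤ coeffPairing T z (leviMatrix (truncExt Z u N) z) := by
  by_cases hzZ : z ∈ Z
  · rw [(hu.truncExt_eventuallyEq_of_mem hO ⟨hz, hzZ⟩ N).leviMatrix.eq_of_nhds, leviMatrix_const]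
    simp [coeffPairing]
  · rw [(hu.truncExt_eventuallyEq_of_notMem ⟨hz, hzZ⟩ N).leviMatrix.eq_of_nhds,
      coeffPairing_leviMatrix_comp (hu.contDiffAt ⟨hz, hzZ⟩)
        (Eventually.of_forall fun s => hasDerivAt_truncBelow N s)
        ((hasDerivAt_smoothTransition (u z + N)).comp_add_const (u z) N)]
    exact add_nonneg (mul_nonneg (Real.smoothTransition.nonneg _) (hu.levi_nonneg z ⟨hz, hzZ⟩))
      (mul_nonneg (deriv_smoothTransition_nonneg _) (hT z hz _))

theorem IsSubsolutionWithPoles.ae_notMem (hu : IsSubsolutionWithPoles T O Z u) :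
    ∀ᵐ z, z ∉ Z := by
  rw [ae_iff]
  simpa using hu.null

/-- The truncations are C² subsolutions, for which integration by parts is classical. They converge
to `u` off the null set `Z` and are dominated by `|u| + 1`. -/
theorem IsSubsolutionWithPoles.integral_mul_adjointOp_nonneg
    (hu : IsSubsolutionWithPoles T O Z u) (hO : IsOpen O)
    (hTc : ∀ j k, ContDiffOn ℝ 2 (T j k) O)
    (hT : ∀ z ∈ O, ∀ v : Fin n → ℂ, 0 ≤ coeffPairing T z (Matrix.vecMulVec v (star v)))
    (hloc : LocallyIntegrableOn u O) {χ : Cn n → ℝ} (hχ : ContDiff ℝ 2 χ)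
    (hc : HasCompactSupport χ) (hs : tsupport χ ⊆ O) (hχ0 : ∀ z, 0 ≤ χ z) :
    0 ≤ ∫ z, u z * adjointOp T χ z := by
  set K := tsupport χ
  have hac := continuous_adjointOp hO hTc hχ hs
  have hK0 : ∀ v : Cn n → ℝ, ∫ z, v z * adjointOp T χ z = ∫ z in K, v z * adjointOp T χ z :=
    fun v => (setIntegral_eq_integral_of_forall_compl_eq_zero fun z hz => by
      rw [adjointOp_eq_zero hz, mul_zero]).symm
  have hN : ∀ N : ℕ, 0 ≤ ∫ z in K, truncExt Z u N z * adjointOp T χ z := by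
    intro N
    rw [← hK0, integral_mul_adjointOp hO hTc (hu.contDiffOn_truncExt hO N) hχ hc hs]
    refine integral_nonneg fun z => ?_
    by_cases hz : z ∈ K
    · exact mul_nonneg (hχ0 z) (hu.levi_truncExt_nonneg hO hT (hs hz) N)
    · simp [image_eq_zero_of_notMem_tsupport hz]
  have hinteg : IntegrableOn u K := hloc.integrableOn_compact_subset hs hc
  have hb : IntegrableOn (fun z => (|u z| + 1) * |adjointOp T χ z|) K :=
    IntegrableOn.mul_continuousOn (hinteg.abs.add (integrableOn_const (by
      exact hc.measure_lt_top.ne))) hac.abs.continuousOn hc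
  have hmeas : ∀ N : ℕ, AEStronglyMeasurable (fun z => truncExt Z u N z * adjointOp T χ z)
      (volume.restrict K) := fun N =>
    (((hu.contDiffOn_truncExt hO N).continuousOn.mono hs).aestronglyMeasurable_of_isCompact hc
      hc.measurableSet).mul hac.aestronglyMeasurable
  have hlim := tendsto_integral_of_dominated_convergence _ hmeas hb
    (f := fun z => u z * adjointOp T χ z)
    (fun N => by
      filter_upwards [ae_restrict_of_ae hu.ae_notMem] with z hz
      rw [norm_mul, Real.norm_eq_abs, Real.norm_eq_abs, truncExt_of_notMem hz]
      gcongr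
      exact abs_truncBelow_le N.cast_nonneg)
    (by
      filter_upwards [ae_restrict_of_ae hu.ae_notMem] with z hz
      exact (tendsto_truncExt hz u).mul_const _)
  rw [hK0]
  exact ge_of_tendsto' hlim hN

/-- Centre a barrier at a point near `z₀` around which `u` is bounded. Testing the nonnegative
supersolutions `S - truncExt Z u N` against it, the bounded contribution of the inner ball controls
their integral over the shell, uniformly in `N`. Fatou's lemma then gives integrability of `u` on a
neighbourhood of `z₀`. -/
theorem IsSubsolutionWithPoles.locallyIntegrableOn
    (hu : IsSubsolutionWithPoles T O Z u) (hO : IsOpen O)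
    (hTc : ∀ j k, ContDiffOn ℝ 2 (T j k) O)
    (hell : ∀ z ∈ O, ∀ v : Fin n → ℂ, v ≠ 0 →
      0 < coeffPairing T z (Matrix.vecMulVec v (star v))) :
    LocallyIntegrableOn u O := by
  have hT : ∀ z ∈ O, ∀ v : Fin n → ℂ, 0 ≤ coeffPairing T z (Matrix.vecMulVec v (star v)) := by
    intro z hz v
    by_cases hv : v = 0
    · simp [hv, coeffPairing, Matrix.vecMulVec]
    · exact (hell z hz v hv).le
  intro z₀ hz₀
  obtain ⟨R, hR, hRO⟩ := Metric.nhds_basis_closedBall.mem_iff.1 (hO.mem_nhds hz₀)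
  -- the centre of the barrier
  have hη : ∃ η > 0, η < R / 2 ∧ (n : ℝ) * η ^ 2 < (R / 2) ^ 2 / 2 := by
    have h1 : Tendsto (fun η : ℝ => (n : ℝ) * η ^ 2) (𝓝[>] 0) (𝓝 ((n : ℝ) * 0 ^ 2)) :=
      (Continuous.tendsto (by fun_prop) 0).mono_left nhdsWithin_le_nhds
    have h2 : ∀ᶠ η : ℝ in 𝓝[>] 0, (n : ℝ) * η ^ 2 < (R / 2) ^ 2 / 2 :=
      h1.eventually_lt_const (by rw [zero_pow two_ne_zero, mul_zero]; positivity)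
    have h3 : ∀ᶠ η : ℝ in 𝓝[>] 0, η < R / 2 :=
      nhdsWithin_le_nhds (Iio_mem_nhds (half_pos hR))
    obtain ⟨η, ⟨h4, h5⟩, h6⟩ := ((h2.and h3).and self_mem_nhdsWithin).exists
    exact ⟨η, h6, h5, h4⟩
  obtain ⟨η, hη0, hηR, hηn⟩ := hη
  obtain ⟨x, hxη, hxZ⟩ : ∃ x ∈ Metric.ball z₀ η, x ∉ Z := by
    have hd : Dense Zᶜ := by
      rw [← interior_eq_empty_iff_dense_compl]
      by_contra hne
      exact (isOpen_interior.measure_pos volume (nonempty_iff_ne_empty.2 hne)).ne'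
        (measure_mono_null interior_subset hu.null)
    obtain ⟨x, hx1, hx2⟩ := hd.exists_mem_open Metric.isOpen_ball ⟨z₀, Metric.mem_ball_self hη0⟩
    exact ⟨x, hx2, hx1⟩
  rw [mem_ball_iff_norm] at hxη
  have hxO : x ∈ O := hRO (by rw [mem_closedBall_iff_norm]; linarith)
  obtain ⟨r, hr, hrU⟩ := Metric.isOpen_iff.1 hu.isOpen_diff x ⟨hxO, hxZ⟩
  set s₃ : ℝ := (R / 2) ^ 2 with hs₃
  have hs₃0 : 0 < s₃ := by positivity
  -- By the choice of `η`, `sqDist x z₀ ≤ n * η ^ 2 < s₂`, so the set where `sqDist x` is at most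
  -- `s₂` is a neighbourhood of `z₀`.
  set s₂ : ℝ := s₃ / 2 with hs₂
  set s₁ : ℝ := min (r ^ 2 / 2) s₂ with hs₁
  have hs₁0 : 0 < s₁ := lt_min (by positivity) (by positivity)
  have h₂₃ : s₂ < s₃ := half_lt_self hs₃0
  have hB₃ : {z | sqDist x z ≤ s₃} ⊆ O := fun z hz => hRO (by
    have h1 : ‖z - x‖ ^ 2 ≤ (R / 2) ^ 2 := (norm_sub_sq_le_sqDist x z).trans hz
    have h2 := abs_le_of_sq_le_sq h1 (half_pos hR).le
    rw [mem_closedBall_iff_norm]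
    calc ‖z - z₀‖ = ‖(z - x) + (x - z₀)‖ := by rw [sub_add_sub_cancel]
      _ ≤ ‖z - x‖ + ‖x - z₀‖ := norm_add_le _ _
      _ ≤ R := by linarith [le_abs_self ‖z - x‖])
  have hB₁ : {z | sqDist x z ≤ s₁} ⊆ O \ Z := fun z hz => hrU (by
    have h1 : ‖z - x‖ ^ 2 < r ^ 2 := by
      have h2 := (norm_sub_sq_le_sqDist x z).trans (le_trans hz (min_le_left _ _))
      have : 0 < r ^ 2 := by positivity
      linarith
    rw [mem_ball_iff_norm]
    exact lt_of_pow_lt_pow_left₀ 2 hr.le h1)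
  obtain ⟨χ, hχ, hc, hs, hχ0, hpos, c, hc0, hcb⟩ := exists_barrier hO hTc hell hs₁0 h₂₃ hB₃
  set a := adjointOp T χ with ha
  have hac : Continuous a := continuous_adjointOp hO hTc hχ (hs.trans hB₃)
  have hqc : Continuous (sqDist x) := (contDiff_sqDist x (k := 0)).continuous
  have hK₁ : IsCompact {z | sqDist x z ≤ s₁} := isCompact_sqDist_le x s₁
  obtain ⟨b, hb⟩ := hK₁.exists_bound_of_continuousOn hac.continuousOn
  obtain ⟨L, hL⟩ := hK₁.exists_bound_of_continuousOn (hu.contDiffOn.continuousOn.mono hB₁)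
  have hvc : ∀ N : ℝ, ContinuousOn (truncExt Z u N) O := fun N =>
    (hu.contDiffOn_truncExt hO N).continuousOn
  -- The truncation at level 0 is continuous across the poles and majorizes `u` off them, so it
  -- gives an upper bound for all truncations at once.
  obtain ⟨S₀, hS₀⟩ := (isCompact_sqDist_le x s₃).exists_bound_of_continuousOn ((hvc 0).mono hB₃)
  set S : ℝ := max S₀ 0 + 1 with hS
  have hvS : ∀ N : ℕ, ∀ z, sqDist x z ≤ s₃ → truncExt Z u N z ≤ S := by
    intro N z hz
    by_cases hzZ : z ∈ Z
    · rw [truncExt_of_mem hzZ]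
      have h1 : (0 : ℝ) ≤ N := N.cast_nonneg
      have h2 := ramp_nonneg 1
      have h3 := le_max_right S₀ 0
      linarith
    · rw [truncExt_of_notMem hzZ]
      refine (truncBelow_le N.cast_nonneg).trans ?_
      have h1 := le_of_abs_le (hS₀ z hz)
      rw [truncExt_of_notMem hzZ] at h1
      have h2 := (le_truncBelow 0 (u z)).trans h1
      rw [hS]
      gcongr
  set A : Set (Cn n) := {z | s₁ ≤ sqDist x z} ∩ {z | sqDist x z ≤ s₂} with hA
  have hAc : IsCompact A := (isCompact_sqDist_le x s₂).inter_left (isClosed_le continuous_const hqc)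
  have hAO : A ⊆ O := fun z hz => hB₃ (le_trans hz.2 h₂₃.le)
  set b' : ℝ := (S + L + 1) * b
  -- the uniform bound on the truncations
  have hbound : ∀ N : ℕ, ∫ z in A, (S - truncExt Z u N z) ≤
      b' * volume.real {z | sqDist x z ≤ s₁} / c := by
    intro N
    set v : Cn n → ℝ := fun z => S - truncExt Z u N z with hv
    have hvC : ContDiffOn ℝ 2 v O := contDiffOn_const.sub (hu.contDiffOn_truncExt hO N)
    have h1 : ∫ z, v z * a z ≤ 0 := by
      rw [ha, integral_mul_adjointOp hO hTc hvC hχ hc (hs.trans hB₃)]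
      refine integral_nonpos fun z => ?_
      by_cases hz : z ∈ tsupport χ
      · have hzO := hB₃ (hs hz)
        refine mul_nonpos_of_nonneg_of_nonpos (hχ0 z) ?_
        have h2 := coeffPairing_leviMatrix_comp (T := T) (κ := fun t => S - t) (κ' := fun _ => -1)
          (κ'' := 0) ((hu.contDiffOn_truncExt hO N).contDiffAt (hO.mem_nhds hzO))
          (Eventually.of_forall fun s => (hasDerivAt_id s).const_sub S) (hasDerivAt_const _ _)
        have h3 := hu.levi_truncExt_nonneg hO hT hzO N
        change coeffPairing T z (leviMatrix v z) ≤ 0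
        rw [h2]
        linarith
      · simp [image_eq_zero_of_notMem_tsupport hz]
    have hva : Integrable fun z => v z * a z := by
      have h2 : Integrable fun z => ((v z : ℝ) : ℂ) * ((a z : ℝ) : ℂ) := by
        have hts : tsupport (fun z => ((a z : ℝ) : ℂ)) ⊆ {z | sqDist x z ≤ s₃} := by
          rw [tsupport_ofReal_comp]
          refine closure_minimal (fun z hz => ?_) (isClosed_le hqc continuous_const)
          by_contra h
          exact hz (adjointOp_eq_zero fun h' => h (hs h'))
        exact (Complex.continuous_ofReal.comp_continuousOn
          hvC.continuousOn).integrable_mul_of_tsupport_subset hO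
          (Complex.continuous_ofReal.comp hac)
          ((isCompact_sqDist_le x s₃).of_isClosed_subset (isClosed_tsupport _) hts)
          (hts.trans hB₃)
      simpa using h2.re
    have hvA : IntegrableOn v A := (hvC.continuousOn.mono hAO).integrableOn_compact hAc
    -- On the inner ball the barrier has no sign, but the loss is at most `b'`; on the shell the
    -- gain is `c * v`; outside the integrand is nonnegative.
    have hpt : ∀ z, A.indicator (fun z => c * v z) z -
        {z | sqDist x z ≤ s₁}.indicator (fun _ => b') z ≤ v z * a z := by
      intro z
      have hv0 : sqDist x z ≤ s₃ → 0 ≤ v z := fun h => sub_nonneg.2 (hvS N z h)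
      by_cases hz1 : s₁ < sqDist x z
      · rw [indicator_of_notMem (s := {z | sqDist x z ≤ s₁}) (by simpa using hz1), sub_zero]
        by_cases hz2 : sqDist x z ≤ s₂
        · rw [indicator_of_mem (show z ∈ A from ⟨hz1.le, hz2⟩), mul_comm]
          exact mul_le_mul_of_nonneg_left (hcb z hz1.le hz2) (hv0 (hz2.trans h₂₃.le))
        · rw [indicator_of_notMem fun h : z ∈ A => hz2 h.2]
          by_cases hz3 : sqDist x z ≤ s₃
          · exact mul_nonneg (hv0 hz3) (hpos z hz1.le)
          · rw [ha, adjointOp_eq_zero fun h => hz3 (hs h), mul_zero]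
      · have hz1' : sqDist x z ≤ s₁ := not_lt.1 hz1
        have hz2 : sqDist x z ≤ s₂ := hz1'.trans (min_le_right _ _)
        have hv1 := hv0 (hz2.trans h₂₃.le)
        rw [indicator_of_mem (s := {z | sqDist x z ≤ s₁}) hz1']
        have hab := abs_le.1 (hb z hz1')
        have hvb : v z ≤ S + L + 1 := by
          have h2 := (abs_truncBelow_le (t := u z) (N := N) N.cast_nonneg).trans
            (add_le_add_left (hL z hz1') 1)
          simp only [hv]
          rw [truncExt_of_notMem (hB₁ hz1').2]
          linarith [(abs_le.1 h2).1]
        have hb0 : 0 ≤ b := (abs_nonneg _).trans (hb z hz1')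
        have h5 : -b' ≤ v z * a z := by
          have h6 : v z * -b ≤ v z * a z := mul_le_mul_of_nonneg_left hab.1 hv1
          have h7 : v z * b ≤ b' := mul_le_mul_of_nonneg_right hvb hb0
          linarith
        by_cases hzA : z ∈ A
        · rw [indicator_of_mem hzA]
          have hz5 := mul_le_mul_of_nonneg_left (hcb z hzA.1 hz2) hv1
          have : 0 ≤ b' := (mul_nonneg hv1 hb0).trans (mul_le_mul_of_nonneg_right hvb hb0)
          linarith
        · rw [indicator_of_notMem hzA]
          linarith
    have i1 : Integrable (A.indicator fun z => c * v z) :=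
      (integrable_indicator_iff hAc.measurableSet).2 (hvA.const_mul c)
    have i2 : Integrable ({z | sqDist x z ≤ s₁}.indicator fun _ => b') :=
      (integrable_indicator_iff hK₁.measurableSet).2 (integrableOn_const hK₁.measure_lt_top.ne)
    have h2 := integral_mono (i1.sub i2) hva hpt
    simp only [Pi.sub_apply] at h2
    rw [integral_sub i1 i2, integral_indicator hAc.measurableSet,
      integral_indicator hK₁.measurableSet, integral_const_mul, setIntegral_const,
      smul_eq_mul] at h2
    rw [le_div_iff₀ hc0]
    linarith
  -- Fatou's lemma
  have hSA : IntegrableOn (fun z => S - u z) A := by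
    have hlim : ∀ᵐ z ∂(volume.restrict A),
        Tendsto (fun N : ℕ => S - truncExt Z u N z) atTop (𝓝 (S - u z)) := by
      filter_upwards [ae_restrict_of_ae hu.ae_notMem] with z hz
      exact tendsto_const_nhds.sub (tendsto_truncExt hz u)
    have hvA : ∀ N : ℕ, IntegrableOn (fun z => S - truncExt Z u N z) A := fun N =>
      (continuousOn_const.sub ((hvc N).mono hAO)).integrableOn_compact hAc
    refine ⟨aestronglyMeasurable_of_tendsto_ae _ (fun N => (hvA N).aestronglyMeasurable) hlim, ?_⟩
    have h1 : ∫⁻ z in A, ‖S - u z‖ₑ ≤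
        liminf (fun N : ℕ => ∫⁻ z in A, ‖S - truncExt Z u N z‖ₑ) atTop :=
      lintegral_congr_ae (by filter_upwards [hlim] with z hz using hz.enorm.liminf_eq) ▸
        lintegral_liminf_le' fun N => (hvA N).aestronglyMeasurable.aemeasurable.enorm
    refine lt_of_le_of_lt h1 ?_
    have h2 : ∀ N : ℕ, ∫⁻ z in A, ‖S - truncExt Z u N z‖ₑ ≤
        ENNReal.ofReal (b' * volume.real {z | sqDist x z ≤ s₁} / c) := by
      intro N
      have h3 : ∀ᵐ z ∂(volume.restrict A), 0 ≤ S - truncExt Z u N z := by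
        filter_upwards [ae_restrict_mem hAc.measurableSet] with z hz
        exact sub_nonneg.2 (hvS N z (le_trans hz.2 h₂₃.le))
      rw [lintegral_congr_ae (g := fun z => ENNReal.ofReal (S - truncExt Z u N z)) (by
        filter_upwards [h3] with z hz
        rw [Real.enorm_eq_ofReal hz]), ← ofReal_integral_eq_lintegral_ofReal (hvA N) h3]
      exact ENNReal.ofReal_le_ofReal (hbound N)
    refine lt_of_le_of_lt (liminf_le_liminf (Eventually.of_forall h2)) ?_
    rw [liminf_const]
    exact ENNReal.ofReal_lt_top
  have huA : IntegrableOn u A := by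
    exact ((integrableOn_const (C := S) hAc.measure_lt_top.ne).sub hSA).congr_fun
      (fun z _ => sub_sub_cancel S (u z)) hAc.measurableSet
  have hu₁ : IntegrableOn u {z | sqDist x z ≤ s₁} :=
    (hu.contDiffOn.continuousOn.mono hB₁).integrableOn_compact hK₁
  refine ⟨{z | sqDist x z ≤ s₂}, mem_nhdsWithin_of_mem_nhds ?_, ?_⟩
  · refine mem_of_superset ((isOpen_lt hqc continuous_const).mem_nhds ?_) fun z hz =>
      show sqDist x z ≤ s₂ from le_of_lt hz
    refine lt_of_le_of_lt (sqDist_le x z₀) (lt_of_le_of_lt ?_ hηn)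
    rw [norm_sub_rev]
    gcongr
  · refine (huA.union hu₁).mono_set fun z hz => ?_
    rcases le_total s₁ (sqDist x z) with h | h
    · exact Or.inl ⟨h, hz⟩
    · exact Or.inr h

end Poles

/-! ### Levi lower bounds tested on the dual cone of the m-positive forms -/

section LowerBounds

variable {n : ℕ} {M : Type*} [TopologicalSpace M] [ChartedSpace (Cn n) M]

/-- On the set `U` the function `S` is of class `C²`, and `i∂∂̄S + B ω` is positive on all
functionals that are nonnegative on `m`-positive forms. -/
def IsLeviBddBelow (g : KahlerMetric n M) (m : ℕ) (U : Set M) (B : ℝ) (S : M → ℝ) : Prop :=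
  ∀ e ∈ atlas (Cn n) M, ∀ z ∈ e.target, e.symm z ∈ U →
    ContDiffAt ℝ 2 (fun w => S (e.symm w)) z ∧
    ∀ L : Matrix (Fin n) (Fin n) ℂ →ₗ[ℝ] ℝ,
      (∀ X, IsMPositive m (g.coeff e z) X → 0 ≤ L X) →
      -B * L (g.coeff e z) ≤ L (leviMatrix (fun w => S (e.symm w)) z)

theorem IsLeviBddBelow.mono {g : KahlerMetric n M} {m : ℕ} {U U' : Set M} {B : ℝ} {S : M → ℝ}
    (h : IsLeviBddBelow g m U B S) (hU : U' ⊆ U) : IsLeviBddBelow g m U' B S :=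
  fun e he z hz hzU => h e he z hz (hU hzU)

theorem IsLeviBddBelow.add_const_mul {g : KahlerMetric n M} {m : ℕ} {U : Set M} {B B' r : ℝ}
    {S S' : M → ℝ} (h : IsLeviBddBelow g m U B S) (h' : IsLeviBddBelow g m U B' S')
    (hr : 0 ≤ r) : IsLeviBddBelow g m U (B + r * B') (fun x => S x + r * S' x) := by
  intro e he z hz hzU
  obtain ⟨h1, h2⟩ := h e he z hz hzU
  obtain ⟨h3, h4⟩ := h' e he z hz hzU
  refine ⟨h1.add (contDiffAt_const.mul h3), fun L hL => ?_⟩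
  rw [leviMatrix_add h1 (contDiffAt_const.mul h3), leviMatrix_const_mul h3, map_add,
    map_ofReal_smul]
  nlinarith [h2 L hL, mul_le_mul_of_nonneg_left (h4 L hL) hr]

theorem LeviGEAt.le_apply {g : KahlerMetric n M} {m : ℕ} {f : M → ℝ} {s : ℝ}
    {e : OpenPartialHomeomorph M (Cn n)} (he : e ∈ atlas (Cn n) M) {z : Cn n} (hz : z ∈ e.target)
    (h : LeviGEAt g m f s (e.symm z)) {L : Matrix (Fin n) (Fin n) ℂ →ₗ[ℝ] ℝ}
    (hL : ∀ X, IsMPositive m (g.coeff e z) X → 0 ≤ L X) :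
    s * L (g.coeff e z) ≤ L (leviMatrix (fun w => f (e.symm w)) z) := by
  have h1 := h e he (e.map_target hz)
  rw [e.right_inv hz] at h1
  have h2 := hL _ h1
  rw [map_sub, map_ofReal_smul] at h2
  linarith

variable [IsManifold 𝓘(ℂ, Cn n) ω M]

theorem isLeviBddBelow_of_leviGEAt {g : KahlerMetric n M} {m : ℕ} {U : Set M} {f : M → ℝ} {s : ℝ}
    (hf : ∀ x ∈ U, ContMDiffAt 𝓘(ℝ, Cn n) 𝓘(ℝ, ℝ) 2 f x) (h : ∀ x ∈ U, LeviGEAt g m f s x) :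
    IsLeviBddBelow g m U (-s) f := by
  intro e he z hz hzU
  refine ⟨(hf _ hzU).contDiffAt_chart (WithTop.coe_le_coe.2 le_top) he hz, fun L hL => ?_⟩
  rw [neg_neg]
  exact (h _ hzU).le_apply he hz hL

-- Transfers the pointwise bound to charts: compactness bounds the derivatives of all the cut-offs
-- by one multiple of ω, and functionals nonnegative on m-positive forms are nonnegative on
-- semidefinite ones.
open scoped ComplexOrder in
theorem exists_isLeviBddBelow_weight {m : ℕ} (hmn : m ≤ n) (g : KahlerMetric n M) {Ω : Set M}
    (hΩ : IsOpen Ω) (hcpt : IsCompact (closure Ω)) {ε δ : ℝ} (hε : 0 < ε) {h : M → ℝ}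
    (hh : IsRegularWeight g m Ω ε δ h) {p c γt γ : ℝ} (hp : p ≤ 0) (hc : 0 < c)
    (hgrowth : ∀ x ∈ Ω, 0 < h x →
      LeviGEAt g m (fun y => rieszReal p (h y)) (-(c * h x ^ (p - 1 + γt))) x)
    (hγ : 0 < γ) (hγ1 : γ < γt + δ - 1) (hγ2 : γ < δ / 2) {N : ℕ} (hN : 1 ≤ N) {θ : ℕ → M → ℝ}
    (hθsmooth : ∀ j ≤ N, ContMDiffOn 𝓘(ℝ, Cn n) 𝓘(ℝ, ℝ) ∞ (θ j) (closure Ω))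
    (hθ01 : ∀ j ≤ N, ∀ x ∈ Ω, 0 ≤ θ j x ∧ θ j x ≤ 1)
    (hθN : ∀ x ∈ Ω, θ N x = 1)
    (hθsupp : ∀ j, 1 ≤ j → j ≤ N →
      Ω ∩ closure {x ∈ Ω | θ (j - 1) x ≠ 0} ⊆ interior {x ∈ Ω | θ j x = 1})
    {a : ℕ → ℝ} (ha : ∀ j ≤ N, 0 < a j) (ha0 : a 0 = 1) :
    ∃ B : ℝ, 0 ≤ B ∧ IsLeviBddBelow g m {x ∈ Ω | 0 < h x} B (fun x =>
      ∑ j ∈ Finset.range (N + 1), a j * (θ j x * rieszReal (p + j * γ) (h x))) := by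
  have hbj : ∀ j, ∃ b : ℝ, 0 ≤ b ∧ (j ≤ N → ∀ x ∈ Ω, g.DerivBound b (θ j) x) := by
    intro j
    by_cases hj : j ≤ N
    · obtain ⟨b, hb, h⟩ := g.exists_derivBound hΩ hcpt (hθsmooth j hj)
      exact ⟨b, hb, fun _ => h⟩
    · exact ⟨0, le_rfl, fun h => absurd h hj⟩
  choose b hb0 hb using hbj
  set b₀ := ∑ j ∈ Finset.range (N + 1), b j
  have hbb : ∀ j ≤ N, b j ≤ b₀ := fun j hj =>
    Finset.single_le_sum (fun i _ => hb0 i) (Finset.mem_range.2 (Nat.lt_succ_of_le hj))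
  obtain ⟨B, hB, hmain⟩ := exists_levi_weight_bound (δ := δ) hp hε hc hγ hγ1 hγ2
    (Finset.sum_nonneg fun j _ => hb0 j : 0 ≤ b₀) hN ha ha0
  refine ⟨B, hB, ?_⟩
  intro e he z hz hzU
  obtain ⟨hzΩ, hz0⟩ := hzU
  have hG := g.coeff_posDef he hz
  have hopen : IsOpen (e.target ∩ e.symm ⁻¹' Ω) := e.isOpen_inter_preimage_symm hΩ
  have hmem : e.target ∩ e.symm ⁻¹' Ω ∈ 𝓝 z := hopen.mem_nhds ⟨hz, hzΩ⟩
  have hf : ContDiffAt ℝ 2 (fun w => h (e.symm w)) z :=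
    (hh.contMDiffAt _ hzΩ hz0).contDiffAt_chart (WithTop.coe_le_coe.2 le_top) he hz
  have hθ : ∀ j ≤ N, ContDiffAt ℝ 2 (fun w => θ j (e.symm w)) z := fun j hj =>
    (((hθsmooth j hj).contMDiffAt (mem_of_superset (hΩ.mem_nhds hzΩ) subset_closure)).of_le
      (WithTop.coe_le_coe.2 le_top)).contDiffAt_chart (WithTop.coe_le_coe.2 le_top) he hz
  refine ⟨ContDiffAt.sum fun j hj => contDiffAt_const.mul ((hθ j (Nat.lt_succ_iff.1
    (Finset.mem_range.1 hj))).mul (hf.rieszReal_comp hz0 _)), fun L hL => ?_⟩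
  have hLp : ∀ X : Matrix (Fin n) (Fin n) ℂ, X.PosSemidef → 0 ≤ L X := fun X hX =>
    hL X (hX.isMPositive hG hmn)
  have hxs : e.symm z ∈ e.source := e.map_target hz
  have hez : e (e.symm z) = z := e.right_inv hz
  refine hmain n z (g.coeff e z) L (fun w => h (e.symm w)) (fun j w => θ j (e.symm w)) hLp
    (hLp _ hG.posSemidef) hf hz0 (hh.le_one _ hzΩ) ((hh.levi_ge _ hzΩ hz0).le_apply he hz hL)
    ((hgrowth _ hzΩ hz0).le_apply he hz hL) hθ (fun j hj => hθ01 j hj _ hzΩ) (fun j hj => ?_)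
    (fun j hj => ?_) (fun j hj => ?_) ?_
  · have h1 := ((hb j hj _ hzΩ).mono (hbb j hj)).levi_le he hxs (by rw [hez]; exact hθ j hj) hLp
    rwa [hez] at h1
  · have h1 := ((hb j hj _ hzΩ).mono (hbb j hj)).grad_le he hxs (by rw [hez]; exact hθ j hj) hLp
    rwa [hez] at h1
  -- On the support of `θ j` the nesting of supports gives `θ (j + 1) = 1`; off it `θ j` vanishes on
  -- a neighbourhood.
  · by_cases hcl : e.symm z ∈ closure {x ∈ Ω | θ j x ≠ 0}
    · right
      have h1 := interior_subset (hθsupp (j + 1) (Nat.succ_pos j) hj ⟨hzΩ, hcl⟩)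
      exact h1.2
    · left
      filter_upwards [hmem, (e.continuousAt_symm hz).preimage_mem_nhds
        (isClosed_closure.isOpen_compl.mem_nhds hcl)] with w hw hw2
      by_contra hne
      exact hw2 (subset_closure ⟨hw.2, hne⟩)
  · filter_upwards [hmem] with w hw
    exact hθN _ hw.2

end LowerBounds

/-! ### Continuity of the weight and smallness of its zero set -/

section Weight

variable {n : ℕ} {M : Type*} [TopologicalSpace M] [ChartedSpace (Cn n) M]

/-- At a minimum, here a zero of `h ≥ 0`, upper semicontinuity is continuity. -/
theorem IsRegularWeight.tendsto_zero {g : KahlerMetric n M} {m : ℕ} {Ω : Set M} {ε δ : ℝ}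
    {h : M → ℝ} (hh : IsRegularWeight g m Ω ε δ h) {x : M} (hx : x ∈ Ω) (hx0 : h x = 0) :
    Tendsto h (𝓝[Ω] x) (𝓝 0) := by
  rw [tendsto_order]
  refine ⟨fun c hc => ?_, fun c hc => ?_⟩
  · filter_upwards [self_mem_nhdsWithin] with y hy
    exact hc.trans_le (hh.nonneg y hy)
  · have h1 := hh.msh.usc x hx (c : EReal)
      (show (h x : EReal) < c by rw [hx0]; exact_mod_cast hc)
    filter_upwards [h1] with y hy
    exact_mod_cast hy

theorem IsRegularWeight.pos_of_ne_zero {g : KahlerMetric n M} {m : ℕ} {Ω : Set M} {ε δ : ℝ}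
    {h : M → ℝ} (hh : IsRegularWeight g m Ω ε δ h) {x : M} (hx : x ∈ Ω) (hx0 : h x ≠ 0) :
    0 < h x := lt_of_le_of_ne (hh.nonneg x hx) hx0.symm

theorem IsRegularWeight.continuousOn {g : KahlerMetric n M} {m : ℕ} {Ω : Set M} {ε δ : ℝ}
    {h : M → ℝ} (hh : IsRegularWeight g m Ω ε δ h) : ContinuousOn h Ω := by
  intro x hx
  by_cases hx0 : h x = 0
  · have := hh.tendsto_zero hx hx0
    rw [ContinuousWithinAt, hx0]
    exact this
  · exact (hh.contMDiffAt x hx (hh.pos_of_ne_zero hx hx0)).continuousAt.continuousWithinAt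

theorem IsRegularWeight.isOpen_pos_chart {g : KahlerMetric n M} {m : ℕ} {Ω : Set M} {ε δ : ℝ}
    {h : M → ℝ} (hh : IsRegularWeight g m Ω ε δ h) (hΩ : IsOpen Ω)
    (e : OpenPartialHomeomorph M (Cn n)) :
    IsOpen ((e.target ∩ e.symm ⁻¹' Ω) \ {z ∈ e.target ∩ e.symm ⁻¹' Ω | h (e.symm z) = 0}) := by
  have h1 : IsOpen {x ∈ Ω | 0 < h x} := by
    have := hh.continuousOn.isOpen_inter_preimage hΩ (isOpen_Ioi (a := (0 : ℝ)))
    exact this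
  convert e.isOpen_inter_preimage_symm h1 using 1
  ext z
  constructor
  · rintro ⟨hz1, hz2⟩
    exact ⟨hz1.1, hz1.2, hh.pos_of_ne_zero hz1.2 fun h0 => hz2 ⟨hz1, h0⟩⟩
  · rintro ⟨hz1, hz2, hz3⟩
    exact ⟨⟨hz1, hz2⟩, fun h0 => hz3.ne' h0.2⟩

/-- Locally the zero set lies in the -∞-set of an m-subharmonic function, which is Lebesgue null. -/
theorem IsRegularWeight.volume_zero_chart {g : KahlerMetric n M} {m : ℕ} {Ω : Set M} {ε δ : ℝ}
    {h : M → ℝ} (hh : IsRegularWeight g m Ω ε δ h) {e : OpenPartialHomeomorph M (Cn n)}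
    (he : e ∈ atlas (Cn n) M) :
    volume {z ∈ e.target ∩ e.symm ⁻¹' Ω | h (e.symm z) = 0} = 0 := by
  refine measure_null_of_locally_null _ fun z hz => ?_
  obtain ⟨⟨hzt, hzΩ⟩, hz0⟩ := hz
  obtain ⟨V, hV, hzV, -, v, hv, hvE⟩ := hh.zero_polar (e.symm z) ⟨hzΩ, hz0⟩
  have hO : IsOpen (e.target ∩ e.symm ⁻¹' V) := e.isOpen_inter_preimage_symm hV
  refine ⟨{z ∈ e.target ∩ e.symm ⁻¹' Ω | h (e.symm z) = 0} ∩ (e.target ∩ e.symm ⁻¹' V),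
    inter_mem self_mem_nhdsWithin (mem_nhdsWithin_of_mem_nhds (hO.mem_nhds ⟨hzt, hzV⟩)), ?_⟩
  have h1 := hv.ae_ne_bot e he
  rw [ae_restrict_iff' hO.measurableSet, ae_iff] at h1
  refine measure_mono_null (fun w hw => ?_) h1
  intro hne
  exact hne hw.2 (hvE _ ⟨⟨hw.1.1.2, hw.1.2⟩, hw.2.2⟩)

end Weight

/-! ### Semicontinuity of Riesz potentials of a weight -/

section Riesz

theorem tendsto_rieszReal_atBot {q : ℝ} (hq : q ≤ 0) :
    Tendsto (rieszReal q) (𝓝[>] 0) atBot := by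
  rcases hq.eq_or_lt with rfl | hq
  · exact Real.tendsto_log_nhdsGT_zero.congr fun s => by simp [rieszReal]
  · exact ((tendsto_rpow_neg_nhdsGT_zero hq).atTop_div_const_of_neg hq).congr fun s => by
      simp [rieszReal, hq.ne]

theorem rieszReal_nonpos {q s : ℝ} (hq : q ≤ 0) (hs : 0 ≤ s) (hs1 : s ≤ 1) :
    rieszReal q s ≤ 0 := by
  unfold rieszReal
  split_ifs with h
  · exact Real.log_nonpos hs hs1
  · exact div_nonpos_of_nonneg_of_nonpos (Real.rpow_nonneg hs q) hq

theorem exists_rieszReal_le (q : ℝ) : ∃ K, ∀ s, 0 ≤ s → s ≤ 1 → rieszReal q s ≤ K := by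
  rcases le_or_gt q 0 with hq | hq
  · exact ⟨0, fun s hs hs1 => rieszReal_nonpos hq hs hs1⟩
  · refine ⟨1 / q, fun s hs hs1 => ?_⟩
    rw [rieszReal, if_neg hq.ne']
    gcongr
    exact Real.rpow_le_one hs hs1 hq.le

theorem continuousAt_rieszReal {q s : ℝ} (hs : 0 < q ∨ 0 < s) : ContinuousAt (rieszReal q) s := by
  rcases hs with hq | hs
  · have : rieszReal q = fun s => s ^ q / q := funext fun s => by simp [rieszReal, hq.ne']
    rw [this]
    exact (Real.continuousAt_rpow_const s q (Or.inr hq.le)).div_const q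
  · exact (contDiffAt_rieszReal q hs (k := 0)).continuousAt

theorem riesz_of_pos {q s : ℝ} (hs : 0 < q ∨ 0 < s) : riesz q s = (rieszReal q s : EReal) := by
  rw [riesz, if_neg]
  rintro ⟨h1, h2⟩
  rcases hs with h | h
  · exact absurd h1 (not_le.2 h)
  · exact h.ne' h2

theorem riesz_zero {q : ℝ} (hq : q ≤ 0) : riesz q 0 = ⊥ := if_pos ⟨hq, rfl⟩

theorem coe_mul_riesz_ne_top {t : ℝ} (ht : 0 ≤ t) (q s : ℝ) : (t : EReal) * riesz q s ≠ ⊤ := by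
  unfold riesz
  split_ifs
  · rcases ht.eq_or_lt with rfl | ht
    · simp
    · rw [EReal.coe_mul_bot_of_pos ht]; simp
  · rw [← EReal.coe_mul]
    exact EReal.coe_ne_top _

theorem coe_mul_riesz_nonpos {t q s : ℝ} (ht : 0 ≤ t) (hq : q ≤ 0) (hs : 0 ≤ s) (hs1 : s ≤ 1) :
    (t : EReal) * riesz q s ≤ 0 := by
  rcases hs.eq_or_lt with rfl | hs0
  · rw [riesz_zero hq]
    rcases ht.eq_or_lt with rfl | ht
    · simp
    · rw [EReal.coe_mul_bot_of_pos ht]; simp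
  · rw [riesz_of_pos (Or.inr hs0), ← EReal.coe_mul]
    exact_mod_cast mul_nonpos_of_nonneg_of_nonpos ht (rieszReal_nonpos hq hs hs1)

/-- The delicate points have `h x = 0` and `q ≤ 0`. If `t x > 0` the product tends to -∞. If `t x =
0` its value is `0 * ⊥ = 0`, and nearby values are nonpositive because `h ≤ 1`. -/
theorem upperSemicontinuousWithinAt_coe_mul_riesz {X : Type*} [TopologicalSpace X] {U : Set X}
    {t h : X → ℝ} (ht : ContinuousOn t U) (ht0 : ∀ x ∈ U, 0 ≤ t x) (hh : ContinuousOn h U)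
    (hh0 : ∀ x ∈ U, 0 ≤ h x) (hh1 : ∀ x ∈ U, h x ≤ 1) (q : ℝ) {x : X} (hx : x ∈ U) :
    UpperSemicontinuousWithinAt (fun y => (t y : EReal) * riesz q (h y)) U x := by
  by_cases hreg : 0 < q ∨ 0 < h x
  · refine ContinuousWithinAt.upperSemicontinuousWithinAt ?_
    have h1 : ∀ᶠ y in 𝓝[U] x, 0 < q ∨ 0 < h y := by
      rcases hreg with hq | hhx
      · exact Eventually.of_forall fun _ => Or.inl hq
      · exact ((hh x hx).eventually (lt_mem_nhds hhx)).mono fun _ => Or.inr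
    have h2 : ContinuousWithinAt (fun y => ((t y * rieszReal q (h y) : ℝ) : EReal)) U x :=
      continuous_coe_real_ereal.continuousAt.comp_continuousWithinAt
        ((ht x hx).mul ((continuousAt_rieszReal hreg).comp_continuousWithinAt (hh x hx)))
    refine h2.congr_of_eventuallyEq ?_ (by rw [riesz_of_pos hreg, EReal.coe_mul])
    filter_upwards [h1] with y hy
    rw [riesz_of_pos hy, EReal.coe_mul]
  · rw [not_or, not_lt, not_lt] at hreg
    have hx0 : h x = 0 := le_antisymm hreg.2 (hh0 x hx)
    have hlim : Tendsto h (𝓝[U] x) (𝓝 0) := by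
      have := hh x hx
      rwa [ContinuousWithinAt, hx0] at this
    intro y hy
    change (t x : EReal) * riesz q (h x) < y at hy
    change ∀ᶠ x' in 𝓝[U] x, (t x' : EReal) * riesz q (h x') < y
    rw [hx0, riesz_zero hreg.1] at hy
    rcases (ht0 x hx).eq_or_lt with h0 | h0
    · rw [← h0] at hy
      simp only [EReal.coe_zero, zero_mul] at hy
      filter_upwards [self_mem_nhdsWithin] with x' hx'
      exact (coe_mul_riesz_nonpos (ht0 x' hx') hreg.1 (hh0 x' hx') (hh1 x' hx')).trans_lt hy
    · rw [EReal.coe_mul_bot_of_pos h0] at hy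
      obtain ⟨r, hr, hry⟩ := EReal.lt_iff_exists_real_btwn.1 hy
      have h1 : ∀ᶠ x' in 𝓝[U] x, t x / 2 < t x' :=
        (ht x hx).eventually (lt_mem_nhds (half_lt_self h0))
      have h2 : ∀ᶠ s in 𝓝[>] (0 : ℝ), rieszReal q s < r / (t x / 2) :=
        (tendsto_rieszReal_atBot hreg.1).eventually (eventually_lt_atBot _)
      rw [eventually_nhdsWithin_iff] at h2
      filter_upwards [h1, hlim.eventually h2, self_mem_nhdsWithin] with x' hx1 hx2 hx'
      have htx' : 0 < t x' := (half_pos h0).trans hx1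
      rcases (hh0 x' hx').eq_or_lt with h3 | h3
      · rw [← h3, riesz_zero hreg.1, EReal.coe_mul_bot_of_pos htx']
        exact hy
      · rw [riesz_of_pos (Or.inr h3), ← EReal.coe_mul]
        refine lt_trans ?_ hry
        rw [EReal.coe_lt_coe_iff]
        have h4 := hx2 h3
        have h5 := rieszReal_nonpos hreg.1 (hh0 x' hx') (hh1 x' hx')
        rw [lt_div_iff₀ (half_pos h0)] at h4
        nlinarith

theorem UpperSemicontinuousWithinAt.ereal_sum {X ι : Type*} [TopologicalSpace X] {U : Set X}
    {x : X} {F : ι → X → EReal} (S : Finset ι)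
    (hF : ∀ i ∈ S, UpperSemicontinuousWithinAt (F i) U x) (hT : ∀ i ∈ S, F i x ≠ ⊤) :
    UpperSemicontinuousWithinAt (fun y => ∑ i ∈ S, F i y) U x ∧ ∑ i ∈ S, F i x ≠ ⊤ := by
  classical
  induction S using Finset.induction_on with
  | empty => exact ⟨continuousWithinAt_const.upperSemicontinuousWithinAt, by simp⟩
  | insert i S hi ih =>
    obtain ⟨h1, h2⟩ := ih (fun k hk => hF k (Finset.mem_insert_of_mem hk))
      fun k hk => hT k (Finset.mem_insert_of_mem hk)
    have h3 := hT i (Finset.mem_insert_self i S)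
    simp only [Finset.sum_insert hi]
    exact ⟨(hF i (Finset.mem_insert_self i S)).add' h1
      (EReal.continuousAt_add (Or.inl h3) (Or.inr h2)), EReal.add_ne_top h3 h2⟩

theorem EReal.coe_finsetSum {ι : Type*} (S : Finset ι) (f : ι → ℝ) :
    ((∑ i ∈ S, f i : ℝ) : EReal) = ∑ i ∈ S, (f i : EReal) := by
  classical
  induction S using Finset.induction_on with
  | empty => simp
  | insert i S hi ih => rw [Finset.sum_insert hi, Finset.sum_insert hi, EReal.coe_add, ih]

end Riesz

/-! ### The test forms as coefficients of second order operators -/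

section Cofactor

variable {n : ℕ} {M : Type*} [TopologicalSpace M] [ChartedSpace (Cn n) M]

theorem coeffPairing_cofactorCoeff (hn : 0 < n) (g : KahlerMetric n M) (m : ℕ)
    (e : OpenPartialHomeomorph M (Cn n)) (A : ℕ → Cn n → Matrix (Fin n) (Fin n) ℂ) (z : Cn n)
    (X : Matrix (Fin n) (Fin n) ℂ) :
    coeffPairing (cofactorCoeff g m e A) z X =
      cofactorLinear hn (fun i : Fin n => if (i : ℕ) < m then A i z else g.coeff e z) X := by
  rw [cofactorLinear_apply, cofactorForm_eq_sum hn]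
  rfl

theorem contDiffOn_cofactorCoeff (g : KahlerMetric n M) (m : ℕ)
    {e : OpenPartialHomeomorph M (Cn n)} (he : e ∈ atlas (Cn n) M) {O : Set (Cn n)}
    (hO : O ⊆ e.target) {A : ℕ → Cn n → Matrix (Fin n) (Fin n) ℂ}
    (hA : ∀ i, 1 ≤ i → i < m → ∀ j k, ContDiffOn ℝ ∞ (fun z => A i z j k) O) (j k : Fin n) :
    ContDiffOn ℝ 2 (cofactorCoeff g m e A j k) O := by
  have hentry : ∀ i a b : Fin n, ContDiffOn ℝ ∞ (fun z =>
      (if (i : ℕ) = 0 then Matrix.single j k (1 : ℂ) else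
        if (i : ℕ) < m then A i z else g.coeff e z) a b) O := by
    intro i a b
    split_ifs with h1 h2
    · exact contDiffOn_const
    · exact hA i (Nat.one_le_iff_ne_zero.2 h1) h2 a b
    · exact (g.smooth e he a b).mono hO
  refine ContDiffOn.of_le (n := ∞) ?_ (WithTop.coe_le_coe.2 le_top)
  unfold cofactorCoeff wedgeCoeff
  exact ContDiffOn.sum fun σ _ => ContDiffOn.sum fun τ _ =>
    contDiffOn_const.mul (contDiffOn_prod fun i _ => hentry i _ _)

end Cofactor

/-! ### Removing the perturbation by a function with poles -/

section Perturbation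

variable {n : ℕ} {O Z : Set (Cn n)} {φ ψ : Cn n → ℝ}

/-- The function φ alone need not tend to -∞ on `Z`, so the integrability theorem is applied to two
perturbations, from which φ and ψ are recovered linearly. -/
theorem locallyIntegrableOn_of_subsolutions {T : Fin n → Fin n → Cn n → ℂ} (hO : IsOpen O)
    (hT : ∀ j k, ContDiffOn ℝ 2 (T j k) O)
    (hell : ∀ z ∈ O, ∀ v : Fin n → ℂ, v ≠ 0 →
      0 < coeffPairing T z (Matrix.vecMulVec v (star v)))
    (h1 : IsSubsolutionWithPoles T O Z fun z => φ z + 1 * ψ z)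
    (h2 : IsSubsolutionWithPoles T O Z fun z => φ z + 2 * ψ z) :
    LocallyIntegrableOn φ O ∧ LocallyIntegrableOn ψ O := by
  have i1 := h1.locallyIntegrableOn hO hT hell
  have i2 := h2.locallyIntegrableOn hO hT hell
  have e2 : ψ = (fun z => φ z + 2 * ψ z) - fun z => φ z + 1 * ψ z := by
    funext z; simp only [Pi.sub_apply]; ring
  have e1 : φ = (fun z => φ z + 1 * ψ z) - ψ := by funext z; simp
  have i3 : LocallyIntegrableOn ψ O := by rw [e2]; exact i2.sub i1
  exact ⟨by rw [e1]; exact i1.sub i3, i3⟩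

/-- The tested inequality is affine in η once φ and ψ are both integrable, so η → 0 is immediate. -/
theorem integral_mul_adjointOp_nonneg_of_subsolutions {T : Fin n → Fin n → Cn n → ℂ}
    (hO : IsOpen O) (hTc : ∀ j k, ContDiffOn ℝ 2 (T j k) O)
    (hT : ∀ z ∈ O, ∀ v : Fin n → ℂ, 0 ≤ coeffPairing T z (Matrix.vecMulVec v (star v)))
    (hφ : LocallyIntegrableOn φ O) (hψ : LocallyIntegrableOn ψ O)
    (hsub : ∀ η : ℝ, 0 < η → η ≤ 1 → IsSubsolutionWithPoles T O Z fun z => φ z + η * ψ z)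
    {χ : Cn n → ℝ} (hχ : ContDiff ℝ 2 χ) (hc : HasCompactSupport χ) (hs : tsupport χ ⊆ O)
    (hχ0 : ∀ z, 0 ≤ χ z) : 0 ≤ ∫ z, φ z * adjointOp T χ z := by
  have hac := continuous_adjointOp hO hTc hχ hs
  have hinteg : ∀ v : Cn n → ℝ, LocallyIntegrableOn v O →
      Integrable fun z => v z * adjointOp T χ z := by
    intro v hv
    refine (integrableOn_iff_integrable_of_support_subset (s := tsupport χ) fun z hz => ?_).1
      (IntegrableOn.mul_continuousOn (hv.integrableOn_compact_subset hs hc)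
        hac.continuousOn hc)
    by_contra h
    exact hz (by simp only; rw [adjointOp_eq_zero h, mul_zero])
  have i1 := hinteg φ hφ
  have i2 := hinteg ψ hψ
  have hη : ∀ᶠ η : ℝ in 𝓝[>] 0, 0 ≤ (∫ z, φ z * adjointOp T χ z) +
      η * ∫ z, ψ z * adjointOp T χ z := by
    filter_upwards [Ioc_mem_nhdsGT (zero_lt_one' ℝ)] with η h
    have h1 := (hsub η h.1 h.2).integral_mul_adjointOp_nonneg hO hTc hT
      (hφ.add fun z hz => by exact (hψ z hz).smul η) hχ hc hs hχ0
    rw [← integral_const_mul, ← integral_add i1 (i2.const_mul η)]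
    refine h1.trans_eq (integral_congr_ae (Eventually.of_forall fun z => ?_))
    simp only
    ring
  have hlim : Tendsto (fun η : ℝ => (∫ z, φ z * adjointOp T χ z) +
      η * ∫ z, ψ z * adjointOp T χ z) (𝓝[>] 0) (𝓝 ((∫ z, φ z * adjointOp T χ z) +
      0 * ∫ z, ψ z * adjointOp T χ z)) :=
    (Continuous.tendsto (by fun_prop) 0).mono_left nhdsWithin_le_nhds
  rw [zero_mul, add_zero] at hlim
  exact ge_of_tendsto hlim hη

end Perturbation

/-! ### Extension across the zero set and the theorem -/

section Main

variable {n : ℕ} {M : Type*} [TopologicalSpace M] [ChartedSpace (Cn n) M]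

theorem tendsto_add_mul_riesz_atBot {g : KahlerMetric n M} {m : ℕ} {Ω : Set M} {ε δ : ℝ}
    {h : M → ℝ} (hh : IsRegularWeight g m Ω ε δ h) {e : OpenPartialHomeomorph M (Cn n)}
    {φ ψ : M → ℝ} {p K K' η : ℝ} (hp : p ≤ 0) (hη : 0 < η) (hφ : ∀ x ∈ Ω, φ x ≤ K)
    (hψ : ∀ x ∈ Ω, ψ x ≤ rieszReal p (h x) + K') {z : Cn n} (hz : z ∈ e.target)
    (hzΩ : e.symm z ∈ Ω) (hz0 : h (e.symm z) = 0) :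
    Tendsto (fun w => φ (e.symm w) + η * ψ (e.symm w))
      (𝓝[(e.target ∩ e.symm ⁻¹' Ω) \ {z ∈ e.target ∩ e.symm ⁻¹' Ω | h (e.symm z) = 0}] z)
      atBot := by
  set O := e.target ∩ e.symm ⁻¹' Ω
  set Z := {z ∈ O | h (e.symm z) = 0}
  have h1 : Tendsto e.symm (𝓝[O \ Z] z) (𝓝[Ω] (e.symm z)) := by
    refine tendsto_nhdsWithin_iff.2 ⟨(e.continuousAt_symm hz).tendsto.mono_left
      nhdsWithin_le_nhds, ?_⟩
    filter_upwards [self_mem_nhdsWithin] with w hw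
    exact hw.1.2
  have h2 : Tendsto (fun w => h (e.symm w)) (𝓝[O \ Z] z) (𝓝[>] 0) := by
    refine tendsto_nhdsWithin_iff.2 ⟨(hh.tendsto_zero hzΩ hz0).comp h1, ?_⟩
    filter_upwards [self_mem_nhdsWithin] with w hw
    exact hh.pos_of_ne_zero hw.1.2 fun h0 => hw.2 ⟨hw.1, h0⟩
  have h3 : Tendsto (fun w => η * rieszReal p (h (e.symm w)) + (K + η * K')) (𝓝[O \ Z] z)
      atBot :=
    tendsto_atBot_add_const_right _ _
      (((tendsto_rieszReal_atBot hp).comp h2).const_mul_atBot hη)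
  refine tendsto_atBot_mono' _ ?_ h3
  filter_upwards [self_mem_nhdsWithin] with w hw
  have h4 := hφ _ hw.1.2
  have h5 := mul_le_mul_of_nonneg_left (hψ _ hw.1.2) hη.le
  linarith

variable [IsManifold 𝓘(ℂ, Cn n) ω M]

open scoped ComplexOrder in
theorem IsLeviBddBelow.of_le {m : ℕ} (hmn : m ≤ n) {g : KahlerMetric n M} {U : Set M} {B B' : ℝ}
    {S : M → ℝ} (h : IsLeviBddBelow g m U B S) (hB : B ≤ B') : IsLeviBddBelow g m U B' S := by
  intro e he z hz hzU
  obtain ⟨h1, h2⟩ := h e he z hz hzU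
  refine ⟨h1, fun L hL => le_trans ?_ (h2 L hL)⟩
  have hG := g.coeff_posDef he hz
  exact mul_le_mul_of_nonneg_right (neg_le_neg hB) (hL _ (hG.posSemidef.isMPositive hG hmn))

open scoped ComplexOrder in
theorem coeffPairing_cofactorCoeff_nonneg {m : ℕ} (hm : 1 ≤ m) (hmn : m ≤ n)
    (g : KahlerMetric n M) {e : OpenPartialHomeomorph M (Cn n)} (he : e ∈ atlas (Cn n) M)
    {z : Cn n} (hz : z ∈ e.target) {A : ℕ → Cn n → Matrix (Fin n) (Fin n) ℂ}
    (hA : ∀ i, 1 ≤ i → i < m → IsMPositive m (g.coeff e z) (A i z))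
    {X : Matrix (Fin n) (Fin n) ℂ} (hX : IsMPositive m (g.coeff e z) X) :
    0 ≤ coeffPairing (cofactorCoeff g m e A) z X := by
  rw [coeffPairing_cofactorCoeff (hm.trans hmn), cofactorLinear_apply]
  exact cofactorForm_nonneg (A := fun i => A i z) (g.coeff_posDef he hz) hm hmn hA hX

open scoped ComplexOrder in
/-- A function `φ` with singularities along the zero set of the weight is `m`-subharmonic if all
its small perturbations by a function `ψ` with poles there are so off the zero set. -/
theorem IsRegularWeight.isMSubharmonicOn {m : ℕ} (hm : 1 ≤ m) (hmn : m ≤ n)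
    {g : KahlerMetric n M} {Ω : Set M} {ε δ : ℝ} {h : M → ℝ} (hΩ : IsOpen Ω)
    (hh : IsRegularWeight g m Ω ε δ h) {φ ψ : M → ℝ} {p K K' B : ℝ} (hp : p ≤ 0)
    (hφ : ∀ x ∈ Ω, φ x ≤ K) (hψ : ∀ x ∈ Ω, ψ x ≤ rieszReal p (h x) + K')
    (hφL : IsLeviBddBelow g m {x ∈ Ω | 0 < h x} (-(2 * B)) φ)
    (hψL : IsLeviBddBelow g m {x ∈ Ω | 0 < h x} B ψ) (hB : 0 ≤ B) {Φ : M → EReal}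
    (hΦtop : ∀ x ∈ Ω, Φ x ≠ ⊤) (husc : UpperSemicontinuousOn Φ Ω)
    (hΦ : ∀ x ∈ Ω, 0 < h x → Φ x = (φ x : EReal)) :
    IsMSubharmonicOn g m Ω Φ := by
  have hn : 0 < n := hm.trans hmn
  have hsub : ∀ e ∈ atlas (Cn n) M, ∀ A : ℕ → Cn n → Matrix (Fin n) (Fin n) ℂ,
      (∀ z ∈ e.target ∩ e.symm ⁻¹' Ω, ∀ i, 1 ≤ i → i < m →
        IsMPositive m (g.coeff e z) (A i z)) → ∀ η : ℝ, 0 < η → η ≤ 2 →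
      IsSubsolutionWithPoles (cofactorCoeff g m e A) (e.target ∩ e.symm ⁻¹' Ω)
        {z ∈ e.target ∩ e.symm ⁻¹' Ω | h (e.symm z) = 0}
        (fun z => φ (e.symm z) + η * ψ (e.symm z)) := by
    intro e he A hA η hη hη2
    have hL := hφL.add_const_mul hψL hη.le
    have hpos : ∀ z ∈ (e.target ∩ e.symm ⁻¹' Ω) \
        {z ∈ e.target ∩ e.symm ⁻¹' Ω | h (e.symm z) = 0}, e.symm z ∈ {x ∈ Ω | 0 < h x} :=
      fun z hz => ⟨hz.1.2, hh.pos_of_ne_zero hz.1.2 fun h0 => hz.2 ⟨hz.1, h0⟩⟩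
    refine ⟨hh.isOpen_pos_chart hΩ e, hh.volume_zero_chart he, fun z hz => ?_, fun z hz => ?_,
      fun z hz => ?_⟩
    · exact (hL e he z hz.1.1 (hpos z hz)).1.contDiffWithinAt
    · exact tendsto_add_mul_riesz_atBot hh hp hη hφ hψ hz.1.1 hz.1.2 hz.2.2
    · have h0 : ∀ X, IsMPositive m (g.coeff e z) X → 0 ≤ cofactorLinear hn
          (fun i : Fin n => if (i : ℕ) < m then A i z else g.coeff e z) X := fun X hX => by
        rw [← coeffPairing_cofactorCoeff]
        exact coeffPairing_cofactorCoeff_nonneg hm hmn g he hz.1.1 (hA z hz.1) hX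
      have h1 := (hL e he z hz.1.1 (hpos z hz)).2 _ h0
      rw [coeffPairing_cofactorCoeff hn]
      refine le_trans ?_ h1
      have hG := g.coeff_posDef he hz.1.1
      have h2 := h0 _ (hG.posSemidef.isMPositive hG hmn)
      -- The lower bound for the Levi form of φ + ηψ is `(2 - η) * B` times ω, whence the
      -- restriction `η ≤ 2`.
      exact mul_nonneg (by nlinarith) h2
  have hloc : ∀ e ∈ atlas (Cn n) M,
      LocallyIntegrableOn (fun z => φ (e.symm z)) (e.target ∩ e.symm ⁻¹' Ω) ∧
      LocallyIntegrableOn (fun z => ψ (e.symm z)) (e.target ∩ e.symm ⁻¹' Ω) := by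
    intro e he
    have hA : ∀ z ∈ e.target ∩ e.symm ⁻¹' Ω, ∀ i : ℕ, 1 ≤ i → i < m →
        IsMPositive m (g.coeff e z) ((fun _ : ℕ => g.coeff e) i z) := fun z hz i _ _ => by
      have hG := g.coeff_posDef he hz.1
      exact hG.posSemidef.isMPositive hG hmn
    -- Integrability does not depend on the test forms, so all of them are taken equal to ω: this
    -- makes the operator elliptic, whereas general m-positive forms may degenerate.
    refine locallyIntegrableOn_of_subsolutions (T := cofactorCoeff g m e fun _ => g.coeff e)
      (e.isOpen_inter_preimage_symm hΩ)
      (contDiffOn_cofactorCoeff g m he inter_subset_left fun i _ _ j k =>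
        (g.smooth e he j k).mono inter_subset_left) (fun z hz v hv => ?_)
      (hsub e he _ hA 1 one_pos one_le_two) (hsub e he _ hA 2 two_pos le_rfl)
    rw [coeffPairing_cofactorCoeff hn, cofactorLinear_apply]
    simp only [ite_self]
    exact cofactorForm_vecMulVec_pos hn (g.coeff_posDef he hz.1) hv
  have hae : ∀ e ∈ atlas (Cn n) M, ∀ᵐ z, z ∈ e.target ∩ e.symm ⁻¹' Ω →
      Φ (e.symm z) = (φ (e.symm z) : EReal) := by
    intro e he
    have h1 : ∀ᵐ z, z ∉ {z ∈ e.target ∩ e.symm ⁻¹' Ω | h (e.symm z) = 0} :=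
      measure_eq_zero_iff_ae_notMem.1 (hh.volume_zero_chart he)
    filter_upwards [h1] with z hz hzO
    exact hΦ _ hzO.2 (hh.pos_of_ne_zero hzO.2 fun h0 => hz ⟨hzO, h0⟩)
  refine ⟨hΦtop, husc, fun e he => ?_, fun e he => ?_, fun e he A hA χ hχ hc hs hχ0 => ?_⟩
  · rw [ae_restrict_iff' (e.isOpen_inter_preimage_symm hΩ).measurableSet]
    filter_upwards [hae e he] with z hz hzO
    rw [hz hzO]
    exact EReal.coe_ne_bot _
  · intro z hz
    obtain ⟨t, ht, hinteg⟩ := (hloc e he).1 z hz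
    have hOm : MeasurableSet (e.target ∩ e.symm ⁻¹' Ω) :=
      (e.isOpen_inter_preimage_symm hΩ).measurableSet
    refine ⟨t ∩ (e.target ∩ e.symm ⁻¹' Ω), inter_mem ht self_mem_nhdsWithin, ?_⟩
    refine (hinteg.mono_set inter_subset_left).congr_fun_ae ?_
    have h1 : ∀ᵐ w ∂(volume.restrict (e.target ∩ e.symm ⁻¹' Ω)),
        φ (e.symm w) = (Φ (e.symm w)).toReal := by
      rw [ae_restrict_iff' hOm]
      filter_upwards [hae e he] with w hw hwO
      rw [hw hwO, EReal.toReal_coe]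
    exact ae_mono (Measure.restrict_mono inter_subset_right le_rfl) h1
  · have h1 := integral_mul_adjointOp_nonneg_of_subsolutions (T := cofactorCoeff g m e A)
      (e.isOpen_inter_preimage_symm hΩ)
      (contDiffOn_cofactorCoeff g m he inter_subset_left fun i h1 h2 => (hA i h1 h2).1)
      (fun z hz v => coeffPairing_cofactorCoeff_nonneg hm hmn g he hz.1
        (fun i h1 h2 => (hA i h1 h2).2 z hz)
        ((Matrix.posSemidef_vecMulVec_self_star v).isMPositive (g.coeff_posDef he hz.1) hmn))
      (hloc e he).1 (hloc e he).2
      (fun η h0 h1 => hsub e he A (fun z hz i h1 h2 => (hA i h1 h2).2 z hz) η h0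
        (h1.trans one_le_two))
      (hχ.of_le (WithTop.coe_le_coe.2 le_top)) hc hs hχ0
    refine h1.trans_eq (integral_congr_ae ?_)
    filter_upwards [hae e he] with z hz
    by_cases hzO : z ∈ e.target ∩ e.symm ⁻¹' Ω
    · rw [hz hzO, EReal.toReal_coe]
      rfl
    · have h2 : adjointOp (cofactorCoeff g m e A) χ z = 0 := adjointOp_eq_zero fun h => hzO (hs h)
      have h3 : (∑ j, ∑ k, wirtinger j
          (wirtingerBar k fun w => (χ w : ℂ) * cofactorCoeff g m e A j k w) z).re = 0 := h2
      rw [h2, h3, mul_zero, mul_zero]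

end Main

theorem proposition3p2 {n m : ℕ} (hm : 1 ≤ m) (hmn : m ≤ n)
    {M : Type*} [TopologicalSpace M] [T2Space M] [SecondCountableTopology M]
    [ChartedSpace (Cn n) M] [IsManifold 𝓘(ℂ, Cn n) ω M]
    (g : KahlerMetric n M) (Ω : Set M) (ρ : M → ℝ)
    (hΩ : IsStronglyMPseudoconvex g m Ω ρ)
    (ε δ : ℝ) (hε : 0 < ε) (hδ : 0 < δ)
    (h : M → ℝ) (hh : IsRegularWeight g m Ω ε δ h)
    (p : ℝ) (hp : p ≤ 0) (c γt : ℝ) (hc : 0 < c) (hγt : 1 - δ < γt)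
    (hgrowth : ∀ x ∈ Ω, 0 < h x →
      LeviGEAt g m (fun y => rieszReal p (h y)) (-(c * h x ^ (p - 1 + γt))) x)
    (γ : ℝ) (hγ : 0 < γ) (hγlt : γ < min (γt + δ - 1) (δ / 2))
    (l : ℕ) (hl : IsLeast {k : ℕ | 0 < p + k * γ} l)
    (θ : ℕ → M → ℝ)
    (hθsmooth : ∀ j ≤ l, ContMDiffOn 𝓘(ℝ, Cn n) 𝓘(ℝ, ℝ) ∞ (θ j) (closure Ω))
    (hθ01 : ∀ j ≤ l, ∀ x ∈ Ω, 0 ≤ θ j x ∧ θ j x ≤ 1)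
    (hθl : ∀ x ∈ Ω, θ l x = 1)
    (hθsupp : ∀ j, 1 ≤ j → j ≤ l →
      Ω ∩ closure {x ∈ Ω | θ (j - 1) x ≠ 0} ⊆ interior {x ∈ Ω | θ j x = 1})
    (a : ℕ → ℝ) (ha : ∀ j, 1 ≤ j → j ≤ l → 0 < a j) :
    ∃ C₀ : ℝ, ∀ C : ℝ, C₀ ≤ C →
      IsMSubharmonicOn g m Ω (fun x =>
        (θ 0 x : EReal) * riesz p (h x)
          + ∑ j ∈ Finset.Icc 1 l, ((a j * θ j x : ℝ) : EReal) * riesz (p + j * γ) (h x)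
          + ((C * ρ x : ℝ) : EReal)) := by
  have hΩo := hΩ.isOpen
  have hγ1 : γ < γt + δ - 1 := hγlt.trans_le (min_le_left _ _)
  have hγ2 : γ < δ / 2 := hγlt.trans_le (min_le_right _ _)
  have hl1 : 1 ≤ l := by
    rcases Nat.eq_zero_or_pos l with h0 | h0
    · have h1 : 0 < p + l * γ := hl.1
      rw [h0, Nat.cast_zero, zero_mul, add_zero] at h1
      exact absurd hp (not_le.2 h1)
    · exact h0
  obtain ⟨ε₀, hε₀, hρL⟩ := hΩ.strict
  obtain ⟨W, hWo, hΩW, hρW⟩ := hΩ.smooth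
  have hρs : ∀ x ∈ Ω, ContMDiffAt 𝓘(ℝ, Cn n) 𝓘(ℝ, ℝ) ∞ ρ x := fun x hx =>
    hρW.contMDiffAt (hWo.mem_nhds (hΩW (subset_closure hx)))
  -- The term θ K_p(h) becomes the summand `j = 0`, with coefficient 1.
  set a' : ℕ → ℝ := fun j => if j = 0 then 1 else a j with ha'
  have ha'pos : ∀ j ≤ l, 0 < a' j := fun j hj => by
    simp only [ha']
    split_ifs with h0
    · exact one_pos
    · exact ha j (Nat.one_le_iff_ne_zero.2 h0) hj
  obtain ⟨B, hB, hS⟩ := exists_isLeviBddBelow_weight hmn g hΩo hΩ.isCompact_closure hε hh hp hc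
    hgrowth hγ hγ1 hγ2 hl1 hθsmooth hθ01 hθl hθsupp ha'pos (by simp [ha'])
  -- The same estimate with constant cut-offs and `N = 1` gives ψ = K_p(h) + K_{p+γ}(h). The second
  -- kernel is needed because the lower bound assumed for K_p(h) alone may be unbounded near the
  -- zero set.
  obtain ⟨B', hB', hψ⟩ := exists_isLeviBddBelow_weight hmn g hΩo hΩ.isCompact_closure hε hh hp hc
    hgrowth hγ hγ1 hγ2 le_rfl (θ := fun _ _ => 1) (fun _ _ => contMDiffOn_const)
    (fun _ _ _ _ => ⟨zero_le_one, le_rfl⟩) (fun _ _ => rfl)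
    (fun _ _ _ x hx => by simpa [hΩo.interior_eq] using hx.1) (a := fun _ => 1)
    (fun _ _ => one_pos) rfl
  set S : M → ℝ := fun x =>
    ∑ j ∈ Finset.range (l + 1), a' j * (θ j x * rieszReal (p + j * γ) (h x)) with hSdef
  choose K hK using fun j : ℕ => exists_rieszReal_le (p + j * γ)
  have hSK : ∀ x ∈ Ω, S x ≤ ∑ j ∈ Finset.range (l + 1), a' j * max (K j) 0 := by
    intro x hx
    refine Finset.sum_le_sum fun j hj => ?_
    have hjl : j ≤ l := Nat.lt_succ_iff.1 (Finset.mem_range.1 hj)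
    refine mul_le_mul_of_nonneg_left ?_ (ha'pos j hjl).le
    have h1 := (hK j (h x) (hh.nonneg x hx) (hh.le_one x hx)).trans (le_max_left _ 0)
    have h2 := hθ01 j hjl x hx
    calc θ j x * rieszReal (p + j * γ) (h x) ≤ θ j x * max (K j) 0 :=
          mul_le_mul_of_nonneg_left h1 h2.1
      _ ≤ 1 * max (K j) 0 := mul_le_mul_of_nonneg_right h2.2 (le_max_right _ _)
      _ = max (K j) 0 := one_mul _
  -- The amount `B` compensates the sum; the extra `2 * B'` leaves room for perturbations ηψ with `η
  -- ≤ 2`.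
  refine ⟨(B + 2 * B') / ε₀, fun C hC => ?_⟩
  have hC0 : 0 ≤ C := le_trans (by positivity) hC
  rw [div_le_iff₀ hε₀] at hC
  have hρB : IsLeviBddBelow g m {x ∈ Ω | 0 < h x} (-ε₀) ρ :=
    (isLeviBddBelow_of_leviGEAt (fun x hx => (hρs x hx).of_le (WithTop.coe_le_coe.2 le_top))
      hρL).mono fun x hx => hx.1
  have hφL := hS.add_const_mul hρB hC0
  -- the potential as a single sum
  have hΦ : ∀ x, (θ 0 x : EReal) * riesz p (h x)
      + ∑ j ∈ Finset.Icc 1 l, ((a j * θ j x : ℝ) : EReal) * riesz (p + j * γ) (h x)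
      + ((C * ρ x : ℝ) : EReal) =
      ∑ j ∈ Finset.range (l + 1), ((a' j * θ j x : ℝ) : EReal) * riesz (p + j * γ) (h x) +
      ((C * ρ x : ℝ) : EReal) := by
    intro x
    rw [Finset.range_eq_Ico, Finset.sum_eq_sum_Ico_succ_bot (Nat.succ_pos l)]
    congr 2
    · simp [ha']
    · refine Finset.sum_congr rfl fun j hj => ?_
      have : j ≠ 0 := by
        have := (Finset.mem_Icc.1 hj).1
        omega
      simp [ha', this]
  simp only [hΦ]
  have husc : ∀ x ∈ Ω, UpperSemicontinuousWithinAt (fun y => ∑ j ∈ Finset.range (l + 1),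
      ((a' j * θ j y : ℝ) : EReal) * riesz (p + j * γ) (h y)) Ω x ∧
      ∑ j ∈ Finset.range (l + 1), ((a' j * θ j x : ℝ) : EReal) * riesz (p + j * γ) (h x) ≠ ⊤ := by
    intro x hx
    have hnn : ∀ j ∈ Finset.range (l + 1), ∀ y ∈ Ω, 0 ≤ a' j * θ j y := fun j hj y hy =>
      mul_nonneg (ha'pos j (Nat.lt_succ_iff.1 (Finset.mem_range.1 hj))).le
        (hθ01 j (Nat.lt_succ_iff.1 (Finset.mem_range.1 hj)) y hy).1
    refine UpperSemicontinuousWithinAt.ereal_sum _ (fun j hj => ?_) fun j hj =>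
      coe_mul_riesz_ne_top (hnn j hj x hx) _ _
    exact upperSemicontinuousWithinAt_coe_mul_riesz
      (continuousOn_const.mul ((hθsmooth j (Nat.lt_succ_iff.1
        (Finset.mem_range.1 hj))).continuousOn.mono subset_closure)) (hnn j hj)
      hh.continuousOn hh.nonneg hh.le_one _ hx
  -- Since ρ < 0 on Ω, the upper bound of the sum is one for φ. The constant `K 1` bounds
  -- K_{p+γ}(h), so that ψ ≤ K_p(h) + `K 1`.
  refine hh.isMSubharmonicOn hm hmn hΩo (φ := fun x => S x + C * ρ x) (B := B')
    (K := ∑ j ∈ Finset.range (l + 1), a' j * max (K j) 0) (K' := K 1) hp (fun x hx => ?_)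
    (fun x hx => ?_) (hφL.of_le hmn (by linarith)) hψ hB' (fun x hx => ?_) (fun x hx => ?_)
    fun x hx hx0 => ?_
  · have h1 := hSK x hx
    have h2 := mul_nonpos_of_nonneg_of_nonpos hC0 (hΩ.neg x hx).le
    linarith
  · have h1 := hK 1 (h x) (hh.nonneg x hx) (hh.le_one x hx)
    simp only [Finset.sum_range_succ, Finset.sum_range_zero, Nat.cast_zero, zero_mul, add_zero,
      zero_add, one_mul]
    linarith
  · exact EReal.add_ne_top (husc x hx).2 (EReal.coe_ne_top _)
  · refine (husc x hx).1.add' (ContinuousWithinAt.upperSemicontinuousWithinAt ?_)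
      (EReal.continuousAt_add (Or.inl (husc x hx).2) (Or.inr (EReal.coe_ne_top _)))
    exact continuous_coe_real_ereal.continuousAt.comp_continuousWithinAt
      (continuousWithinAt_const.mul (hρs x hx).continuousAt.continuousWithinAt)
  · rw [EReal.coe_add, hSdef, EReal.coe_finsetSum]
    congr 1
    refine Finset.sum_congr rfl fun j _ => ?_
    rw [riesz_of_pos (Or.inr hx0), ← EReal.coe_mul, mul_assoc]
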